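/- The ground field is $\mathbb C$. Let $V$ have basis $\{\xi_i\}_{i\ge 1}$ and let $\Lambda(\infty)=\Lambda(V)$ be the Grassmann algebra on the $\xi_i$, with odd superderivations $\partial_i$, $\partial_i(\xi_j)=\delta_{ij}$. Let $\mathfrak g=W(\infty)$ be the Lie superalgebra spanned by all $P\partial_j$ ($P\in\Lambda(\infty)$), under the supercommutator, and let $\mathfrak g^k$ ($k\ge -1$) be the span of the $P\partial_j$ with $P\in\Lambda^{k+1}(V)$; then $\mathfrak g=\bigoplus_k\mathfrak g^k$, and $\mathfrak g^k$ has parity $k$ mod $2$. Identify $\mathfrak g^0$ with $\mathfrak{gl}(\infty)$ (matrices with finitely many nonzero entries) by $\xi_i\partial_j\mapsto E_{i,j}$. Put $\mathfrak g^{\ge}=\bigoplus_{k\ge0}\mathfrak g^k$, $\mathfrak g^{>}=\bigoplus_{k>0}\mathfrak g^k$, $\mathfrak g^{\le}=\mathfrak g^{-1}\oplus\mathfrak g^0$, $\mathfrak g^{<}=\mathfrak g^{-1}$. Let $\mathfrak t_n\subset\mathfrak g$ be the subalgebra generated by the $\xi_{i_1}\cdots\xi_{i_r}\partial_j$ ($r\ge0$)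 with all $i_s,j\ge n$, and $\mathfrak t'_n=\langle E_{i,j}: i,j\ge n\rangle\subset\mathfrak{gl}(\infty)$. A $\mathfrak{gl}(\infty)$-module $M$ is integrable if $\dim\operatorname{span}\{x^im: i\ge0\}<\infty$ for all $x\in\mathfrak{gl}(\infty)$, $m\in M$. The category $\mathbb T_{\mathfrak{gl}(\infty)}$ consists of the integrable $\mathfrak{gl}(\infty)$-modules of finite length in which every vector is annihilated by $\mathfrak t'_n$ for some $n$. The category $\mathbb T_W^{\ge}$ (respectively $\mathbb T_W^{\le}$) consists of the ($\mathbb Z_2$-graded) $\mathfrak g$-modules $M$ such that (1) $M$ has a $\mathbb Z$-grading $M=\bigoplus_k M^k$ with $\mathfrak g^iM^k\subset M^{i+k}$ and with $M^k$ of parity $k$ mod $2$; (2) $M$ is integrable over $\mathfrak g^0$; (3) every $m\in M$ is annihilated by $\mathfrak t_n\cap\mathfrak g^{\ge}$ (respectively $\mathfrak t_n\cap\mathfrak g^{\le}$) for some $n$. For a $\mathfrak{gl}(\infty)$-module $X$, regarded as purely even, let $K^+(X)=\mathbf U(\mathfrak g)\otimes_{\mathbf U(\mathfrak g^{\ge})}X$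 and $K^-(X)=\mathbf U(\mathfrak g)\otimes_{\mathbf U(\mathfrak g^{\le})}X$, where $\mathfrak g^{>}$, respectively $\mathfrak g^{<}$, acts on $X$ by zero. **Theorem.** Let $X\in\mathbb T_{\mathfrak{gl}(\infty)}$. Then $X=\bigoplus_{k\in\mathbb Z}X^k$, where $X^k$ is the sum of the weight spaces $X_\mu$ over the finitely supported integral weights $\mu=\sum_i\mu_i\varepsilon_i$ with $|\mu|:=\sum_i\mu_i=k$. Moreover $K^+(X)$ lies in $\mathbb T_W^{\ge}$ and $K^-(X)$ lies in $\mathbb T_W^{\le}$. More precisely, let $T_+^{j,k}\subset K^+(X)$ (respectively $T_-^{j,k}\subset K^-(X)$) be the span of the $y_1\cdots y_m\otimes x$ with $m\ge0$, $x\in X^k$, and homogeneous $y_s\in\mathfrak g^{<}$ (respectively homogeneous $y_s\in\mathfrak g^{>}$) of degrees of sum $j$, and put $T_\pm^j=\sum_kT_\pm^{j,k}$. Then: (a) $K^\pm(X)=\bigoplus_{j}T_\pm^j$ is a $\mathbb Z$-grading as in (1), with $T_+^j=0$ for $j>0$ and $T_-^j=0$ for $j<0$, and each $T_\pm^j$ is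 in $\mathbb T_{\mathfrak{gl}(\infty)}$; (b) $K^\pm(X)=\bigoplus_{j,k}T_\pm^{j,k}$, with $\mathfrak g^iT_\pm^{j,k}\subset T_\pm^{i+j,k}$; each $T_\pm^{j,k}$ is in $\mathbb T_{\mathfrak{gl}(\infty)}$, and it is the sum of its weight spaces for weights $\mu$ with $|\mu|=j+k$. -/

import Mathlib

open scoped TensorProduct

attribute [local instance 100] LieRing.ofAssociativeRing

noncomputable section

namespace WInfty

/-! ### The Lie algebra `gl(∞)`

The index set `{1, 2, 3, …}` is replaced by `ℕ = {0, 1, 2, …}`. -/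

/-- The natural module, with basis `ξ_i = Finsupp.single i 1`. -/
abbrev V : Type := ℕ →₀ ℂ

/-- The matrix unit `E i j` (written `ξ_i ∂_j`): it sends `ξ_j` to `ξ_i` and kills the other basis
vectors. -/
def E (i j : ℕ) : Module.End ℂ V := (Finsupp.lsingle i).comp (Finsupp.lapply j)

lemma E_apply (i j : ℕ) (v : V) : E i j v = Finsupp.single i (v j) := rfl

lemma E_mul (i j k l : ℕ) : E i j * E k l = if j = k then E i l else 0 := by
  refine LinearMap.ext fun v => ?_
  rw [Module.End.mul_apply, E_apply, E_apply, Finsupp.single_apply]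
  by_cases h : j = k
  · simp [h, E_apply]
  · simp [h, Ne.symm h]

lemma span_E_mul {a b : Module.End ℂ V}
    (ha : a ∈ Submodule.span ℂ (Set.range fun p : ℕ × ℕ => E p.1 p.2))
    (hb : b ∈ Submodule.span ℂ (Set.range fun p : ℕ × ℕ => E p.1 p.2)) :
    a * b ∈ Submodule.span ℂ (Set.range fun p : ℕ × ℕ => E p.1 p.2) := by
  induction ha using Submodule.span_induction with
  | mem x hx =>
    obtain ⟨p, rfl⟩ := hx
    induction hb using Submodule.span_induction with
    | mem y hy =>
      obtain ⟨q, rfl⟩ := hy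
      simp only [E_mul]
      split_ifs
      · exact Submodule.subset_span ⟨(p.1, q.2), rfl⟩
      · exact Submodule.zero_mem _
    | zero => simp
    | add y z _ _ hy hz => rw [mul_add]; exact Submodule.add_mem _ hy hz
    | smul c y _ hy => rw [mul_smul_comm]; exact Submodule.smul_mem _ _ hy
  | zero => simp
  | add y z _ _ hy hz => rw [add_mul]; exact Submodule.add_mem _ hy hz
  | smul c y _ hy => rw [smul_mul_assoc]; exact Submodule.smul_mem _ _ hy

/-- `gl(∞)`: the `ℕ × ℕ` matrices with finitely many nonzero entries, under the commutator. -/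
def gl : LieSubalgebra ℂ (Module.End ℂ V) :=
  { Submodule.span ℂ (Set.range fun p : ℕ × ℕ => E p.1 p.2) with
    lie_mem' := by
      intro a b ha hb
      exact Submodule.sub_mem (Submodule.span ℂ (Set.range fun p : ℕ × ℕ => E p.1 p.2))
        (span_E_mul ha hb) (span_E_mul hb ha) }

lemma E_mem (i j : ℕ) : E i j ∈ gl :=
  Submodule.subset_span (s := Set.range fun p : ℕ × ℕ => E p.1 p.2) ⟨(i, j), rfl⟩

/-- `E i j` as an element of `gl(∞)`. -/
def glE (i j : ℕ) : gl := ⟨E i j, E_mem i j⟩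

/-- The subalgebra `t'_n` of `gl(∞)` generated by the `E i j` with `i, j ≥ n`. -/
def tgl (n : ℕ) : LieSubalgebra ℂ gl :=
  LieSubalgebra.lieSpan ℂ gl {x | ∃ i j, n ≤ i ∧ n ≤ j ∧ x = glE i j}

/-- The category `T_gl(∞)`: `gl(∞)`-modules that have finite length, are integrable, and satisfy the
large annihilator condition. -/
structure InTgl (M : Type*) [AddCommGroup M] [Module ℂ M] [LieRingModule gl M]
    [LieModule ℂ gl M] : Prop where
  /-- There is a finite chain of submodules from `0` to `M` whose steps are simple. -/
  finite_length : ∃ (n : ℕ) (F : ℕ → LieSubmodule ℂ gl M),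
    F 0 = ⊥ ∧ F n = ⊤ ∧ ∀ i < n, F i ⋖ F (i + 1)
  integrable : ∀ (A : gl) (m : M),
    Module.Finite ℂ (Submodule.span ℂ (Set.range fun i : ℕ => (LieModule.toEnd ℂ gl M A ^ i) m))
  lac : ∀ m : M, ∃ n : ℕ, ∀ A ∈ tgl n, ⁅A, m⁆ = 0

/-- The weight space `M_μ` of the diagonal matrices for the integral weight `μ = ∑ μ_i ε_i`. -/
def weightSpace (M : Type*) [AddCommGroup M] [Module ℂ M] [LieRingModule gl M]
    [LieModule ℂ gl M] (μ : ℕ →₀ ℤ) : Submodule ℂ M where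
  carrier := {m | ∀ i, ⁅glE i i, m⁆ = ((μ i : ℤ) : ℂ) • m}
  zero_mem' := by intro i; simp
  add_mem' := by
    intro a b ha hb i
    rw [lie_add, ha i, hb i, smul_add]
  smul_mem' := by
    intro c a ha i
    rw [lie_smul, ha i, smul_comm]

/-- `M^k`, the sum of the weight spaces `M_μ` with `|μ| = ∑ μ_i = k`. -/
def weightDegree (M : Type*) [AddCommGroup M] [Module ℂ M] [LieRingModule gl M]
    [LieModule ℂ gl M] (k : ℤ) : Submodule ℂ M :=
  ⨆ μ : {μ : ℕ →₀ ℤ // (μ.sum fun _ a => a) = k}, weightSpace M μ.1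

/-! ### The Lie superalgebra `W(∞)` -/

/-- The infinite Grassmann algebra. -/
abbrev Lam : Type := ExteriorAlgebra ℂ V

/-- The generator `ξ_i` of the Grassmann algebra. -/
def xi (i : ℕ) : Lam := ExteriorAlgebra.ι ℂ (Finsupp.single i 1)

/-- The odd superderivation `∂_i` of the Grassmann algebra, `∂_i ξ_j = δ_ij`. -/
def del (i : ℕ) : Module.End ℂ Lam :=
  CliffordAlgebra.contractLeft (Q := (0 : QuadraticForm ℂ V)) (Finsupp.lapply i)

/-- The superderivation `P ∂_j`. -/
def vf (P : Lam) (j : ℕ) : Module.End ℂ Lam := LinearMap.mulLeft ℂ P * del j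

/-- `W(∞)`: the span of all `P ∂_j` among the superderivations of the Grassmann algebra. -/
def W : Submodule ℂ (Module.End ℂ Lam) :=
  Submodule.span ℂ {T | ∃ (P : Lam) (j : ℕ), T = vf P j}

/-- The component `W(∞)^k`, spanned by the `P ∂_j` with `P` of degree `k + 1`. It is even when `k`
is even and odd when `k` is odd. -/
def Wdeg (k : ℤ) : Submodule ℂ W :=
  Submodule.span ℂ {y | ∃ d : ℕ, (d : ℤ) = k + 1 ∧ ∃ P ∈ ⋀[ℂ]^d V, ∃ j : ℕ,
    (y : Module.End ℂ Lam) = vf P j}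

/-- The subalgebra `g^≥`. -/
def Wge : Submodule ℂ W := ⨆ k : {k : ℤ // 0 ≤ k}, Wdeg k.1

/-- The subalgebra `g^≤`. -/
def Wle : Submodule ℂ W := ⨆ k : {k : ℤ // k ≤ 0}, Wdeg k.1

/-- The subalgebra `t_n` of `W(∞)` generated by the `ξ_{i_1} ⋯ ξ_{i_r} ∂_j` (`r ≥ 0`) with all
`i_s, j ≥ n`. The span of these elements is already closed under the superbracket. -/
def t (n : ℕ) : Submodule ℂ W :=
  Submodule.span ℂ {y | ∃ (l : List ℕ) (j : ℕ), (∀ i ∈ l, n ≤ i) ∧ n ≤ j ∧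
    (y : Module.End ℂ Lam) = vf (l.map xi).prod j}

/-! ### The universal enveloping superalgebra -/

/-- The sign `(-1)^{kl}` for elements of degrees `k` and `l`. -/
def sgn (k l : ℤ) : ℂ := (((-1 : ℤˣ) ^ (k * l) : ℤˣ) : ℤ)

/-- The defining relations `x y - (-1)^{kl} y x = [x, y]` of the enveloping superalgebra, for
homogeneous `x`, `y`. The bracket `[x, y]` is the supercommutator of operators on the Grassmann
algebra (it lies in `W(∞)`). -/
inductive URel : TensorAlgebra ℂ W → TensorAlgebra ℂ W → Prop
  | bracket (k l : ℤ) (x y z : W) (hx : x ∈ Wdeg k) (hy : y ∈ Wdeg l)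
      (hz : (z : Module.End ℂ Lam) = (x : Module.End ℂ Lam) * y - sgn k l • (y * x)) :
      URel (TensorAlgebra.ι ℂ x * TensorAlgebra.ι ℂ y)
        (sgn k l • (TensorAlgebra.ι ℂ y * TensorAlgebra.ι ℂ x) + TensorAlgebra.ι ℂ z)

/-- The universal enveloping superalgebra `U(W(∞))`. -/
def U : Type := RingQuot URel

instance : Ring U := inferInstanceAs (Ring (RingQuot URel))

instance : Algebra ℂ U := inferInstanceAs (Algebra ℂ (RingQuot URel))

/-- The quotient map from the tensor algebra. -/
def mkU : TensorAlgebra ℂ W →ₐ[ℂ] U := RingQuot.mkAlgHom ℂ URel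

/-- The canonical map `W(∞) → U(W(∞))`. -/
def iU : W →ₗ[ℂ] U := mkU.toLinearMap ∘ₗ TensorAlgebra.ι ℂ

/-- `monomials D c j` is the set of products `y_1 ⋯ y_m` in `U(W(∞))` (`m ≥ 0`) of homogeneous
elements whose degrees lie in `D` and add up to `j`, the sum being taken in `A` along `ℤ → A`. -/
inductive monomials {A : Type} [AddGroupWithOne A] (D : Set ℤ) : A → U → Prop
  | one : monomials D 0 1
  | mul (k : ℤ) (j : A) (y : W) (u : U) (hk : k ∈ D) (hy : y ∈ Wdeg k) (hu : monomials D j u) :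
      monomials D ((k : A) + j) (iU y * u)

/-! ### The embedding of `gl(∞)` as `W(∞)^0` -/

lemma gl_finite (A : gl) :
    {j : ℕ | (A : Module.End ℂ V) (Finsupp.single j 1) ≠ 0}.Finite := by
  obtain ⟨A, hA⟩ := A
  change A ∈ Submodule.span ℂ (Set.range fun p : ℕ × ℕ => E p.1 p.2) at hA
  change {j : ℕ | A (Finsupp.single j 1) ≠ 0}.Finite
  induction hA using Submodule.span_induction with
  | mem x hx =>
    obtain ⟨⟨a, b⟩, rfl⟩ := hx
    refine (Set.finite_singleton b).subset fun j hj => ?_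
    by_contra h
    apply hj
    have : j ≠ b := h
    simp [E_apply, this]
  | zero => simp
  | add x y _ _ hx hy =>
    refine (hx.union hy).subset fun j hj => ?_
    by_contra h
    simp only [Set.mem_union, Set.mem_ofPred_eq, not_or, not_not] at h
    exact hj (by rw [LinearMap.add_apply, h.1, h.2, add_zero])
  | smul c x _ hx =>
    refine hx.subset fun j hj h => hj (by rw [LinearMap.smul_apply, h, smul_zero])

lemma phi_support (A : gl) : (Function.support fun j : ℕ =>
    vf (ExteriorAlgebra.ι ℂ ((A : Module.End ℂ V) (Finsupp.single j 1))) j).Finite := by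
  refine (gl_finite A).subset fun j hj h => hj ?_
  simp [vf, h]

/-- The identification of `gl(∞)` with `W(∞)^0`, `A ↦ ∑_j (A ξ_j) ∂_j`, so `E i j ↦ ξ_i ∂_j`; here
with values in the operators on the Grassmann algebra. -/
def phi : gl →ₗ[ℂ] Module.End ℂ Lam where
  toFun A := ∑ᶠ j : ℕ, vf (ExteriorAlgebra.ι ℂ ((A : Module.End ℂ V) (Finsupp.single j 1))) j
  map_add' A B := by
    rw [← finsum_add_distrib (phi_support A) (phi_support B)]
    refine finsum_congr fun j => ?_
    ext x; simp [vf, add_mul]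
  map_smul' c A := by
    rw [RingHom.id_apply, smul_finsum' c (phi_support A)]
    refine finsum_congr fun j => ?_
    ext x; simp [vf]

lemma phi_E (i j : ℕ) : phi (glE i j) = vf (xi i) j := by
  change ∑ᶠ k : ℕ, vf (ExteriorAlgebra.ι ℂ (E i j (Finsupp.single k 1))) k = _
  rw [finsum_eq_single _ j]
  · simp [E_apply, xi]
  · intro k hk
    simp [E_apply, hk, vf]

lemma vf_mem (P : Lam) (j : ℕ) : vf P j ∈ W := Submodule.subset_span ⟨P, j, rfl⟩

lemma phi_mem (A : gl) : phi A ∈ W :=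
  finsum_induction (· ∈ W) W.zero_mem (fun _ _ => W.add_mem) (fun _ => vf_mem _ _)

/-- The identification of `gl(∞)` with `W(∞)^0`, as a map into `W(∞)`. -/
def phiW : gl →ₗ[ℂ] W := phi.codRestrict W phi_mem

lemma phiW_mem (A : gl) : phiW A ∈ Wdeg 0 := by
  have h : phiW A = ∑ᶠ j : ℕ, (⟨vf (ExteriorAlgebra.ι ℂ
      ((A : Module.End ℂ V) (Finsupp.single j 1))) j, vf_mem _ _⟩ : W) := by
    apply Subtype.ext
    change phi A = W.subtype _
    rw [map_finsum]
    · rfl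
    · refine (gl_finite A).subset fun j hj h => hj ?_
      apply Subtype.ext
      simp [vf, h]
  rw [h]
  refine finsum_induction (· ∈ Wdeg 0) (Submodule.zero_mem _)
    (fun _ _ => Submodule.add_mem _) (fun j => Submodule.subset_span ⟨1, by simp, _, ?_, j, rfl⟩)
  simp [ExteriorAlgebra.exteriorPower]

lemma del_mul (j : ℕ) (v : V) (x : Lam) :
    del j (ExteriorAlgebra.ι ℂ v * x) = v j • x - ExteriorAlgebra.ι ℂ v * del j x :=
  CliffordAlgebra.contractLeft_ι_mul _ _ _

lemma ι_anticomm (v w : V) (x : Lam) :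
    ExteriorAlgebra.ι ℂ v * (ExteriorAlgebra.ι ℂ w * x) =
      -(ExteriorAlgebra.ι ℂ w * (ExteriorAlgebra.ι ℂ v * x)) := by
  rw [← mul_assoc, ← mul_assoc, eq_neg_iff_add_eq_zero, ← add_mul,
    ExteriorAlgebra.ι_add_mul_swap, zero_mul]

lemma vf_ι (i j : ℕ) (v : V) (x : Lam) :
    vf (xi i) j (ExteriorAlgebra.ι ℂ v * x) =
      ExteriorAlgebra.ι ℂ (E i j v) * x + ExteriorAlgebra.ι ℂ v * vf (xi i) j x := by
  have h : E i j v = v j • Finsupp.single i 1 := by simp [E_apply]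
  simp only [vf, Module.End.mul_apply, LinearMap.mulLeft_apply, del_mul, mul_sub, xi]
  rw [ι_anticomm, h, map_smul]
  simp

lemma phi_ι (A : gl) (v : V) (x : Lam) :
    phi A (ExteriorAlgebra.ι ℂ v * x) =
      ExteriorAlgebra.ι ℂ ((A : Module.End ℂ V) v) * x + ExteriorAlgebra.ι ℂ v * phi A x := by
  obtain ⟨A, hA⟩ := A
  change A ∈ Submodule.span ℂ (Set.range fun p : ℕ × ℕ => E p.1 p.2) at hA
  induction hA using Submodule.span_induction with
  | mem y hy =>
    obtain ⟨⟨i, j⟩, rfl⟩ := hy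
    change phi (glE i j) _ = ExteriorAlgebra.ι ℂ (E i j v) * x + _ * phi (glE i j) x
    rw [phi_E, vf_ι]
  | zero =>
    change phi 0 _ = ExteriorAlgebra.ι ℂ ((0 : Module.End ℂ V) v) * x + _ * phi 0 x
    simp
  | add y z hy hz h1 h2 =>
    change phi (⟨y, hy⟩ + ⟨z, hz⟩) _ =
      ExteriorAlgebra.ι ℂ ((y + z) v) * x + _ * phi (⟨y, hy⟩ + ⟨z, hz⟩) x
    rw [map_add, LinearMap.add_apply, LinearMap.add_apply, LinearMap.add_apply, h1, h2, map_add]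
    simp only [add_mul, mul_add]; abel
  | smul c y hy h1 =>
    change phi (c • ⟨y, hy⟩) _ =
      ExteriorAlgebra.ι ℂ ((c • y) v) * x + _ * phi (c • ⟨y, hy⟩) x
    rw [map_smul, LinearMap.smul_apply, LinearMap.smul_apply, LinearMap.smul_apply, h1, map_smul]
    simp

lemma phi_one (A : gl) : phi A 1 = 0 := by
  obtain ⟨A, hA⟩ := A
  change A ∈ Submodule.span ℂ (Set.range fun p : ℕ × ℕ => E p.1 p.2) at hA
  induction hA using Submodule.span_induction with
  | mem y hy =>
    obtain ⟨⟨i, j⟩, rfl⟩ := hy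
    change phi (glE i j) 1 = 0
    rw [phi_E]; simp [vf, del]
  | zero => change phi 0 1 = 0; simp
  | add y z hy hz h1 h2 =>
    change phi (⟨y, hy⟩ + ⟨z, hz⟩) 1 = 0
    rw [map_add, LinearMap.add_apply, h1, h2, add_zero]
  | smul c y hy h1 =>
    change phi (c • ⟨y, hy⟩) 1 = 0
    rw [map_smul, LinearMap.smul_apply, h1, smul_zero]

lemma phi_lie (A B : gl) : phi ⁅A, B⁆ = phi A * phi B - phi B * phi A := by
  refine LinearMap.ext fun x => ?_
  induction x using CliffordAlgebra.left_induction with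
  | algebraMap r =>
    rw [Algebra.algebraMap_eq_smul_one]
    simp [phi_one]
  | add x y hx hy => rw [map_add, map_add, hx, hy]
  | ι_mul x v hx =>
    change phi ⁅A, B⁆ (ExteriorAlgebra.ι ℂ v * x) =
      (phi A * phi B - phi B * phi A) (ExteriorAlgebra.ι ℂ v * x)
    rw [phi_ι, hx]
    simp only [LinearMap.sub_apply, Module.End.mul_apply, phi_ι, map_add, LieSubalgebra.coe_bracket,
      Ring.lie_def, map_sub, sub_mul, mul_sub]
    abel

lemma iU_phiW_lie (A B : gl) :
    iU (phiW ⁅A, B⁆) = iU (phiW A) * iU (phiW B) - iU (phiW B) * iU (phiW A) := by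
  have h : mkU _ = mkU _ := RingQuot.mkAlgHom_rel ℂ (URel.bracket 0 0 (phiW A) (phiW B) (phiW ⁅A, B⁆)
    (phiW_mem A) (phiW_mem B) (by
      change phi ⁅A, B⁆ = phi A * phi B - _ • (phi B * phi A)
      rw [phi_lie]; simp [sgn]))
  have hs : sgn 0 0 = 1 := by simp [sgn]
  rw [hs, one_smul, map_mul, map_add, map_mul] at h
  change iU (phiW A) * iU (phiW B) = iU (phiW B) * iU (phiW A) + iU (phiW ⁅A, B⁆) at h
  rw [h]; abel

/-! ### The categories of `W(∞)`-modules

A `W(∞)`-module is a module over `U(W(∞))` with a parity decomposition `par 0 ⊕ par 1`. -/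

section Modules

variable (M : Type*) [AddCommGroup M] [Module ℂ M] [Module U M] [IsScalarTower ℂ U M]

/-- `par` makes `M` a `ℤ/2`-graded module over `W(∞)`. -/
structure IsSuper (par : ZMod 2 → Submodule ℂ M) : Prop where
  internal : DirectSum.IsInternal par
  act : ∀ (i : ℤ) (y : W), y ∈ Wdeg i → ∀ (a : ZMod 2), ∀ m ∈ par a, iU y • m ∈ par (i + a)

/-- A `ℤ`-grading of the `W(∞)`-module `M` that is compatible with the superalgebra grading. -/
structure IsZGrading (par : ZMod 2 → Submodule ℂ M) (Mk : ℤ → Submodule ℂ M) : Prop where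
  internal : DirectSum.IsInternal Mk
  act : ∀ (i : ℤ) (y : W), y ∈ Wdeg i → ∀ (k : ℤ), ∀ m ∈ Mk k, iU y • m ∈ Mk (i + k)
  parity : ∀ k : ℤ, Mk k ≤ par (k : ZMod 2)

/-- The category of `W(∞)`-modules `M` that have a compatible `ℤ`-grading, are integrable over
`W(∞)^0 = gl(∞)`, and satisfy the large annihilator condition for the subalgebra `s`. -/
structure InT (s : Submodule ℂ W) (par : ZMod 2 → Submodule ℂ M) : Prop where
  super : IsSuper M par
  grading : ∃ Mk : ℤ → Submodule ℂ M, IsZGrading M par Mk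
  integrable : ∀ (A : gl) (m : M),
    Module.Finite ℂ (Submodule.span ℂ (Set.range fun i : ℕ => (iU (phiW A) ^ i) • m))
  lac : ∀ m : M, ∃ n : ℕ, ∀ y ∈ t n ⊓ s, iU y • m = 0

/-- The category `T_W^≥`. -/
abbrev InTWge (par : ZMod 2 → Submodule ℂ M) : Prop := InT M Wge par

/-- The category `T_W^≤`. -/
abbrev InTWle (par : ZMod 2 → Submodule ℂ M) : Prop := InT M Wle par

end Modules

/-! ### Induced modules -/

section Induced

variable (D : Set ℤ) (X : Type*) [AddCommGroup X] [Module ℂ X] [LieRingModule gl X]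
  [LieModule ℂ gl X]

/-- The relations of the tensor product `U(g) ⊗_{U(p)} X`, where `p` is the sum of `W(∞)^0` and of
the `W(∞)^k` with `k ∈ D`, and the latter act on `X` by zero. -/
def indRel : Submodule U (U ⊗[ℂ] X) :=
  Submodule.span U
    ({w | ∃ (u : U) (A : gl) (x : X), w = (u * iU (phiW A)) ⊗ₜ[ℂ] x - u ⊗ₜ[ℂ] ⁅A, x⁆} ∪
     {w | ∃ (u : U) (k : ℤ) (y : W) (x : X), k ∈ D ∧ y ∈ Wdeg k ∧ w = (u * iU y) ⊗ₜ[ℂ] x})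

/-- The induced module `U(g) ⊗_{U(p)} X`, as a quotient of `U(g) ⊗_ℂ X`; `U(p)` is generated by
`p`. -/
def Ind : Type _ := (U ⊗[ℂ] X) ⧸ indRel D X

instance : AddCommGroup (Ind D X) := inferInstanceAs (AddCommGroup ((U ⊗[ℂ] X) ⧸ indRel D X))

instance : Module U (Ind D X) := inferInstanceAs (Module U ((U ⊗[ℂ] X) ⧸ indRel D X))

instance : Module ℂ (Ind D X) := inferInstanceAs (Module ℂ ((U ⊗[ℂ] X) ⧸ indRel D X))

instance : IsScalarTower ℂ U (Ind D X) :=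
  inferInstanceAs (IsScalarTower ℂ U ((U ⊗[ℂ] X) ⧸ indRel D X))

/-- `K^+(X) = Ind_{g^≥}^g X`. -/
abbrev Kplus : Type _ := Ind {k | 0 < k} X

/-- `K^-(X) = Ind_{g^≤}^g X`. -/
abbrev Kminus : Type _ := Ind {k | k < 0} X

/-- `K^±(X)` as a `gl(∞)`-module, by restriction to `W(∞)^0`. -/
instance : LieRingModule gl (Ind D X) where
  bracket A m := iU (phiW A) • m
  add_lie A B m := by
    rw [map_add, map_add, add_smul]
  lie_add A m n := smul_add _ _ _
  leibniz_lie A B m := by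
    change iU (phiW A) • iU (phiW B) • m =
      iU (phiW ⁅A, B⁆) • m + iU (phiW B) • iU (phiW A) • m
    rw [iU_phiW_lie, sub_smul, mul_smul, mul_smul, sub_add_cancel]

instance : LieModule ℂ gl (Ind D X) where
  smul_lie c A m := by
    change iU (phiW (c • A)) • m = c • iU (phiW A) • m
    rw [map_smul, map_smul, smul_assoc]
  lie_smul c A m := smul_algebra_smul_comm _ _ _

variable {D X} in
/-- The class of `u ⊗ x` in the induced module. -/
def tmk (u : U) (x : X) : Ind D X := (indRel D X).mkQ (u ⊗ₜ[ℂ] x)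

/-- The parity on the induced module: `X` is purely even, so `u ⊗ x` has the parity of `u`. -/
def par (a : ZMod 2) : Submodule ℂ (Ind D X) :=
  Submodule.span ℂ {w | ∃ (u : U) (x : X), monomials Set.univ a u ∧ w = tmk u x}

/-- The `gl(∞)`-submodule `T^{j,k}` of the induced module spanned by the `y_1 ⋯ y_m ⊗ x`, with
`x ∈ X^k` and the `y_s` homogeneous of degrees in `C` of sum `j`. (The linear span is already a
`gl(∞)`-submodule.) -/
def T (C : Set ℤ) (j k : ℤ) : LieSubmodule ℂ gl (Ind D X) :=
  LieSubmodule.lieSpan ℂ gl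
    {w | ∃ (u : U) (x : X), monomials C j u ∧ x ∈ weightDegree X k ∧ w = tmk u x}

/-- `T^j = ∑_k T^{j,k}`. -/
def Tdeg (C : Set ℤ) (j : ℤ) : LieSubmodule ℂ gl (Ind D X) := ⨆ k : ℤ, T D X C j k

/-- The submodules `T^{j,k}` of the induced module lie in `T_gl(∞)`, all weights of `T^{j,k}` have
size `j + k`, and the `T^{j,k}` form a bigrading of the `W(∞)`-module, whose first degree gives a
`ℤ`-grading that is compatible with the parity and has components `T^j` in `T_gl(∞)`. -/
structure IsKacGrading (C : Set ℤ) : Prop where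
  grading : IsZGrading (Ind D X) (par D X) fun j => (Tdeg D X C j).toSubmodule
  inTgl : ∀ j, InTgl (Tdeg D X C j)
  refined_internal : DirectSum.IsInternal fun p : ℤ × ℤ => (T D X C p.1 p.2).toSubmodule
  refined_act : ∀ (i : ℤ) (y : W), y ∈ Wdeg i → ∀ j k : ℤ, ∀ m ∈ T D X C j k,
    iU y • m ∈ T D X C (i + j) k
  refined_inTgl : ∀ j k, InTgl (T D X C j k)
  refined_weights : ∀ j k, (T D X C j k).toSubmodule ≤ weightDegree (Ind D X) (j + k)

end Induced

end WInfty

/-! The main difficulty is that `T^j` has finite length; the gradings come from rescaling operators,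
so no PBW basis is needed.

Finite length is proved over `t'_n`, a copy of `gl(∞)` with shifted indices. A subspace is called
tensorial if it is a finite sum of equivariant images of tensor products of copies of `V` and `V_*`.
Invariant subspaces of a tensorial space satisfy both chain conditions (`Tensorial.wellFounded`).
For a single tensor family, keep only the indices `< r`: the commutant of `gl(r)` on mixed tensors
has dimension bounded independently of `r`, and invariant subspaces have invariant complements, so
the equivariant endomorphisms with values in a subspace measure its size by a bounded number.

Every object `X` of `T_gl(∞)` is tensorial over `t'_n` for large `n` (`InTgl.tensorial`). A
composition series reduces this to a cyclic module generated by a vector `v` killed by `t'_n`.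
Filter it by word length. Up to shorter words letters commute, high powers of one letter can be
shortened by integrability, and polarizing with `t'_n` extends this to all letters of the same type.
There are finitely many types, so the filtration stops.

The components of `W(∞)` are tensorial as well (`tensorial_Wdeg`), and a monomial of degree `j` in
letters of degrees of one sign has at most `|j|` letters. Hence `T^j` lies in a tensorial subspace
(`tmk_mem_wordSpan`), and the same holds for all its submodules, in particular the `T^{j,k}`.

For the weights of `X`, a vector is killed by `E j j` for large `j`, and the `sl(2)` spanned by `E i
j`, `E j i` and `E i i - E j j` forces the eigenvalues of `E i i` to be integers and its action to
be diagonalizable (`Sl2Rel.mem_intEigen`, `iSup_weightSpace`).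

The monomials span by straightening (`smul_tmk_mem_monomialSpan`). The sum of the `T^{j,k}` is
direct because scaling degree `k` of `W(∞)` by `2^k` and `X^k` by `3^k` induces an operator with the
distinct eigenvalues `2^j 3^k` on them (`iSupIndep_monomialSpan`). Integrability and the annihilator
conditions propagate from `1 ⊗ X`, since `gl(∞)` acts locally finitely on `W(∞)` and vector fields
in disjoint variables supercommute. -/

namespace WInfty

/-! ### Tensors with covariant and contravariant indices -/

section TensorOp

variable {ι κ : Type*} [Fintype ι] [DecidableEq ι] [DecidableEq κ]
  {M : Type*} [AddCommGroup M] [Module ℂ M]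

/-- The action of the matrix unit `E i j` on the coordinates of a tensor, whose index `s` is
covariant or contravariant according to `ε s`. -/
def tensorOp (ε : ι → Bool) (i j : κ) : ((ι → κ) → M) →ₗ[ℂ] ((ι → κ) → M) where
  toFun c K := ∑ s, if ε s then (if K s = i then c (Function.update K s j) else 0)
    else (if K s = j then -c (Function.update K s i) else 0)
  map_add' c d := by
    funext K
    simp only [Pi.add_apply, ← Finset.sum_add_distrib]
    refine Finset.sum_congr rfl fun s _ => ?_
    split_ifs <;> simp [add_comm]
  map_smul' a c := by
    funext K
    simp only [Pi.smul_apply, RingHom.id_apply, Finset.smul_sum]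
    refine Finset.sum_congr rfl fun s _ => ?_
    split_ifs <;> simp

lemma tensorOp_apply (ε : ι → Bool) (i j : κ) (c : (ι → κ) → M) (K : ι → κ) :
    tensorOp ε i j c K = ∑ s, if ε s then (if K s = i then c (Function.update K s j) else 0)
    else (if K s = j then -c (Function.update K s i) else 0) := rfl

/-- Replacing the entry `i` in slot `s` by `j` is a bijection from the index tuples with `i` in that
slot to those with `j` there. -/
lemma sum_update_smul [Fintype κ] (s : ι) (i j : κ) (c : (ι → κ) → ℂ) (F : (ι → κ) → M) :
    ∑ K : ι → κ, (if K s = i then c (Function.update K s j) else 0) • F K =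
      ∑ K : ι → κ, c K • (if K s = j then F (Function.update K s i) else 0) := by
  simp only [ite_smul, smul_ite, zero_smul, smul_zero]
  rw [← Finset.sum_filter, ← Finset.sum_filter]
  refine Finset.sum_nbij' (fun K => Function.update K s j) (fun K => Function.update K s i)
    ?_ ?_ ?_ ?_ ?_
  · intro K _; simp
  · intro K _; simp
  · intro K hK
    simp only [Finset.mem_filter, Finset.mem_univ, true_and] at hK
    simp [← hK]
  · intro K hK
    simp only [Finset.mem_filter, Finset.mem_univ, true_and] at hK
    simp [← hK]
  · intro K hK
    simp only [Finset.mem_filter, Finset.mem_univ, true_and] at hK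
    simp [← hK]

/-- For the coordinate pairing, the transpose of the action of `E i j` is that of `E j i`. This
yields the equivariance of evaluation maps as well as the invariance of orthogonal complements. -/
lemma sum_tensorOp_smul [Fintype κ] (ε : ι → Bool) (i j : κ) (c : (ι → κ) → ℂ)
    (F : (ι → κ) → M) :
    ∑ K, tensorOp ε i j c K • F K = ∑ K, c K • tensorOp ε j i F K := by
  simp only [tensorOp_apply, Finset.sum_smul, Finset.smul_sum]
  rw [Finset.sum_comm, Finset.sum_comm (s := Finset.univ (α := ι → κ))]
  refine Finset.sum_congr rfl fun s _ => ?_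
  cases ε s
  · have h := sum_update_smul s j i c F
    simp only [Bool.false_eq_true, if_false]
    rw [← neg_inj, ← Finset.sum_neg_distrib, ← Finset.sum_neg_distrib]
    convert h using 2 with K _ K _
    · split_ifs <;> simp
    · split_ifs <;> simp
  · exact sum_update_smul s i j c F

lemma tensorOp_single [Fintype κ] (ε : ι → Bool) (i j : κ) (K : ι → κ) :
    tensorOp ε i j (Pi.single K (1 : ℂ)) =
      tensorOp ε j i (fun L : ι → κ => (Pi.single L (1 : ℂ) : (ι → κ) → ℂ)) K := by
  have h := sum_tensorOp_smul ε i j (Pi.single K (1 : ℂ))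
    (fun L : ι → κ => (Pi.single L (1 : ℂ) : (ι → κ) → ℂ))
  rw [Finset.sum_eq_single (f := fun L => (Pi.single K (1 : ℂ) : (ι → κ) → ℂ) L • _) K
    (fun L _ hL => by rw [Pi.single_eq_of_ne hL, zero_smul])
    (by simp), Pi.single_eq_same, one_smul] at h
  rw [← h]
  funext L
  simp [Finset.sum_apply, Pi.single_apply]

/-- An invariant tensor is determined by its coordinates with small indices. -/
lemma eq_zero_of_tensorOp_eq_zero {r : ℕ} (hr : Fintype.card ι + 1 ≤ r) (ε : ι → Bool)
    (f : (ι → Fin r) → ℂ) (hf : ∀ i j, i ≠ j → tensorOp ε i j f = 0)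
    (h0 : ∀ K : ι → Fin r, (∀ s, (K s : ℕ) < Fintype.card ι + 1) → f K = 0) : f = 0 := by
  classical
  -- Induction on the number of slots that carry a large index.
  suffices h : ∀ (n : ℕ) (K : ι → Fin r),
      (Finset.univ.filter fun s => Fintype.card ι + 1 ≤ (K s : ℕ)).card = n → f K = 0 by
    funext K; exact h _ K rfl
  intro n
  induction n using Nat.strong_induction_on with
  | _ n ih =>
  intro K hK
  by_cases hs : ∀ s, (K s : ℕ) < Fintype.card ι + 1
  · exact h0 K hs
  push Not at hs
  obtain ⟨s₀, hs₀⟩ := hs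
  -- There is one more small value than there are slots, so some small `j` does not occur in `K`.
  obtain ⟨j, hj, hjK⟩ : ∃ j : Fin r, (j : ℕ) < Fintype.card ι + 1 ∧ ∀ s, K s ≠ j := by
    have : ∃ a ∈ Finset.range (Fintype.card ι + 1),
        a ∉ Finset.univ.image fun s => (K s : ℕ) := by
      apply Finset.exists_mem_notMem_of_card_lt_card
      exact Finset.card_image_le.trans_lt (by simp)
    obtain ⟨a, ha, ha'⟩ := this
    simp only [Finset.mem_range] at ha
    refine ⟨⟨a, ha.trans_le hr⟩, ha, fun s hs => ha' ?_⟩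
    simp only [Finset.mem_image, Finset.mem_univ, true_and]
    exact ⟨s, by rw [hs]⟩
  have hne : K s₀ ≠ j := hjK s₀
  -- The invariance equation for `j` and `K s₀`, read at `L`, contains `f K` exactly once: `s₀` is
  -- the only slot of `L` with entry `j`.
  set L := Function.update K s₀ j with hL
  have hLs : ∀ s, L s = j ↔ s = s₀ := by
    intro s
    by_cases h : s = s₀
    · simp [h, hL]
    · simp [h, hL, hjK s]
  have hLK : Function.update L s₀ (K s₀) = K := by simp [hL]
  -- The other terms put `j` into a further slot with entry `K s₀`, and slot `s₀` is now small, so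
  -- the induction hypothesis applies.
  have small : ∀ s, L s = K s₀ → f (Function.update L s j) = 0 := by
    intro s hsL
    have hss : s ≠ s₀ := by
      rintro rfl
      exact hne (by rw [← hsL, hL, Function.update_self])
    refine ih _ ?_ _ rfl
    rw [← hK]
    apply Finset.card_lt_card
    refine (Finset.ssubset_iff_of_subset ?_).2 ⟨s₀, by simpa using hs₀, ?_⟩
    · intro t ht
      simp only [Finset.mem_filter, Finset.mem_univ, true_and] at ht ⊢
      by_cases h1 : t = s
      · subst h1; rw [Function.update_self] at ht; omega
      · rw [Function.update_of_ne h1] at ht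
        by_cases h2 : t = s₀
        · subst h2; exact hs₀
        · rwa [hL, Function.update_of_ne h2] at ht
    · simp only [Finset.mem_filter, Finset.mem_univ, true_and, not_le]
      rw [Function.update_of_ne hss.symm, hL, Function.update_self]
      exact hj
  cases hε : ε s₀
  · have h := congrFun (hf (K s₀) j hne) L
    rw [tensorOp_apply, Finset.sum_eq_single s₀] at h
    · simpa [hε, hLs, hLK] using h
    · intro s _ hs
      split_ifs with h1 h2 h3
      · exact small s h2
      · rfl
      · exact absurd ((hLs s).1 h3) hs
      · rfl
    · simp
  · have h := congrFun (hf j (K s₀) hne.symm) L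
    rw [tensorOp_apply, Finset.sum_eq_single s₀] at h
    · simpa [hε, hLs, hLK] using h
    · intro s _ hs
      split_ifs with h1 h2 h3
      · exact absurd ((hLs s).1 h2) hs
      · rfl
      · rw [small s h3, neg_zero]
      · rfl
    · simp

/-- The endomorphisms that commute with all `tensorOp ε i j`. -/
def commutant (ε : ι → Bool) (r : ℕ) : Submodule ℂ (Module.End ℂ ((ι → Fin r) → ℂ)) where
  carrier := {φ | ∀ i j, φ ∘ₗ tensorOp ε i j = tensorOp ε i j ∘ₗ φ}
  zero_mem' := by intro i j; simp
  add_mem' := by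
    intro a b ha hb i j
    rw [LinearMap.add_comp, LinearMap.comp_add, ha, hb]
  smul_mem' := by
    intro c a ha i j
    rw [LinearMap.smul_comp, LinearMap.comp_smul, ha]

/-- The endomorphisms with range in `Z`. -/
def endInto {E : Type*} [AddCommGroup E] [Module ℂ E] (Z : Submodule ℂ E) :
    Submodule ℂ (Module.End ℂ E) where
  carrier := {φ | ∀ c, φ c ∈ Z}
  zero_mem' _ := Z.zero_mem
  add_mem' ha hb c := Z.add_mem (ha c) (hb c)
  smul_mem' a _ hφ c := Z.smul_mem a (hφ c)

/-- The coordinates of an endomorphism. -/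
def endCoord (r : ℕ) : Module.End ℂ ((ι → Fin r) → ℂ) →ₗ[ℂ] ((ι ⊕ ι → Fin r) → ℂ) where
  toFun φ K := φ (Pi.single (K ∘ Sum.inr) 1) (K ∘ Sum.inl)
  map_add' _ _ := rfl
  map_smul' _ _ := rfl

/-- An equivariant endomorphism is an invariant in the tensor product of the space with its dual.
Dualizing exchanges covariant and contravariant slots, hence `!ε` on the input indices. -/
lemma tensorOp_endCoord (ε : ι → Bool) (r : ℕ) (φ : Module.End ℂ ((ι → Fin r) → ℂ))
    (hφ : φ ∈ commutant ε r) (i j : Fin r) :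
    tensorOp (Sum.elim ε fun s => !ε s) i j (endCoord r φ) = 0 := by
  funext K
  have h1 := congrFun (LinearMap.congr_fun (hφ i j) (Pi.single (K ∘ Sum.inr) 1)) (K ∘ Sum.inl)
  simp only [LinearMap.comp_apply] at h1
  rw [tensorOp_single, tensorOp_apply, map_sum, tensorOp_apply] at h1
  rw [tensorOp_apply, Fintype.sum_sum_type, Pi.zero_apply]
  simp only [Sum.elim_inl, Sum.elim_inr]
  have e1 : ∀ (s : ι) (a : Fin r), Function.update K (Sum.inl s) a ∘ Sum.inl =
      Function.update (K ∘ Sum.inl) s a := fun s a =>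
    Function.update_comp_eq_of_injective K Sum.inl_injective s a
  have e2 : ∀ (s : ι) (a : Fin r), Function.update K (Sum.inr s) a ∘ Sum.inr =
      Function.update (K ∘ Sum.inr) s a := fun s a =>
    Function.update_comp_eq_of_injective K Sum.inr_injective s a
  have e3 : ∀ (s : ι) (a : Fin r), Function.update K (Sum.inl s) a ∘ Sum.inr =
      K ∘ Sum.inr := fun s a => by funext t; simp
  have e4 : ∀ (s : ι) (a : Fin r), Function.update K (Sum.inr s) a ∘ Sum.inl =
      K ∘ Sum.inl := fun s a => by funext t; simp
  simp only [endCoord, LinearMap.coe_mk, AddHom.coe_mk, e1, e2, e3, e4]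
  rw [Finset.sum_apply] at h1
  have h2 : ∀ s, φ (if ε s then
        (if (K ∘ Sum.inr) s = j then Pi.single (Function.update (K ∘ Sum.inr) s i) 1 else 0)
      else (if (K ∘ Sum.inr) s = i then -Pi.single (Function.update (K ∘ Sum.inr) s j) 1 else 0))
        (K ∘ Sum.inl) =
      -(if (!ε s) = true then (if K (Sum.inr s) = i then
        φ (Pi.single (Function.update (K ∘ Sum.inr) s j) 1) (K ∘ Sum.inl) else 0)
      else (if K (Sum.inr s) = j then
        -φ (Pi.single (Function.update (K ∘ Sum.inr) s i) 1) (K ∘ Sum.inl) else 0)) := by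
    intro s
    cases ε s <;> simp only [Function.comp_apply, Bool.not_true, Bool.not_false, if_true,
      Bool.false_eq_true, if_false] <;> split_ifs <;> simp
  simp only [h2, Finset.sum_neg_distrib] at h1
  simp only [Function.comp_apply] at h1 ⊢
  rw [← h1]
  exact neg_add_cancel _

/-- What matters is that the bound does not involve `r`: a commuting endomorphism is determined by
its matrix entries with small indices. -/
lemma finrank_commutant_le {r : ℕ} (hr : Fintype.card (ι ⊕ ι) + 1 ≤ r) (ε : ι → Bool) :
    Module.finrank ℂ (commutant ε r) ≤
      (Fintype.card (ι ⊕ ι) + 1) ^ Fintype.card (ι ⊕ ι) := by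
  let g : commutant ε r →ₗ[ℂ] ((ι ⊕ ι → Fin (Fintype.card (ι ⊕ ι) + 1)) → ℂ) :=
    (LinearMap.funLeft ℂ ℂ fun K => Fin.castLE hr ∘ K) ∘ₗ endCoord r ∘ₗ (commutant ε r).subtype
  have hg : Function.Injective g := by
    suffices H : ∀ φ : commutant ε r, g φ = 0 → φ = 0 by
      intro a b hab
      refine sub_eq_zero.1 (H _ ?_)
      rw [map_sub, hab, sub_self]
    rintro ⟨φ, hφ⟩ h
    have hz : endCoord r φ = 0 := by
      refine eq_zero_of_tensorOp_eq_zero hr (Sum.elim ε fun s => !ε s) _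
        (fun i j _ => tensorOp_endCoord ε r φ hφ i j) fun K hK => ?_
      have := congrFun h fun s => ⟨K s, hK s⟩
      exact this
    apply Subtype.ext
    apply LinearMap.pi_ext'
    intro K'
    apply LinearMap.ext_ring
    funext K
    have := congrFun hz (Sum.elim K K')
    simpa [endCoord] using this
  refine (LinearMap.finrank_le_finrank_of_injective hg).trans ?_
  simp

/-- Invariant subspaces have invariant complements. -/
lemma exists_mem_commutant_projection (ε : ι → Bool) {r : ℕ} (Z : Submodule ℂ ((ι → Fin r) → ℂ))
    (hZ : ∀ i j, ∀ z ∈ Z, tensorOp ε i j z ∈ Z) :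
    ∃ P ∈ commutant ε r, (∀ c, P c ∈ Z) ∧ ∀ z ∈ Z, P z = z := by
  let e : EuclideanSpace ℂ (ι → Fin r) ≃ₗ[ℂ] ((ι → Fin r) → ℂ) := WithLp.linearEquiv 2 ℂ _
  let Y : Submodule ℂ (EuclideanSpace ℂ (ι → Fin r)) := Z.comap e.toLinearMap
  let P : Module.End ℂ ((ι → Fin r) → ℂ) :=
    e.toLinearMap ∘ₗ Y.starProjection.toLinearMap ∘ₗ e.symm.toLinearMap
  have hP : ∀ c, P c ∈ Z := fun c => Y.starProjection_apply_mem (e.symm c)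
  have hPz : ∀ z ∈ Z, P z = z := by
    intro z hz
    have : Y.starProjection (e.symm z) = e.symm z :=
      Submodule.starProjection_eq_self_iff.2 (by simpa [Y] using hz)
    change e (Y.starProjection (e.symm z)) = z
    rw [this, LinearEquiv.apply_symm_apply]
  have hPw : ∀ w, e.symm w ∈ Yᗮ → P w = 0 := by
    intro w hw
    have : Y.starProjection (e.symm w) = 0 := (Submodule.starProjection_apply_eq_zero_iff _).2 hw
    change e (Y.starProjection (e.symm w)) = 0
    rw [this, map_zero]
  have hstar : ∀ (i j : Fin r) (u : (ι → Fin r) → ℂ),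
      tensorOp ε i j (star u) = star (tensorOp ε i j u) := by
    intro i j u
    funext K
    simp only [Pi.star_apply, tensorOp_apply, star_sum]
    refine Finset.sum_congr rfl fun s _ => ?_
    split_ifs <;> simp
  -- For the standard Hermitian form the adjoint of `tensorOp ε i j` is `tensorOp ε j i`, so the
  -- orthogonal complement of an invariant subspace is invariant and the orthogonal projection
  -- commutes with the action.
  have horth : ∀ i j w, e.symm w ∈ Yᗮ → e.symm (tensorOp ε i j w) ∈ Yᗮ := by
    intro i j w hw
    rw [Submodule.mem_orthogonal] at hw ⊢
    intro u hu
    have h := hw (e.symm (tensorOp ε j i (e u))) (by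
      change e (e.symm _) ∈ Z
      rw [LinearEquiv.apply_symm_apply]
      exact hZ j i _ hu)
    rw [PiLp.inner_apply] at h ⊢
    have h1 := sum_tensorOp_smul ε i j w (star (e u))
    rw [hstar] at h1
    rw [← h]
    exact h1
  refine ⟨P, fun i j => LinearMap.ext fun c => ?_, hP, hPz⟩
  have hc : c = P c + (c - P c) := by abel
  have hw : e.symm (c - P c) ∈ Yᗮ := by
    have := Y.sub_starProjection_mem_orthogonal (e.symm c)
    rw [map_sub]
    change e.symm c - e.symm (e (Y.starProjection (e.symm c))) ∈ Yᗮ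
    rwa [LinearEquiv.symm_apply_apply]
  simp only [LinearMap.comp_apply]
  conv_lhs => rw [hc]
  rw [map_add, map_add, hPz _ (hZ i j _ (hP c)), hPw _ (horth i j _ hw), add_zero]

end TensorOp

/-! ### Chains of invariant subspaces in tensor modules -/

section Chains

/-- A strict chain with `B + 2` terms involves finitely many comparisons, so a single large `r`
makes `D r` strictly monotone along it. This is impossible for values in `0, …, B`. -/
lemma wellFounded_of_eventually_rank {α : Type*} [Preorder α] (D : ℕ → α → ℕ) (B : ℕ)
    (hB : ∀ᶠ r in Filter.atTop, ∀ a, D r a ≤ B)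
    (hD : ∀ a b, a < b → ∀ᶠ r in Filter.atTop, D r a < D r b) :
    WellFoundedLT α ∧ WellFoundedGT α := by
  constructor
  · refine ⟨wellFounded_iff_isEmpty_descending_chain.2 ⟨?_⟩⟩
    rintro ⟨f, hf⟩
    have h : ∀ᶠ r in Filter.atTop, ∀ l ∈ Finset.range (B + 1), D r (f (l + 1)) < D r (f l) :=
      (Filter.eventually_all_finset _).2 fun l _ => hD _ _ (hf l)
    obtain ⟨r, h1, h2⟩ := (h.and hB).exists
    have : ∀ l ≤ B + 1, D r (f l) + l ≤ D r (f 0) := by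
      intro l
      induction l with
      | zero => simp
      | succ l ih =>
        intro hl
        have := ih (by omega)
        have := h1 l (by simp; omega)
        omega
    have := this (B + 1) le_rfl
    have := h2 (f 0)
    omega
  · refine ⟨wellFounded_iff_isEmpty_descending_chain.2 ⟨?_⟩⟩
    rintro ⟨f, hf⟩
    have h : ∀ᶠ r in Filter.atTop, ∀ l ∈ Finset.range (B + 1), D r (f l) < D r (f (l + 1)) :=
      (Filter.eventually_all_finset _).2 fun l _ => hD _ _ (hf l)
    obtain ⟨r, h1, h2⟩ := (h.and hB).exists
    have : ∀ l ≤ B + 1, l ≤ D r (f l) := by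
      intro l
      induction l with
      | zero => simp
      | succ l ih =>
        intro hl
        have := ih (by omega)
        have := h1 l (by simp; omega)
        omega
    have := this (B + 1) le_rfl
    have := h2 (f (B + 1))
    omega

variable {M M₁ M₂ M₃ : Type*} [AddCommGroup M] [Module ℂ M] [AddCommGroup M₁] [Module ℂ M₁]
  [AddCommGroup M₂] [Module ℂ M₂] [AddCommGroup M₃] [Module ℂ M₃]

/-- The subspaces of `S` that are invariant under the operators `ρ i j`. -/
abbrev InvariantSubspace (ρ : ℕ → ℕ → Module.End ℂ M) (S : Submodule ℂ M) : Type _ :=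
  {N : Submodule ℂ M // N ≤ S ∧ ∀ i j, ∀ m ∈ N, ρ i j m ∈ N}

/-- `F` is the restriction to basis tensors of an equivariant linear map from a tensor product of
copies of `V` and `V_*`. -/
def IsTensorFamily (ρ : ℕ → ℕ → Module.End ℂ M) {ι : Type} [Fintype ι] [DecidableEq ι]
    (ε : ι → Bool) (F : (ι → ℕ) → M) : Prop :=
  ∀ i j I, ρ i j (F I) = tensorOp ε j i F I

/-- Subspaces that are finite sums of equivariant images of tensor products of copies of `V`
and `V_*`. -/
inductive Tensorial (ρ : ℕ → ℕ → Module.End ℂ M) : Submodule ℂ M → Prop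
  | bot : Tensorial ρ ⊥
  | family (ι : Type) [Fintype ι] [DecidableEq ι] (ε : ι → Bool) (F : (ι → ℕ) → M)
      (hF : IsTensorFamily ρ ε F) : Tensorial ρ (Submodule.span ℂ (Set.range F))
  | sup (S₁ S₂ : Submodule ℂ M) (h₁ : Tensorial ρ S₁) (h₂ : Tensorial ρ S₂) :
      Tensorial ρ (S₁ ⊔ S₂)

lemma Tensorial.invariant {ρ : ℕ → ℕ → Module.End ℂ M} {S : Submodule ℂ M}
    (h : Tensorial ρ S) (i j : ℕ) : ∀ m ∈ S, ρ i j m ∈ S := by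
  induction h with
  | bot => intro m hm; rw [Submodule.mem_bot] at hm; simp [hm]
  | family ι ε F hF =>
    intro m hm
    induction hm using Submodule.span_induction with
    | mem x hx =>
      obtain ⟨I, rfl⟩ := hx
      rw [hF, tensorOp_apply]
      refine Submodule.sum_mem _ fun s _ => ?_
      have : ∀ J, F J ∈ Submodule.span ℂ (Set.range F) := fun J => Submodule.subset_span ⟨J, rfl⟩
      split_ifs
      · exact this _
      · exact Submodule.zero_mem _
      · exact Submodule.neg_mem _ (this _)
      · exact Submodule.zero_mem _
    | zero => simp
    | add x y _ _ hx hy => rw [map_add]; exact Submodule.add_mem _ hx hy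
    | smul c x _ hx => rw [map_smul]; exact Submodule.smul_mem _ _ hx
  | sup S₁ S₂ _ _ h₁ h₂ =>
    intro m hm
    obtain ⟨a, ha, b, hb, rfl⟩ := Submodule.mem_sup.1 hm
    rw [map_add]
    exact Submodule.add_mem_sup (h₁ a ha) (h₂ b hb)

/-- Only finitely many indices occur at a time, so the problem reduces to the spaces of tensors with
indices `< r`, where complete reducibility and the uniform bound on the commutant are available. -/
lemma wellFounded_invariantSubspace_family (ρ : ℕ → ℕ → Module.End ℂ M) {ι : Type} [Fintype ι]
    [DecidableEq ι] (ε : ι → Bool) (F : (ι → ℕ) → M) (hF : IsTensorFamily ρ ε F) :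
    WellFoundedLT (InvariantSubspace ρ (Submodule.span ℂ (Set.range F))) ∧
      WellFoundedGT (InvariantSubspace ρ (Submodule.span ℂ (Set.range F))) := by
  let Ψ : ∀ r : ℕ, ((ι → Fin r) → ℂ) →ₗ[ℂ] M := fun r =>
    { toFun := fun c => ∑ K, c K • F fun s => K s
      map_add' := fun c d => by simp [add_smul, Finset.sum_add_distrib]
      map_smul' := fun a c => by simp [mul_smul, Finset.smul_sum] }
  have hΨ : ∀ r c, Ψ r c = ∑ K, c K • F fun s => K s := fun _ _ => rfl
  have hequiv : ∀ r i j c, Ψ r (tensorOp ε i j c) = ρ i j (Ψ r c) := by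
    intro r i j c
    rw [hΨ, hΨ, sum_tensorOp_smul ε i j c fun K : ι → Fin r => F fun s => K s, map_sum]
    refine Finset.sum_congr rfl fun K _ => ?_
    rw [map_smul, hF, tensorOp_apply, tensorOp_apply]
    congr 1
    refine Finset.sum_congr rfl fun s _ => ?_
    have : ∀ a : Fin r, (fun t => ((Function.update K s a t : Fin r) : ℕ)) =
        Function.update (fun t => (K t : ℕ)) s a := fun a =>
      Function.comp_update (fun x : Fin r => (x : ℕ)) K s a
    simp only [this, Fin.ext_iff]
  -- The rank of `N` at level `r`: the dimension of the space of equivariant endomorphisms of the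
  -- truncated tensor space with values in the preimage of `N`.
  let D : ℕ → InvariantSubspace ρ (Submodule.span ℂ (Set.range F)) → ℕ := fun r N =>
    Module.finrank ℂ (commutant ε r ⊓ endInto (N.1.comap (Ψ r)) :
      Submodule ℂ (Module.End ℂ ((ι → Fin r) → ℂ)))
  refine wellFounded_of_eventually_rank D
    ((Fintype.card (ι ⊕ ι) + 1) ^ Fintype.card (ι ⊕ ι)) ?_ ?_
  · filter_upwards [Filter.eventually_ge_atTop (Fintype.card (ι ⊕ ι) + 1)] with r hr N
    exact (Submodule.finrank_mono inf_le_left).trans (finrank_commutant_le hr ε)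
  · rintro ⟨N₁, h₁, h₁'⟩ ⟨N₂, h₂, h₂'⟩ hlt
    have hle : N₁ ≤ N₂ := hlt.le
    obtain ⟨m, hm₂, hm₁⟩ := SetLike.exists_of_lt (show N₁ < N₂ from hlt)
    -- A vector separating the two subspaces is a combination of finitely many `F I`, and is visible
    -- once `r` exceeds all their indices.
    have hm : ∀ᶠ r in Filter.atTop, m ∈ LinearMap.range (Ψ r) := by
      have := h₂ hm₂
      clear hm₂ hm₁
      induction this using Submodule.span_induction with
      | mem x hx =>
        obtain ⟨I, rfl⟩ := hx
        obtain ⟨R, hR⟩ := (Set.finite_range I).bddAbove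
        filter_upwards [Filter.eventually_gt_atTop R] with r hr
        have hI : ∀ s, I s < r := fun s => (hR ⟨s, rfl⟩).trans_lt hr
        refine ⟨Pi.single (fun s => ⟨I s, hI s⟩) 1, ?_⟩
        rw [hΨ, Finset.sum_eq_single (fun s => ⟨I s, hI s⟩)]
        · simp
        · intro K _ hK; rw [Pi.single_eq_of_ne hK, zero_smul]
        · simp
      | zero => exact Filter.Eventually.of_forall fun r => Submodule.zero_mem _
      | add x y _ _ hx hy =>
        filter_upwards [hx, hy] with r h1 h2 using Submodule.add_mem _ h1 h2
      | smul c x _ hx => filter_upwards [hx] with r h1 using Submodule.smul_mem _ _ h1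
    filter_upwards [hm] with r ⟨c, hc⟩
    apply Submodule.finrank_lt_finrank_of_lt
    refine lt_of_le_of_ne ?_ ?_
    · exact inf_le_inf_left _ fun φ hφ c => hle (hφ c)
    · intro heq
      -- If the ranks came from equal spaces, the invariant projection onto the preimage of `N₂`
      -- would have values in that of `N₁`, so `m` would lie in `N₁`.
      obtain ⟨P, hP, hPZ, hPz⟩ := exists_mem_commutant_projection ε (N₂.comap (Ψ r)) (by
        intro i j z hz
        rw [Submodule.mem_comap, hequiv]
        exact h₂' _ _ _ hz)
      have hP' : P ∈ commutant ε r ⊓ endInto (N₁.comap (Ψ r)) := heq ▸ ⟨hP, hPZ⟩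
      have hcm : c ∈ N₂.comap (Ψ r) := by rwa [Submodule.mem_comap, hc]
      have := hP'.2 c
      rw [hPz c hcm, Submodule.mem_comap, hc] at this
      exact hm₁ this

lemma Tensorial.wellFounded {ρ : ℕ → ℕ → Module.End ℂ M} {S : Submodule ℂ M}
    (h : Tensorial ρ S) :
    WellFoundedLT (InvariantSubspace ρ S) ∧ WellFoundedGT (InvariantSubspace ρ S) := by
  induction h with
  | bot =>
    have : Subsingleton (InvariantSubspace ρ (⊥ : Submodule ℂ M)) :=
      ⟨fun a b => Subtype.ext ((le_bot_iff.1 a.2.1).trans (le_bot_iff.1 b.2.1).symm)⟩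
    exact ⟨inferInstance, inferInstance⟩
  | family ι ε F hF => exact wellFounded_invariantSubspace_family ρ ε F hF
  | sup S₁ S₂ t₁ t₂ h₁ h₂ =>
    -- By the modular law, `N` inside a larger `N'` is determined by the pair of its intersection
    -- with `S₁` and of `(N + S₁) ∩ S₂`, so strict inclusions are detected in one of the two
    -- factors.
    let f : InvariantSubspace ρ (S₁ ⊔ S₂) → InvariantSubspace ρ S₁ × InvariantSubspace ρ S₂ :=
      fun N => (⟨N.1 ⊓ S₁, inf_le_right, fun i j m hm =>
          ⟨N.2.2 i j m hm.1, t₁.invariant i j m hm.2⟩⟩,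
        ⟨(N.1 ⊔ S₁) ⊓ S₂, inf_le_right, fun i j m hm => ⟨by
          obtain ⟨a, ha, b, hb, rfl⟩ := Submodule.mem_sup.1 hm.1
          rw [map_add]
          exact Submodule.add_mem_sup (N.2.2 i j a ha) (t₁.invariant i j b hb),
          t₂.invariant i j m hm.2⟩⟩)
    have hf : StrictMono f := by
      intro N N' hlt
      have hle : N.1 ≤ N'.1 := hlt.le
      refine lt_of_le_of_ne ⟨inf_le_inf_right _ hle,
        inf_le_inf_right _ (sup_le_sup_right hle _)⟩ fun heq => hlt.ne (Subtype.ext ?_)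
      have e1 : N.1 ⊓ S₁ = N'.1 ⊓ S₁ := congrArg Subtype.val (congrArg Prod.fst heq)
      have e2 : (N.1 ⊔ S₁) ⊓ S₂ = (N'.1 ⊔ S₁) ⊓ S₂ :=
        congrArg Subtype.val (congrArg Prod.snd heq)
      have e3 : ∀ L : InvariantSubspace ρ (S₁ ⊔ S₂), L.1 ⊔ S₁ = S₁ ⊔ S₂ ⊓ (L.1 ⊔ S₁) := by
        intro L
        rw [← sup_inf_assoc_of_le S₂ (le_sup_right : S₁ ≤ L.1 ⊔ S₁)]
        exact (inf_eq_right.2 (sup_le L.2.1 le_sup_left)).symm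
      refine eq_of_le_of_inf_le_of_sup_le (z := S₁) hle e1.ge ?_
      rw [e3 N', e3 N, inf_comm S₂, inf_comm S₂, e2]
    have := h₁.1
    have := h₁.2
    have := h₂.1
    have := h₂.2
    exact ⟨hf.wellFoundedLT, hf.wellFoundedGT⟩

end Chains

/-! ### Closure properties of tensorial subspaces. -/

section TensorialClosure

variable {M M₁ M₂ M₃ : Type*} [AddCommGroup M] [Module ℂ M] [AddCommGroup M₁] [Module ℂ M₁]
  [AddCommGroup M₂] [Module ℂ M₂] [AddCommGroup M₃] [Module ℂ M₃]
  {ρ₁ : ℕ → ℕ → Module.End ℂ M₁} {ρ₂ : ℕ → ℕ → Module.End ℂ M₂} {ρ₃ : ℕ → ℕ → Module.End ℂ M₃}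

/-- A trivial line is an image of the empty tensor product, a family with no slots. -/
lemma Tensorial.span_singleton {ρ : ℕ → ℕ → Module.End ℂ M} {m : M} (h : ∀ i j, ρ i j m = 0) :
    Tensorial ρ (Submodule.span ℂ {m}) := by
  have := Tensorial.family (ρ := ρ) Empty (fun _ => true) (fun _ => m) fun i j I => by
    rw [h, tensorOp_apply, Finset.univ_eq_empty, Finset.sum_empty]
  rwa [Set.range_const] at this

lemma Tensorial.finset_sup {ρ : ℕ → ℕ → Module.End ℂ M} {α : Type*} (s : Finset α)
    (S : α → Submodule ℂ M) (h : ∀ a ∈ s, Tensorial ρ (S a)) : Tensorial ρ (s.sup S) := by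
  classical
  induction s using Finset.induction_on with
  | empty => exact Tensorial.bot
  | insert a s _ ih =>
    rw [Finset.sup_insert]
    exact Tensorial.sup _ _ (h a (Finset.mem_insert_self _ _))
      (ih fun b hb => h b (Finset.mem_insert_of_mem hb))

lemma Tensorial.map {S : Submodule ℂ M₁} (h : Tensorial ρ₁ S) (f : M₁ →ₗ[ℂ] M₂)
    (hf : ∀ i j x, ρ₂ i j (f x) = f (ρ₁ i j x)) : Tensorial ρ₂ (S.map f) := by
  induction h with
  | bot => rw [Submodule.map_bot]; exact Tensorial.bot
  | family ι ε F hF =>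
    rw [Submodule.map_span, ← Set.range_comp]
    refine Tensorial.family ι ε (f ∘ F) fun i j I => ?_
    rw [Function.comp_apply, hf, hF, tensorOp_apply, tensorOp_apply, map_sum]
    refine Finset.sum_congr rfl fun s _ => ?_
    split_ifs <;> simp
  | sup S₁ S₂ _ _ h₁ h₂ => rw [Submodule.map_sup]; exact Tensorial.sup _ _ h₁ h₂

/-- The values of `B` on two tensor families form a tensor family over the disjoint union of their
slots. -/
lemma Tensorial.map₂ {S₁ : Submodule ℂ M₁} {S₂ : Submodule ℂ M₂} (h₁ : Tensorial ρ₁ S₁)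
    (h₂ : Tensorial ρ₂ S₂) (B : M₁ →ₗ[ℂ] M₂ →ₗ[ℂ] M₃)
    (hB : ∀ i j x y, ρ₃ i j (B x y) = B (ρ₁ i j x) y + B x (ρ₂ i j y)) :
    Tensorial ρ₃ (Submodule.map₂ B S₁ S₂) := by
  induction h₁ with
  | bot => rw [Submodule.map₂_bot_left]; exact Tensorial.bot
  | sup S S' _ _ h h' => rw [Submodule.map₂_sup_left]; exact Tensorial.sup _ _ h h'
  | family ι ε F hF =>
    induction h₂ with
    | bot => rw [Submodule.map₂_bot_right]; exact Tensorial.bot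
    | sup S S' _ _ h h' => rw [Submodule.map₂_sup_right]; exact Tensorial.sup _ _ h h'
    | family ι' ε' F' hF' =>
      have hr : Set.image2 (fun x y => B x y) (Set.range F) (Set.range F') =
          Set.range fun I : ι ⊕ ι' → ℕ => B (F (I ∘ Sum.inl)) (F' (I ∘ Sum.inr)) := by
        ext z
        constructor
        · rintro ⟨_, ⟨I, rfl⟩, _, ⟨J, rfl⟩, rfl⟩
          exact ⟨Sum.elim I J, by simp⟩
        · rintro ⟨I, rfl⟩
          exact ⟨_, ⟨_, rfl⟩, _, ⟨_, rfl⟩, rfl⟩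
      rw [Submodule.map₂_span_span, hr]
      refine Tensorial.family (ι ⊕ ι') (Sum.elim ε ε') _ fun i j I => ?_
      rw [hB, hF, hF', tensorOp_apply, tensorOp_apply, tensorOp_apply, Fintype.sum_sum_type,
        map_sum, map_sum, LinearMap.sum_apply]
      have e1 : ∀ (s : ι) (a : ℕ), Function.update I (Sum.inl s) a ∘ Sum.inl =
          Function.update (I ∘ Sum.inl) s a := fun s a =>
        Function.update_comp_eq_of_injective I Sum.inl_injective s a
      have e2 : ∀ (s : ι') (a : ℕ), Function.update I (Sum.inr s) a ∘ Sum.inr =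
          Function.update (I ∘ Sum.inr) s a := fun s a =>
        Function.update_comp_eq_of_injective I Sum.inr_injective s a
      have e3 : ∀ (s : ι) (a : ℕ), Function.update I (Sum.inl s) a ∘ Sum.inr =
          I ∘ Sum.inr := fun s a => by funext t; simp
      have e4 : ∀ (s : ι') (a : ℕ), Function.update I (Sum.inr s) a ∘ Sum.inl =
          I ∘ Sum.inl := fun s a => by funext t; simp
      simp only [e1, e2, e3, e4, Sum.elim_inl, Sum.elim_inr, Function.comp_apply]
      congr 1
      · refine Finset.sum_congr rfl fun s _ => ?_
        split_ifs <;> simp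
      · refine Finset.sum_congr rfl fun s _ => ?_
        split_ifs <;> simp

end TensorialClosure

/-! ### The action of `t'_n` on `V`, on its dual, and on `gl(∞)` -/

section Basic

/-- The operators by which the `E i j` with `i, j ≥ n` act on a `gl(∞)`-module, with shifted
indices. -/
def actE (M : Type*) [AddCommGroup M] [Module ℂ M] [LieRingModule gl M] [LieModule ℂ gl M]
    (n i j : ℕ) : Module.End ℂ M := LieModule.toEnd ℂ gl M (glE (n + i) (n + j))

lemma actE_apply (M : Type*) [AddCommGroup M] [Module ℂ M] [LieRingModule gl M]
    [LieModule ℂ gl M] (n i j : ℕ) (m : M) : actE M n i j m = ⁅glE (n + i) (n + j), m⁆ := rfl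

/-- The dual action: `V → V` stands for the restricted dual of `V`, on the dual basis. -/
def dualE (i j : ℕ) : Module.End ℂ V := -E j i

/-- Over `t'_n`, the space splits into `n` trivial lines and a shifted copy of `V` or `V_*`; the
flag `b` tells which. -/
lemma tensorial_top_of_single {ρ : ℕ → ℕ → Module.End ℂ V} (n : ℕ) (b : Bool)
    (h0 : ∀ i j a, a < n → ρ i j (Finsupp.single a 1) = 0)
    (h1 : ∀ i j a, ρ i j (Finsupp.single (n + a) 1) =
      if b then (if a = j then Finsupp.single (n + i) 1 else 0)
        else (if a = i then -Finsupp.single (n + j) 1 else 0)) : Tensorial ρ ⊤ := by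
  have hA : Tensorial ρ ((Finset.range n).sup fun a => Submodule.span ℂ {Finsupp.single a (1 : ℂ)}) :=
    Tensorial.finset_sup _ _ fun a ha => Tensorial.span_singleton fun i j =>
      h0 i j a (Finset.mem_range.1 ha)
  have hB := Tensorial.family (ρ := ρ) Unit (fun _ => b)
    (fun I => (Finsupp.single (n + I ()) 1 : V)) fun i j I => by
      rw [h1, tensorOp_apply]
      simp
  have := Tensorial.sup _ _ hA hB
  convert this
  rw [eq_comm, eq_top_iff]
  intro v _
  induction v using Finsupp.induction_linear with
  | zero => exact Submodule.zero_mem _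
  | add f g hf hg => exact Submodule.add_mem _ (hf trivial) (hg trivial)
  | single a c =>
    have hc : (Finsupp.single a c : V) = c • Finsupp.single a 1 := by simp
    rw [hc]
    refine Submodule.smul_mem _ _ ?_
    by_cases ha : a < n
    · refine Submodule.mem_sup_left ?_
      exact (Finset.le_sup (f := fun a => Submodule.span ℂ {(Finsupp.single a (1 : ℂ) : V)})
        (Finset.mem_range.2 ha)) (Submodule.mem_span_singleton_self _)
    · refine Submodule.mem_sup_right (Submodule.subset_span ⟨fun _ => a - n, ?_⟩)
      simp only
      rw [Nat.add_sub_cancel' (not_lt.1 ha)]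

lemma tensorial_V (n : ℕ) : Tensorial (fun i j => E (n + i) (n + j)) ⊤ := by
  refine tensorial_top_of_single n true ?_ ?_
  · intro i j a ha
    have : a ≠ n + j := by omega
    rw [E_apply, Finsupp.single_apply, if_neg this, Finsupp.single_zero]
  · intro i j a
    rw [E_apply, Finsupp.single_apply]
    simp only [Nat.add_left_cancel_iff, if_true]
    split_ifs <;> simp

lemma tensorial_dual (n : ℕ) : Tensorial (fun i j => dualE (n + i) (n + j)) ⊤ := by
  refine tensorial_top_of_single n false ?_ ?_
  · intro i j a ha
    have : a ≠ n + i := by omega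
    rw [dualE, LinearMap.neg_apply, E_apply, Finsupp.single_apply, if_neg this,
      Finsupp.single_zero, neg_zero]
  · intro i j a
    rw [dualE, LinearMap.neg_apply, E_apply, Finsupp.single_apply]
    simp only [Nat.add_left_cancel_iff, Bool.false_eq_true, if_false]
    split_ifs <;> simp

lemma glE_lie (i j k l : ℕ) : ⁅glE i j, glE k l⁆ =
    (if j = k then glE i l else 0) - (if l = i then glE k j else 0) := by
  apply Subtype.ext
  rw [LieSubalgebra.coe_bracket, Ring.lie_def]
  change E i j * E k l - E k l * E i j = _
  rw [E_mul, E_mul, AddSubgroupClass.coe_sub]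
  split_ifs <;> rfl

/-- The bilinear map `(ξ_i, ξ_j^*) ↦ E i j`. -/
def glB : V →ₗ[ℂ] V →ₗ[ℂ] gl :=
  Finsupp.lsum ℂ fun i => LinearMap.toSpanSingleton ℂ (V →ₗ[ℂ] gl)
    (Finsupp.lsum ℂ fun j => LinearMap.toSpanSingleton ℂ gl (glE i j))

lemma glB_single (i j : ℕ) : glB (Finsupp.single i 1) (Finsupp.single j 1) = glE i j := by
  simp [glB]

lemma ext_single {N : Type*} [AddCommGroup N] [Module ℂ N] {f g : V →ₗ[ℂ] N}
    (h : ∀ a, f (Finsupp.single a 1) = g (Finsupp.single a 1)) : f = g :=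
  Finsupp.lhom_ext' fun a => LinearMap.ext_ring (h a)

lemma glB_equivariant (i j : ℕ) (v w : V) :
    ⁅glE i j, glB v w⁆ = glB (E i j v) w + glB v (dualE i j w) := by
  let A : Module.End ℂ gl := LieModule.toEnd ℂ gl gl (glE i j)
  have h : glB.compr₂ A = glB.comp (E i j) + glB.compl₂ (dualE i j) := by
    refine ext_single fun a => ext_single fun b => ?_
    change ⁅glE i j, glB (Finsupp.single a 1) (Finsupp.single b 1)⁆ =
      glB (E i j (Finsupp.single a 1)) (Finsupp.single b 1) +
        glB (Finsupp.single a 1) (-(E j i (Finsupp.single b 1)))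
    rw [glB_single, glE_lie, E_apply, E_apply, Finsupp.single_apply, Finsupp.single_apply, map_neg,
      sub_eq_add_neg]
    congr 1
    · by_cases h : a = j
      · simp [h, glB_single]
      · simp [h, Ne.symm h]
    · by_cases h : b = i
      · simp [h, glB_single]
      · simp [h]
  exact LinearMap.congr_fun₂ h v w

lemma span_glE : Submodule.span ℂ (Set.range fun p : ℕ × ℕ => glE p.1 p.2) = ⊤ := by
  rw [eq_top_iff]
  rintro ⟨A, hA⟩ -
  change A ∈ Submodule.span ℂ (Set.range fun p : ℕ × ℕ => E p.1 p.2) at hA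
  induction hA using Submodule.span_induction with
  | mem x hx => obtain ⟨p, rfl⟩ := hx; exact Submodule.subset_span ⟨p, rfl⟩
  | zero => exact Submodule.zero_mem _
  | add x y hx hy h1 h2 => exact Submodule.add_mem _ h1 h2
  | smul c x hx h1 => exact Submodule.smul_mem _ c h1

/-- Through `glB`, the adjoint module is an equivariant image of the tensor product of `V` and
`V_*`. -/
lemma tensorial_gl (n : ℕ) : Tensorial (actE gl n) ⊤ := by
  have h := (tensorial_V n).map₂ (ρ₃ := actE gl n) (tensorial_dual n) glB
    fun i j v w => glB_equivariant _ _ v w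
  convert h
  rw [eq_comm, eq_top_iff, ← span_glE, Submodule.span_le]
  rintro _ ⟨p, rfl⟩
  change glE p.1 p.2 ∈ _
  rw [← glB_single]
  exact Submodule.apply_mem_map₂ _ trivial trivial

variable (M : Type*) [AddCommGroup M] [Module ℂ M] [LieRingModule gl M] [LieModule ℂ gl M]

lemma lie_tgl_eq_zero {M : Type*} [AddCommGroup M] [Module ℂ M] [LieRingModule gl M]
    [LieModule ℂ gl M] {n : ℕ} {m : M} (h : ∀ i j, n ≤ i → n ≤ j → ⁅glE i j, m⁆ = 0) :
    ∀ A ∈ tgl n, ⁅A, m⁆ = 0 := by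
  let K : LieSubalgebra ℂ gl :=
    { carrier := {A | ⁅A, m⁆ = 0}
      zero_mem' := zero_lie m
      add_mem' := by
        intro a b ha hb
        simp only [Set.mem_ofPred_eq] at *
        rw [add_lie, ha, hb, add_zero]
      smul_mem' := by
        intro c a ha
        simp only [Set.mem_ofPred_eq] at *
        rw [smul_lie, ha, smul_zero]
      lie_mem' := by
        intro a b ha hb
        change ⁅⁅a, b⁆, m⁆ = 0
        change ⁅a, m⁆ = 0 at ha
        change ⁅b, m⁆ = 0 at hb
        rw [lie_lie, ha, hb, lie_zero, lie_zero, sub_zero] }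
  have : tgl n ≤ K := by
    rw [tgl, LieSubalgebra.lieSpan_le]
    rintro _ ⟨i, j, hi, hj, rfl⟩
    exact h i j hi hj
  exact fun A hA => this hA

lemma glE_mem_tgl {n i j : ℕ} (hi : n ≤ i) (hj : n ≤ j) : glE i j ∈ tgl n :=
  LieSubalgebra.subset_lieSpan ⟨i, j, hi, hj, rfl⟩

/-- A submodule of a tensorial subspace has finite length. -/
lemma Tensorial.exists_chain {M : Type*} [AddCommGroup M] [Module ℂ M] [LieRingModule gl M]
    [LieModule ℂ gl M] {n : ℕ} {S : Submodule ℂ M} (hS : Tensorial (actE M n) S)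
    (N : LieSubmodule ℂ gl M) (hN : N.toSubmodule ≤ S) :
    ∃ (l : ℕ) (F : ℕ → LieSubmodule ℂ gl N),
      F 0 = ⊥ ∧ F l = ⊤ ∧ ∀ i < l, F i ⋖ F (i + 1) := by
  -- Submodules over `gl(∞)` are in particular stable under the `E i j` with `i, j ≥ n`, so the
  -- chain conditions for the smaller algebra suffice.
  let f : LieSubmodule ℂ gl N → InvariantSubspace (actE M n) S := fun L =>
    ⟨L.toSubmodule.map N.toSubmodule.subtype, (Submodule.map_subtype_le _ _).trans hN, by
      rintro i j _ ⟨x, hx, rfl⟩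
      exact ⟨_, L.lie_mem (x := glE (n + i) (n + j)) hx, rfl⟩⟩
  have hf : StrictMono f := by
    intro L L' h
    change L.toSubmodule.map N.toSubmodule.subtype < L'.toSubmodule.map N.toSubmodule.subtype
    exact Submodule.map_strictMono_of_injective (f := N.toSubmodule.subtype)
      N.toSubmodule.injective_subtype (show L.toSubmodule < L'.toSubmodule from h)
  have := hS.wellFounded.1
  have := hS.wellFounded.2
  have := hf.wellFoundedLT
  have := hf.wellFoundedGT
  obtain ⟨F, h0, l, hl, hc⟩ :=
    exists_covBy_seq_of_wellFoundedLT_wellFoundedGT (LieSubmodule ℂ gl N)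
  exact ⟨l, F, isMin_iff_eq_bot.1 h0, isMax_iff_eq_top.1 hl, hc⟩

end Basic

/-! ### Cyclic modules are tensorial -/

section Cyclic

variable {M : Type*} [AddCommGroup M] [Module ℂ M] [LieRingModule gl M] [LieModule ℂ gl M]

/-- The span of the `A_1 ⋯ A_s v` with `s ≤ r` and `A_i` in `gl(∞)`. -/
def orbit (v : M) : ℕ → Submodule ℂ M
  | 0 => Submodule.span ℂ {v}
  | r + 1 => orbit v r ⊔ Submodule.map₂ (LieModule.toEnd ℂ gl M).toLinearMap ⊤ (orbit v r)

/-- The span of the `A_1 ⋯ A_s v` with `s < r`. -/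
def orbitLt (v : M) : ℕ → Submodule ℂ M
  | 0 => ⊥
  | r + 1 => orbit v r

/-- `A_1 ⋯ A_s v`. -/
def word (v : M) : List gl → M
  | [] => v
  | A :: l => ⁅A, word v l⁆

lemma orbit_le_succ (v : M) (r : ℕ) : orbit v r ≤ orbit v (r + 1) := le_sup_left

lemma orbit_mono (v : M) : Monotone (orbit v) := monotone_nat_of_le_succ (orbit_le_succ v)

lemma lie_mem_orbit {v : M} {r : ℕ} (A : gl) {m : M} (hm : m ∈ orbit v r) :
    ⁅A, m⁆ ∈ orbit v (r + 1) :=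
  Submodule.mem_sup_right
    (Submodule.apply_mem_map₂ (LieModule.toEnd ℂ gl M).toLinearMap (Submodule.mem_top (x := A)) hm)

lemma lie_mem_orbitLt {v : M} {r : ℕ} (A : gl) {m : M} (hm : m ∈ orbitLt v r) :
    ⁅A, m⁆ ∈ orbitLt v (r + 1) := by
  cases r with
  | zero =>
    have : m = 0 := hm
    rw [this, lie_zero]; exact Submodule.zero_mem _
  | succ r => exact lie_mem_orbit A hm

lemma word_mem_orbit (v : M) (l : List gl) : word v l ∈ orbit v l.length := by
  induction l with
  | nil => exact Submodule.mem_span_singleton_self v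
  | cons A l ih => exact lie_mem_orbit A ih

/-- Exchanging two adjacent letters costs a word in which both are replaced by their bracket, so
letters commute modulo shorter words. -/
lemma word_sub_mem_of_perm (v : M) {l l' : List gl} (h : l.Perm l') :
    word v l - word v l' ∈ orbitLt v l.length := by
  induction h with
  | nil => simp
  | cons A h ih =>
    have := lie_mem_orbitLt A ih
    rwa [lie_sub] at this
  | swap A B l =>
    change ⁅B, ⁅A, word v l⁆⁆ - ⁅A, ⁅B, word v l⁆⁆ ∈ orbit v (l.length + 1)
    rw [← lie_lie]
    exact lie_mem_orbit _ (word_mem_orbit v l)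
  | trans h1 h2 ih1 ih2 =>
    rw [← sub_add_sub_cancel]
    exact Submodule.add_mem _ ih1 (h1.length_eq ▸ ih2)

/-- The word can be shortened. -/
def Reducible (v : M) (l : List gl) : Prop := word v l ∈ orbitLt v l.length

lemma Reducible.perm {v : M} {l l' : List gl} (hl : Reducible v l) (h : l.Perm l') :
    Reducible v l' := by
  have h1 := word_sub_mem_of_perm v h
  have := Submodule.sub_mem _ hl h1
  rw [sub_sub_cancel, h.length_eq] at this
  exact this

lemma Reducible.append {v : M} {l : List gl} (hl : Reducible v l) (l' : List gl) :
    Reducible v (l' ++ l) := by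
  induction l' with
  | nil => exact hl
  | cons A l' ih => exact lie_mem_orbitLt A ih

/-- Since `v` is invariant under `t'_n`, applying letters to it is an iterated equivariant bilinear
operation with the tensorial module `gl(∞)`. -/
lemma tensorial_orbit {v : M} {n : ℕ} (hv : ∀ i j, n ≤ i → n ≤ j → ⁅glE i j, v⁆ = 0) (r : ℕ) :
    Tensorial (actE M n) (orbit v r) := by
  induction r with
  | zero => exact Tensorial.span_singleton fun i j => hv _ _ (by omega) (by omega)
  | succ r ih =>
    refine Tensorial.sup _ _ ih ((tensorial_gl n).map₂ ih _ fun i j A m => ?_)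
    exact leibniz_lie _ _ _

/-- An element of `t'_n` kills `v`, so it only acts on the letters of a word and does not raise the
length. -/
lemma lie_glE_mem_orbitLt {v : M} {n : ℕ} (hv : ∀ i j, n ≤ i → n ≤ j → ⁅glE i j, v⁆ = 0)
    {i j : ℕ} (hi : n ≤ i) (hj : n ≤ j) (r : ℕ) {m : M} (hm : m ∈ orbitLt v r) :
    ⁅glE i j, m⁆ ∈ orbitLt v r := by
  cases r with
  | zero =>
    have : m = 0 := hm
    rw [this, lie_zero]; exact Submodule.zero_mem _
  | succ r =>
    have := (tensorial_orbit hv r).invariant (i - n) (j - n) m hm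
    rwa [actE_apply, Nat.add_sub_cancel' hi, Nat.add_sub_cancel' hj] at this

omit [Module ℂ M] [LieModule ℂ gl M] in
lemma lie_word_eq_zero {v : M} {D : gl} (hDv : ⁅D, v⁆ = 0) {l : List gl}
    (hl : ∀ z ∈ l, ⁅D, z⁆ = 0) : ⁅D, word v l⁆ = 0 := by
  induction l with
  | nil => exact hDv
  | cons A l ih =>
    change ⁅D, ⁅A, word v l⁆⁆ = 0
    rw [leibniz_lie, hl A (by simp), zero_lie, zero_add,
      ih fun z hz => hl z (List.mem_cons_of_mem _ hz), lie_zero]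

/-- By the Leibniz rule `D` replaces one of the `k + 1` copies of `x` by `c • y`. Moving `y` to the
front changes the word only by shorter words, which explains the factor `k + 1`. -/
lemma lie_word_replicate {v : M} {D x y : gl} {c : ℂ} (hDx : ⁅D, x⁆ = c • y) (hDv : ⁅D, v⁆ = 0)
    {l : List gl} (hl : ∀ z ∈ l, ⁅D, z⁆ = 0) (k : ℕ) :
    ⁅D, word v (List.replicate (k + 1) x ++ l)⁆ -
      ((k + 1 : ℕ) * c) • word v (y :: (List.replicate k x ++ l)) ∈
        orbitLt v (k + 1 + l.length) := by
  induction k with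
  | zero =>
    change ⁅D, ⁅x, word v l⁆⁆ - _ • ⁅y, word v l⁆ ∈ _
    rw [leibniz_lie, hDx, lie_word_eq_zero hDv hl, lie_zero, smul_lie]
    simp
  | succ k ih =>
    have h1 := lie_mem_orbitLt x ih
    have h2 := word_sub_mem_of_perm v (List.Perm.swap y x (List.replicate k x ++ l))
    have h3 := Submodule.add_mem _ h1 (Submodule.smul_mem _ (((k + 1 : ℕ) : ℂ) * c)
      (by convert h2 using 2; simp; omega))
    rw [Nat.add_right_comm (k + 1) 1]
    convert h3 using 1
    change ⁅D, ⁅x, word v (List.replicate (k + 1) x ++ l)⁆⁆ -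
      (((k + 1 + 1 : ℕ) : ℂ) * c) • ⁅y, ⁅x, word v (List.replicate k x ++ l)⁆⁆ = _
    change _ = ⁅x, ⁅D, word v (List.replicate (k + 1) x ++ l)⁆ -
      (((k + 1 : ℕ) : ℂ) * c) • ⁅y, word v (List.replicate k x ++ l)⁆⁆ + (((k + 1 : ℕ) : ℂ) * c) •
      (⁅x, ⁅y, word v (List.replicate k x ++ l)⁆⁆ - ⁅y, ⁅x, word v (List.replicate k x ++ l)⁆⁆)
    rw [leibniz_lie, hDx, smul_lie, lie_sub, lie_smul, smul_sub]
    change c • ⁅y, ⁅x, word v (List.replicate k x ++ l)⁆⁆ + _ - _ = _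
    push_cast
    module

/-- Applying `E i j` to a reducible word gives, up to shorter words, a multiple of the word with one
`x` turned into `y`; the factor `(k + 1) c` is invertible in characteristic zero. -/
lemma Reducible.polarize {v : M} {n : ℕ} (hv : ∀ i j, n ≤ i → n ≤ j → ⁅glE i j, v⁆ = 0)
    {i j : ℕ} (hi : n ≤ i) (hj : n ≤ j) {x y : gl} {c : ℂ} (hc : c ≠ 0)
    (hDx : ⁅glE i j, x⁆ = c • y) {l : List gl} (hl : ∀ z ∈ l, ⁅glE i j, z⁆ = 0) {k : ℕ}
    (h : Reducible v (List.replicate (k + 1) x ++ l)) :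
    Reducible v (List.replicate k x ++ (y :: l)) := by
  have h1 := lie_word_replicate hDx (hv i j hi hj) hl k
  have h2 := lie_glE_mem_orbitLt hv hi hj _ h
  have hlen : (List.replicate (k + 1) x ++ l).length = k + 1 + l.length := by simp
  rw [hlen] at h2
  have h3 := Submodule.sub_mem _ h2 h1
  rw [sub_sub_cancel] at h3
  have hk : (((k + 1 : ℕ) : ℂ) * c) ≠ 0 := mul_ne_zero (by exact_mod_cast k.succ_ne_zero) hc
  rw [Submodule.smul_mem_iff _ hk] at h3
  have h4 : Reducible v (y :: (List.replicate k x ++ l)) := by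
    rw [Reducible]; convert h3 using 2; simp; omega
  exact h4.perm List.perm_middle.symm

/-- Integrability enters here: the length filtration cuts out an increasing sequence of subspaces in
the finite-dimensional span of the `x^i v`, and where it becomes stationary the next power lies in a
smaller step than its length predicts. -/
lemma exists_reducible_replicate (v : M) (x : gl)
    (hfin : Module.Finite ℂ (Submodule.span ℂ
      (Set.range fun i : ℕ => (LieModule.toEnd ℂ gl M x ^ i) v))) :
    ∃ s, ∀ k, s ≤ k → Reducible v (List.replicate k x) := by
  have hw : ∀ k, word v (List.replicate k x) = (LieModule.toEnd ℂ gl M x ^ k) v := by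
    intro k
    induction k with
    | zero => rfl
    | succ k ih =>
      rw [pow_succ', Module.End.mul_apply, ← ih]; rfl
  obtain ⟨s, hs⟩ : ∃ s, Reducible v (List.replicate s x) := by
    let P := Submodule.span ℂ (Set.range fun i : ℕ => (LieModule.toEnd ℂ gl M x ^ i) v)
    have hmono : Monotone (orbitLt v) := monotone_nat_of_le_succ fun k => by
      cases k with
      | zero => exact bot_le
      | succ k => exact orbit_le_succ v k
    let f : ℕ →o Submodule ℂ P :=
      ⟨fun k => (orbitLt v k).comap P.subtype, fun a b h => Submodule.comap_mono (hmono h)⟩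
    have : IsNoetherian ℂ P := isNoetherian_of_isNoetherianRing_of_finite ℂ P
    obtain ⟨s, hs⟩ := monotone_stabilizes_iff_noetherian.2 this f
    have hP : word v (List.replicate s x) ∈ P := by
      rw [hw]; exact Submodule.subset_span ⟨s, rfl⟩
    have h1 : (⟨_, hP⟩ : P) ∈ f (s + 1) := by
      have := word_mem_orbit v (List.replicate s x)
      rwa [List.length_replicate] at this
    rw [← hs (s + 1) (Nat.le_succ s)] at h1
    refine ⟨s, ?_⟩
    rw [Reducible, List.length_replicate]
    exact h1
  refine ⟨s, fun k hk => ?_⟩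
  obtain ⟨d, rfl⟩ := Nat.exists_eq_add_of_le' hk
  rw [List.replicate_add]
  exact hs.append _

/-- The class of `(i, j)`, where all indices `≥ n` are identified. -/
def color (n : ℕ) (p : ℕ × ℕ) : ℕ × ℕ := (min p.1 n, min p.2 n)

/-- A colour with both entries below `n` consists of one letter. If exactly one entry equals `n` and
the other is smaller, all letters of the colour arise from the base letter by polarization with
`t'_n`. The remaining colours are `(n, n)`, whose letters kill `v`, and those that never occur. -/
lemma exists_reducible_color {v : M} {n : ℕ} (hv : ∀ i j, n ≤ i → n ≤ j → ⁅glE i j, v⁆ = 0)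
    (hfin : ∀ x : gl, Module.Finite ℂ (Submodule.span ℂ
      (Set.range fun i : ℕ => (LieModule.toEnd ℂ gl M x ^ i) v))) (c : ℕ × ℕ) :
    ∃ s, ∀ l : List (ℕ × ℕ), (∀ p ∈ l, color n p = c) → s ≤ l.length →
      Reducible v (l.map fun p => glE p.1 p.2) := by
  obtain ⟨a, b⟩ := c
  obtain ⟨s, hs⟩ := exists_reducible_replicate v (glE a b) (hfin _)
  -- the letters equal to the base letter are split off and the other ones polarized
  have key : ∀ f : ℕ → ℕ × ℕ, (f n = (a, b)) →
      (∀ j, n < j → ∃ i k, n ≤ i ∧ n ≤ k ∧ ∃ c : ℂ, c ≠ 0 ∧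
        ⁅glE i k, glE a b⁆ = c • glE (f j).1 (f j).2 ∧
        ∀ j', n < j' → ⁅glE i k, glE (f j').1 (f j').2⁆ = 0) →
      ∀ l : List ℕ, (∀ j ∈ l, n ≤ j) → s ≤ l.length →
        Reducible v (l.map fun j => glE (f j).1 (f j).2) := by
    intro f hfn hf l hl hsl
    have aux : ∀ l : List ℕ, (∀ j ∈ l, n < j) → ∀ t, s ≤ t + l.length →
        Reducible v (List.replicate t (glE a b) ++ l.map fun j => glE (f j).1 (f j).2) := by
      intro l
      induction l with
      | nil => intro _ t ht; rw [List.map_nil, List.append_nil]; exact hs t (by simpa using ht)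
      | cons j l ih =>
        intro hl t ht
        obtain ⟨i, k, hi, hk, c, hc, h1, h2⟩ := hf j (hl j (by simp))
        refine Reducible.polarize hv hi hk hc h1 ?_
          (ih (fun j' hj' => hl j' (List.mem_cons_of_mem _ hj')) (t + 1) (by
            simp at ht; omega))
        intro z hz
        obtain ⟨j', hj', rfl⟩ := List.mem_map.1 hz
        exact h2 j' (hl j' (List.mem_cons_of_mem _ hj'))
    have hperm := (List.filter_append_perm (fun j => decide (j = n)) l)
    have hrep : (l.filter fun j => decide (j = n)).map (fun j => glE (f j).1 (f j).2) =
        List.replicate (l.filter fun j => decide (j = n)).length (glE a b) := by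
      rw [List.eq_replicate_iff]
      refine ⟨by simp, fun z hz => ?_⟩
      obtain ⟨j, hj, rfl⟩ := List.mem_map.1 hz
      have : j = n := by simpa using (List.mem_filter.1 hj).2
      rw [this, hfn]
    have h := aux (l.filter fun j => !decide (j = n)) (fun j hj => by
      obtain ⟨h1, h2⟩ := List.mem_filter.1 hj
      have := hl j h1
      simp at h2
      omega) (l.filter fun j => decide (j = n)).length (by
        have := hperm.length_eq
        rw [List.length_append] at this
        omega)
    rw [← hrep, ← List.map_append] at h
    exact h.perm (hperm.map _)
  have hmap : ∀ (l : List (ℕ × ℕ)) (f : ℕ → ℕ × ℕ) (g : ℕ × ℕ → ℕ),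
      (∀ p ∈ l, f (g p) = p) → (l.map fun p => glE p.1 p.2) =
        (l.map g).map fun j => glE (f j).1 (f j).2 := by
    intro l f g h
    rw [List.map_map]
    refine List.map_congr_left fun p hp => ?_
    simp [h p hp]
  rcases lt_or_ge a n with ha | ha <;> rcases lt_or_ge b n with hb | hb
  · refine ⟨s, fun l hl hsl => ?_⟩
    have : l.map (fun p => glE p.1 p.2) = List.replicate l.length (glE a b) := by
      rw [List.eq_replicate_iff]
      refine ⟨by simp, fun z hz => ?_⟩
      obtain ⟨p, hp, rfl⟩ := List.mem_map.1 hz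
      have := hl p hp
      simp only [color, Prod.mk.injEq] at this
      rw [show p.1 = a by omega, show p.2 = b by omega]
    rw [this]
    exact hs _ hsl
  · by_cases hbn : b = n
    · subst hbn
      refine ⟨s, fun l hl hsl => ?_⟩
      have hl' : ∀ p ∈ l, p.1 = a ∧ b ≤ p.2 := fun p hp => by
        have := hl p hp
        simp only [color, Prod.mk.injEq] at this
        omega
      rw [hmap l (fun j => (a, j)) Prod.snd fun p hp => by rw [← (hl' p hp).1]]
      -- Here `b = n`, and `E b j` sends the base letter `E a b` to `-E a j`; it commutes with every
      -- `E a j'` for `j' > b`.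
      refine key _ rfl (fun j hj => ⟨b, j, le_rfl, hj.le, -1, by simp, ?_, ?_⟩) _ ?_ (by simpa)
      · rw [glE_lie, if_neg (by omega), if_pos rfl]; simp
      · intro j' hj'
        rw [glE_lie, if_neg (by omega), if_neg (by omega), sub_zero]
      · intro j hj
        obtain ⟨p, hp, rfl⟩ := List.mem_map.1 hj
        exact (hl' p hp).2
    -- Colours have entries at most `n`, so no nonempty list has this colour and the bound `1` makes
    -- the claim vacuous.
    · refine ⟨1, fun l hl hsl => ?_⟩
      obtain ⟨p, hp⟩ := List.exists_mem_of_length_pos hsl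
      have := hl p hp
      simp only [color, Prod.mk.injEq] at this
      omega
  · by_cases han : a = n
    · subst han
      refine ⟨s, fun l hl hsl => ?_⟩
      have hl' : ∀ p ∈ l, p.2 = b ∧ a ≤ p.1 := fun p hp => by
        have := hl p hp
        simp only [color, Prod.mk.injEq] at this
        omega
      rw [hmap l (fun j => (j, b)) Prod.fst fun p hp => by rw [← (hl' p hp).1]]
      -- Here `a = n`, and `E j a` sends the base letter `E a b` to `E j b`.
      refine key _ rfl (fun j hj => ⟨j, a, hj.le, le_rfl, 1, by simp, ?_, ?_⟩) _ ?_ (by simpa)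
      · rw [glE_lie, if_pos rfl, if_neg (by omega)]; simp
      · intro j' hj'
        rw [glE_lie, if_neg (by omega), if_neg (by omega), sub_zero]
      · intro j hj
        obtain ⟨p, hp, rfl⟩ := List.mem_map.1 hj
        exact (hl' p hp).2
    · refine ⟨1, fun l hl hsl => ?_⟩
      obtain ⟨p, hp⟩ := List.exists_mem_of_length_pos hsl
      have := hl p hp
      simp only [color, Prod.mk.injEq] at this
      omega
  -- The last letter, the one next to `v`, lies in `t'_n` and kills `v`.
  · refine ⟨1, fun l hl hsl => ?_⟩
    obtain ⟨l', p, rfl⟩ : ∃ l' p, l = l' ++ [p] := by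
      rcases List.eq_nil_or_concat l with h | ⟨l', p, h⟩
      · simp [h] at hsl
      · exact ⟨l', p, by simpa using h⟩
    rw [List.map_append]
    refine Reducible.append ?_ _
    have := hl p (by simp)
    simp only [color, Prod.mk.injEq] at this
    change ⁅glE p.1 p.2, v⁆ ∈ _
    rw [hv p.1 p.2 (by omega) (by omega)]
    exact Submodule.zero_mem _

lemma orbit_le_span_word (v : M) (r : ℕ) : orbit v r ≤ Submodule.span ℂ
    {m | ∃ l : List (ℕ × ℕ), l.length ≤ r ∧ m = word v (l.map fun p => glE p.1 p.2)} := by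
  induction r with
  | zero =>
    rw [orbit, Submodule.span_le, Set.singleton_subset_iff]
    exact Submodule.subset_span ⟨[], le_rfl, rfl⟩
  | succ r ih =>
    refine sup_le (ih.trans (Submodule.span_mono ?_)) ?_
    · rintro _ ⟨l, hl, rfl⟩; exact ⟨l, by omega, rfl⟩
    · rw [← span_glE]
      refine (Submodule.map₂_le_map₂_right ih).trans ?_
      rw [Submodule.map₂_span_span, Submodule.span_le]
      rintro _ ⟨_, ⟨p, rfl⟩, _, ⟨l, hl, rfl⟩, rfl⟩
      exact Submodule.subset_span ⟨p :: l, by simpa using hl, rfl⟩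

lemma length_eq_sum_countP {α β : Type*} [DecidableEq β] (f : α → β) (S : Finset β) (l : List α)
    (hl : ∀ a ∈ l, f a ∈ S) : l.length = ∑ c ∈ S, l.countP fun a => decide (f a = c) := by
  induction l with
  | nil => simp
  | cons a l ih =>
    simp only [List.countP_cons, Finset.sum_add_distrib, List.length_cons]
    rw [← ih fun b hb => hl b (List.mem_cons_of_mem _ hb)]
    simp [hl a (by simp)]

/-- Pigeonhole: among more than `∑ s c` letters some colour `c` occurs more than `s c` times.
Permute those letters next to `v` and shorten that part. -/
lemma exists_orbit_succ_le {v : M} {n : ℕ} (hv : ∀ i j, n ≤ i → n ≤ j → ⁅glE i j, v⁆ = 0)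
    (hfin : ∀ x : gl, Module.Finite ℂ (Submodule.span ℂ
      (Set.range fun i : ℕ => (LieModule.toEnd ℂ gl M x ^ i) v))) :
    ∃ R, orbit v (R + 1) ≤ orbit v R := by
  choose s hs using exists_reducible_color hv hfin
  let S : Finset (ℕ × ℕ) := Finset.range (n + 1) ×ˢ Finset.range (n + 1)
  refine ⟨∑ c ∈ S, s c, (orbit_le_span_word v _).trans ?_⟩
  rw [Submodule.span_le]
  rintro _ ⟨l, hl, rfl⟩
  rcases Nat.lt_or_ge (∑ c ∈ S, s c) l.length with h | h
  · have hlS : ∀ p ∈ l, color n p ∈ S := fun p _ => by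
      simp only [S, color, Finset.mem_product, Finset.mem_range]; omega
    obtain ⟨c, -, hc⟩ : ∃ c ∈ S, s c < l.countP fun p => decide (color n p = c) := by
      refine Finset.exists_lt_of_sum_lt ?_
      rwa [← length_eq_sum_countP (color n) S l hlS]
    have h1 := hs c (l.filter fun p => decide (color n p = c))
      (fun p hp => by simpa using (List.mem_filter.1 hp).2)
      (by rw [← List.countP_eq_length_filter]; exact hc.le)
    have h2 := (h1.append ((l.filter fun p => !decide (color n p = c)).map
      fun p => glE p.1 p.2))
    rw [← List.map_append] at h2
    have h3 := h2.perm ((List.perm_append_comm.trans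
      (List.filter_append_perm (fun p => decide (color n p = c)) l)).map _)
    have hlen : l.length = (∑ c ∈ S, s c) + 1 := by omega
    rw [Reducible, List.length_map, hlen] at h3
    exact h3
  · have := word_mem_orbit v (l.map fun p => glE p.1 p.2)
    rw [List.length_map] at this
    exact orbit_mono v h this

/-- Once one more letter adds nothing, the filtration step is a submodule, so the whole cyclic
module is a single tensorial `orbit v R`. -/
lemma tensorial_lieSpan {v : M} {n : ℕ} (hv : ∀ i j, n ≤ i → n ≤ j → ⁅glE i j, v⁆ = 0)
    (hfin : ∀ x : gl, Module.Finite ℂ (Submodule.span ℂ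
      (Set.range fun i : ℕ => (LieModule.toEnd ℂ gl M x ^ i) v))) :
    Tensorial (actE M n) (LieSubmodule.lieSpan ℂ gl {v}).toSubmodule := by
  obtain ⟨R, hR⟩ := exists_orbit_succ_le hv hfin
  suffices h : (LieSubmodule.lieSpan ℂ gl {v}).toSubmodule = orbit v R by
    rw [h]; exact tensorial_orbit hv R
  apply le_antisymm
  · let N : LieSubmodule ℂ gl M :=
      { orbit v R with lie_mem := fun {A m} hm => hR (lie_mem_orbit A hm) }
    have : LieSubmodule.lieSpan ℂ gl {v} ≤ N := by
      rw [LieSubmodule.lieSpan_le, Set.singleton_subset_iff]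
      exact orbit_mono v (Nat.zero_le R) (Submodule.mem_span_singleton_self v)
    exact this
  · suffices ∀ r, orbit v r ≤ (LieSubmodule.lieSpan ℂ gl {v}).toSubmodule from this R
    intro r
    induction r with
    | zero =>
      rw [orbit, Submodule.span_le, Set.singleton_subset_iff]
      exact LieSubmodule.subset_lieSpan rfl
    | succ r ih =>
      refine sup_le ih (Submodule.map₂_le.2 fun A _ m hm => ?_)
      exact LieSubmodule.lie_mem _ (ih hm)

/-- Objects of `T_gl(∞)` are tensorial. -/
lemma InTgl.tensorial (h : InTgl M) : ∃ n, Tensorial (actE M n) ⊤ := by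
  obtain ⟨l, F, h0, hl, hc⟩ := h.finite_length
  have key : ∀ i ≤ l, ∀ᶠ n in Filter.atTop, Tensorial (actE M n) (F i).toSubmodule := by
    intro i
    induction i with
    | zero =>
      intro _
      rw [h0]
      exact Filter.Eventually.of_forall fun n => Tensorial.bot
    | succ i ih =>
      intro hi
      have hcov := hc i (by omega)
      obtain ⟨v, hv, hv'⟩ := SetLike.exists_of_lt hcov.lt
      -- The quotient `F (i + 1) / F i` is simple, so any vector outside `F i` generates the next
      -- step.
      have hF : F i ⊔ LieSubmodule.lieSpan ℂ gl {v} = F (i + 1) := by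
        refine (hcov.eq_or_eq le_sup_left (sup_le hcov.le ?_)).resolve_left ?_
        · rw [LieSubmodule.lieSpan_le, Set.singleton_subset_iff]
          exact hv
        · intro heq
          apply hv'
          rw [← heq]
          exact (le_sup_right : LieSubmodule.lieSpan ℂ gl {v} ≤ _)
            (LieSubmodule.subset_lieSpan rfl)
      obtain ⟨n₀, hn₀⟩ := h.lac v
      filter_upwards [ih (by omega), Filter.eventually_ge_atTop n₀] with n h1 h2
      rw [← hF, LieSubmodule.sup_toSubmodule]
      exact Tensorial.sup _ _ h1 (tensorial_lieSpan
        (fun a b ha hb => hn₀ _ (glE_mem_tgl (h2.trans ha) (h2.trans hb))) fun x => h.integrable x v)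
  obtain ⟨n, hn⟩ := (key l le_rfl).exists
  rw [hl] at hn
  exact ⟨n, hn⟩

end Cyclic

/-! ### Integrality of weights -/

section Sl2

open Polynomial

variable {M : Type*} [AddCommGroup M] [Module ℂ M]

/-- The sum of the eigenspaces of `h` for integral eigenvalues. -/
def intEigen (h : Module.End ℂ M) : Submodule ℂ M := ⨆ c : ℤ, h.eigenspace (c : ℂ)

lemma aeval_mem {h : Module.End ℂ M} {D : Submodule ℂ M} (hD : ∀ v ∈ D, h v ∈ D) (p : ℂ[X])
    {v : M} (hv : v ∈ D) : aeval h p v ∈ D := by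
  induction p using Polynomial.induction_on' with
  | add p q hp hq => rw [map_add]; exact D.add_mem hp hq
  | monomial n a =>
    rw [aeval_monomial, Module.End.mul_apply, Module.algebraMap_end_apply]
    refine D.smul_mem a ?_
    induction n with
    | zero => simpa using hv
    | succ n ih => rw [pow_succ', Module.End.mul_apply]; exact hD _ ih

lemma mem_of_isCoprime {h : Module.End ℂ M} {D : Submodule ℂ M} (hD : ∀ v ∈ D, h v ∈ D)
    {p q : ℂ[X]} (hpq : IsCoprime p q) {v : M} (hp : aeval h p v ∈ D) (hq : aeval h q v ∈ D) :
    v ∈ D := by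
  obtain ⟨a, b, hab⟩ := hpq
  have h1 := D.add_mem (aeval_mem hD a hp) (aeval_mem hD b hq)
  rwa [← Module.End.mul_apply, ← Module.End.mul_apply, ← map_mul, ← map_mul,
    ← LinearMap.add_apply, ← map_add, hab, map_one, Module.End.one_apply] at h1

/-- Distinct linear factors are coprime, so they can be split off one by one. The stable subspace
`B` later records the weights found for other diagonal matrices. -/
lemma mem_iSup_eigenspace_of_prod {h : Module.End ℂ M} {B : Submodule ℂ M}
    (hB : ∀ v ∈ B, h v ∈ B) (s : Finset ℤ) {v : M} (hv : v ∈ B)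
    (hs : aeval h (∏ c ∈ s, (X - C (c : ℂ))) v = 0) :
    v ∈ ⨆ c : ℤ, B ⊓ h.eigenspace (c : ℂ) := by
  have hD : ∀ v ∈ ⨆ c : ℤ, B ⊓ h.eigenspace (c : ℂ), h v ∈ ⨆ c : ℤ, B ⊓ h.eigenspace (c : ℂ) := by
    intro v hv
    induction hv using Submodule.iSup_induction' with
    | mem c x hx =>
      rw [Module.End.mem_eigenspace_iff.1 hx.2]
      exact Submodule.smul_mem _ _ (Submodule.mem_iSup_of_mem c hx)
    | zero => simp
    | add x y _ _ hx hy => rw [map_add]; exact Submodule.add_mem _ hx hy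
  induction s using Finset.induction_on generalizing v with
  | empty =>
    simp only [Finset.prod_empty, map_one, Module.End.one_apply] at hs
    simp [hs]
  | insert a s ha ih =>
    rw [Finset.prod_insert ha] at hs
    refine mem_of_isCoprime hD (p := X - C (a : ℂ)) (q := ∏ c ∈ s, (X - C (c : ℂ))) ?_ ?_ ?_
    · refine IsCoprime.prod_right fun c hc => isCoprime_X_sub_C_of_isUnit_sub ?_
      rw [isUnit_iff_ne_zero, sub_ne_zero]
      exact fun hac => ha (Int.cast_injective hac ▸ hc)
    · refine ih (aeval_mem hB _ hv) ?_
      rwa [← Module.End.mul_apply, ← map_mul, mul_comm]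
    · refine Submodule.mem_iSup_of_mem a ⟨aeval_mem hB _ hv, ?_⟩
      rw [map_mul, Module.End.mul_apply, map_sub, aeval_X, aeval_C, LinearMap.sub_apply,
        Module.algebraMap_end_apply, sub_eq_zero] at hs
      exact Module.End.mem_eigenspace_iff.2 hs

lemma exists_prod_of_mem_intEigen {h : Module.End ℂ M} {v : M} (hv : v ∈ intEigen h) :
    ∃ s : Finset ℤ, aeval h (∏ c ∈ s, (X - C (c : ℂ))) v = 0 := by
  induction hv using Submodule.iSup_induction' with
  | mem c x hx =>
    refine ⟨{c}, ?_⟩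
    rw [Finset.prod_singleton, map_sub, aeval_X, aeval_C, LinearMap.sub_apply,
      Module.algebraMap_end_apply, sub_eq_zero]
    exact Module.End.mem_eigenspace_iff.1 hx
  | zero => exact ⟨∅, by simp⟩
  | add x y _ _ hx hy =>
    obtain ⟨s, hs⟩ := hx
    obtain ⟨t, ht⟩ := hy
    refine ⟨s ∪ t, ?_⟩
    have key : ∀ (s u : Finset ℤ) (z : M), s ⊆ u → aeval h (∏ c ∈ s, (X - C (c : ℂ))) z = 0 →
        aeval h (∏ c ∈ u, (X - C (c : ℂ))) z = 0 := by
      intro s u z hsu hz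
      rw [← Finset.prod_sdiff hsu, map_mul, Module.End.mul_apply, hz, map_zero]
    rw [map_add, key s _ x Finset.subset_union_left hs, key t _ y Finset.subset_union_right ht,
      add_zero]

/-- The relations of `sl(2)`. -/
structure Sl2Rel (e f h : Module.End ℂ M) : Prop where
  he : ∀ v, h (e v) = e (h v) + (2 : ℂ) • e v
  hf : ∀ v, h (f v) = f (h v) - (2 : ℂ) • f v
  ef : ∀ v, e (f v) = f (e v) + h v

variable {e f h : Module.End ℂ M}

lemma Sl2Rel.symm (t : Sl2Rel e f h) : Sl2Rel f e (-h) where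
  he v := by simp only [LinearMap.neg_apply, t.hf, map_neg]; abel
  hf v := by simp only [LinearMap.neg_apply, t.he, map_neg]; abel
  ef v := by rw [LinearMap.neg_apply, t.ef]; abel

lemma Sl2Rel.e_mem (t : Sl2Rel e f h) : ∀ v ∈ intEigen h, e v ∈ intEigen h := by
  intro v hv
  induction hv using Submodule.iSup_induction' with
  | mem c x hx =>
    refine Submodule.mem_iSup_of_mem (c + 2) (Module.End.mem_eigenspace_iff.2 ?_)
    rw [t.he, Module.End.mem_eigenspace_iff.1 hx, map_smul]
    push_cast
    module
  | zero => simp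
  | add x y _ _ hx hy => rw [map_add]; exact Submodule.add_mem _ hx hy

lemma intEigen_neg (h : Module.End ℂ M) : intEigen (-h) = intEigen h := by
  have key : ∀ h : Module.End ℂ M, intEigen (-h) ≤ intEigen h := fun h =>
    iSup_le fun c x hx => Submodule.mem_iSup_of_mem (-c) (Module.End.mem_eigenspace_iff.2 (by
      have := Module.End.mem_eigenspace_iff.1 hx
      rw [LinearMap.neg_apply, neg_eq_iff_eq_neg] at this
      rw [this]; push_cast; module))
  refine le_antisymm (key h) ?_
  have := key (-h)
  rwa [neg_neg] at this

lemma Sl2Rel.f_mem (t : Sl2Rel e f h) : ∀ v ∈ intEigen h, f v ∈ intEigen h := by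
  have := t.symm.e_mem
  rwa [intEigen_neg] at this

lemma h_mem : ∀ v ∈ intEigen h, h v ∈ intEigen h := by
  intro v hv
  induction hv using Submodule.iSup_induction' with
  | mem c x hx =>
    rw [Module.End.mem_eigenspace_iff.1 hx]
    exact Submodule.smul_mem _ _ (Submodule.mem_iSup_of_mem c hx)
  | zero => simp
  | add x y _ _ hx hy => rw [map_add]; exact Submodule.add_mem _ hx hy

lemma pow_mem {D : Submodule ℂ M} (hD : ∀ v ∈ D, e v ∈ D) (k : ℕ) {v : M} (hv : v ∈ D) :
    (e ^ k) v ∈ D := by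
  induction k with
  | zero => exact hv
  | succ k ih => rw [pow_succ', Module.End.mul_apply]; exact hD _ ih

lemma Sl2Rel.h_pow_f (t : Sl2Rel e f h) (k : ℕ) (v : M) :
    h ((f ^ k) v) = (f ^ k) (h v) - (2 * k : ℂ) • (f ^ k) v := by
  induction k with
  | zero => simp
  | succ k ih =>
    rw [pow_succ', Module.End.mul_apply, t.hf, ih, map_sub, map_smul, Module.End.mul_apply]
    push_cast
    module

lemma Sl2Rel.e_pow_f (t : Sl2Rel e f h) {u : M} (hu : e u = 0) (k : ℕ) :
    e ((f ^ (k + 1)) u) = (k + 1 : ℂ) • (f ^ k) (h u - (k : ℂ) • u) := by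
  induction k with
  | zero => simp [t.ef, hu]
  | succ k ih =>
    rw [pow_succ' f (k + 1), Module.End.mul_apply, t.ef, ih, t.h_pow_f]
    have h1 : ∀ x, f ((f ^ k) x) = (f ^ (k + 1)) x := fun x => by
      rw [pow_succ', Module.End.mul_apply]
    rw [map_smul, h1, map_sub, map_sub, map_smul, map_smul]
    push_cast
    module

/-- If `e u = 0` then also `e (h u - k u) = 0`, so `Sl2Rel.e_pow_f` can be iterated. -/
lemma Sl2Rel.pow_e_pow_f (t : Sl2Rel e f h) (k : ℕ) {u : M} (hu : e u = 0) :
    (e ^ k) ((f ^ k) u) =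
      (k.factorial : ℂ) • aeval h (∏ i ∈ Finset.range k, (X - C (i : ℂ))) u := by
  induction k generalizing u with
  | zero => simp
  | succ k ih =>
    have hu' : e (h u - (k : ℂ) • u) = 0 := by
      have := t.he u
      rw [hu, map_zero, smul_zero, add_zero] at this
      rw [map_sub, map_smul, hu, ← this, smul_zero, sub_zero]
    have hX : aeval h (X - C (k : ℂ)) u = h u - (k : ℂ) • u := by
      rw [map_sub, aeval_X, aeval_C, LinearMap.sub_apply, Module.algebraMap_end_apply]
    rw [pow_succ e, Module.End.mul_apply, t.e_pow_f hu, map_smul, ih hu', Finset.prod_range_succ,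
      map_mul, Module.End.mul_apply, hX, smul_smul, Nat.factorial_succ]
    push_cast
    rfl

lemma Sl2Rel.aeval_pow_e (t : Sl2Rel e f h) (p : ℂ[X]) (r : ℕ) (v : M) :
    aeval h p ((e ^ r) v) = (e ^ r) (aeval h (p.comp (X + C (2 * r : ℂ))) v) := by
  have h1 : ∀ v, h ((e ^ r) v) = (e ^ r) ((h + algebraMap ℂ _ (2 * r : ℂ)) v) := by
    intro v
    induction r generalizing v with
    | zero => simp
    | succ r ih =>
      rw [pow_succ, Module.End.mul_apply, ih, Module.End.mul_apply, LinearMap.add_apply,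
        LinearMap.add_apply, t.he, Module.algebraMap_end_apply, Module.algebraMap_end_apply,
        map_add (f := e), map_smul]
      congr 1
      push_cast
      module
  have h2 : aeval h (p.comp (X + C (2 * r : ℂ))) = aeval (h + algebraMap ℂ _ (2 * r : ℂ)) p := by
    rw [aeval_comp, map_add, aeval_X, aeval_C]
  rw [h2]
  induction p using Polynomial.induction_on' with
  | add p q hp hq =>
    have hp := hp (by rw [aeval_comp, map_add, aeval_X, aeval_C])
    have hq := hq (by rw [aeval_comp, map_add, aeval_X, aeval_C])
    rw [map_add, map_add, LinearMap.add_apply, LinearMap.add_apply, map_add, hp, hq]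
  | monomial n a =>
    rw [aeval_monomial, aeval_monomial, Module.End.mul_apply, Module.End.mul_apply,
      Module.algebraMap_end_apply, Module.algebraMap_end_apply, map_smul]
    congr 1
    clear h2
    induction n with
    | zero => simp
    | succ n ih => rw [pow_succ', Module.End.mul_apply, ih, h1, pow_succ', Module.End.mul_apply]

/-- For a highest weight vector with `f^k u = 0`, applying `e^k` shows that `h (h - 1) ⋯ (h - k +
1)` kills `u`. -/
lemma Sl2Rel.mem_of_e_eq_zero (t : Sl2Rel e f h) {u : M} (hu : e u = 0) {k : ℕ}
    (hf : (f ^ k) u = 0) : u ∈ intEigen h := by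
  have h1 := t.pow_e_pow_f k hu
  rw [hf, map_zero, eq_comm, smul_eq_zero] at h1
  have h2 := h1.resolve_left (by exact_mod_cast k.factorial_ne_zero)
  have := mem_iSup_eigenspace_of_prod (h := h) (B := ⊤) (fun _ _ => trivial)
    ((Finset.range k).map ⟨Nat.cast, Nat.cast_injective⟩) (v := u) trivial (by
      rw [Finset.prod_map]; simpa using h2)
  simpa [intEigen] using this

/-- Modulo the integral eigenspaces of `h`, a vector killed by a power of `e` only sees eigenvalues
with negative real part. The symmetric statement for `f` excludes these as well. -/
lemma Sl2Rel.exists_neg_poly (t : Sl2Rel e f h) {A : Submodule ℂ M} (hAe : ∀ v ∈ A, e v ∈ A)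
    (hAf : ∀ v ∈ A, f v ∈ A) (hAh : ∀ v ∈ A, h v ∈ A) (hnil : ∀ v ∈ A, ∃ k, (f ^ k) v = 0)
    (r : ℕ) : ∀ v ∈ A, (e ^ r) v = 0 →
      ∃ p : ℂ[X], (∀ z, p.eval z = 0 → z.re < 0) ∧ aeval h p v ∈ intEigen h := by
  induction r with
  | zero =>
    intro v _ hv
    exact ⟨1, by simp, by simp at hv; simp [hv]⟩
  | succ r ih =>
    intro v hv hr
    have hu : e ((e ^ r) v) = 0 := by rwa [← Module.End.mul_apply, ← pow_succ']
    have huA : (e ^ r) v ∈ A := pow_mem hAe r hv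
    obtain ⟨k, hk⟩ := hnil _ huA
    have huD : (e ^ r) v ∈ intEigen h := t.mem_of_e_eq_zero hu hk
    -- Moving `h` past `e^r` shifts it by `2 r`, so `P` has the roots `i - 2 r` with `0 ≤ i < r`,
    -- all negative. The shift is chosen so that `f^r e^r v - r! P(h) v` is killed by `e^r`.
    set P : ℂ[X] := (∏ i ∈ Finset.range r, (X - C (i : ℂ))).comp (X + C (2 * r : ℂ)) with hP
    have hw : (e ^ r) ((f ^ r) ((e ^ r) v) - (r.factorial : ℂ) • aeval h P v) = 0 := by
      rw [map_sub, map_smul, t.pow_e_pow_f r hu, t.aeval_pow_e, sub_self]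
    obtain ⟨p, hp, hpw⟩ := ih _ (A.sub_mem (pow_mem hAf r huA)
      (A.smul_mem _ (aeval_mem hAh P hv))) hw
    refine ⟨p * P, ?_, ?_⟩
    · intro z hz
      rw [eval_mul, mul_eq_zero] at hz
      rcases hz with hz | hz
      · exact hp z hz
      · rw [hP, eval_comp, eval_prod, Finset.prod_eq_zero_iff] at hz
        obtain ⟨i, hi, hz⟩ := hz
        simp only [eval_sub, eval_add, eval_X, eval_C] at hz
        have hre := congrArg Complex.re hz
        simp at hre
        have : (i : ℝ) < r := by exact_mod_cast Finset.mem_range.1 hi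
        have : (0 : ℝ) ≤ r := Nat.cast_nonneg r
        linarith
    · rw [map_sub, map_smul] at hpw
      have h1 := (intEigen h).sub_mem (aeval_mem h_mem p (pow_mem t.f_mem r huD)) hpw
      rw [sub_sub_cancel, Submodule.smul_mem_iff _ (by exact_mod_cast r.factorial_ne_zero)] at h1
      rwa [map_mul, Module.End.mul_apply]

/-- If `e` and `f` are locally nilpotent then `h` is diagonalizable with integral eigenvalues. -/
lemma Sl2Rel.mem_intEigen (t : Sl2Rel e f h) {A : Submodule ℂ M} (hAe : ∀ v ∈ A, e v ∈ A)
    (hAf : ∀ v ∈ A, f v ∈ A) (hAh : ∀ v ∈ A, h v ∈ A) (hne : ∀ v ∈ A, ∃ k, (e ^ k) v = 0)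
    (hnf : ∀ v ∈ A, ∃ k, (f ^ k) v = 0) {v : M} (hv : v ∈ A) : v ∈ intEigen h := by
  obtain ⟨r, hr⟩ := hne v hv
  obtain ⟨s, hs⟩ := hnf v hv
  obtain ⟨p, hp, hpv⟩ := t.exists_neg_poly hAe hAf hAh hnf r v hv hr
  obtain ⟨q, hq, hqv⟩ := t.symm.exists_neg_poly hAf hAe
    (fun v hv => by rw [LinearMap.neg_apply]; exact A.neg_mem (hAh v hv)) hne s v hv hs
  rw [intEigen_neg] at hqv
  -- The roots of `p` have negative and those of `q(-X)` positive real part, so the two are coprime.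
  refine mem_of_isCoprime h_mem (p := p) (q := q.comp (-X)) ?_ hpv ?_
  · refine (Polynomial.isCoprime_iff_aeval_ne_zero_of_isAlgClosed ℂ ℂ _ _).2 fun z => ?_
    by_contra! hz
    obtain ⟨h1, h2⟩ := hz
    rw [coe_aeval_eq_eval] at h1 h2
    rw [eval_comp, eval_neg, eval_X] at h2
    have := hp z h1
    have := hq _ h2
    rw [Complex.neg_re] at this
    linarith
  · rwa [aeval_comp, map_neg, aeval_X]

/-- Nonzero vectors `e^k x` would be eigenvectors of `g` for pairwise different eigenvalues, hence
independent, against local finiteness of `e`. -/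
lemma exists_pow_eq_zero_of_shift {e g : Module.End ℂ M} {d : ℤ} (hd : d ≠ 0)
    (hge : ∀ v, g (e v) = e (g v) + (d : ℂ) • e v)
    (hfin : ∀ v, Module.Finite ℂ (Submodule.span ℂ (Set.range fun i : ℕ => (e ^ i) v)))
    {v : M} (hv : v ∈ intEigen g) : ∃ k, (e ^ k) v = 0 := by
  induction hv using Submodule.iSup_induction' with
  | mem c x hx =>
    by_contra! h
    have hxk : ∀ k : ℕ, g ((e ^ k) x) = ((c : ℂ) + k * d) • (e ^ k) x := by
      intro k
      induction k with
      | zero => simpa using Module.End.mem_eigenspace_iff.1 hx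
      | succ k ih =>
        rw [pow_succ', Module.End.mul_apply, hge, ih, map_smul]
        push_cast
        module
    have hli : LinearIndependent ℂ fun k : ℕ => (e ^ k) x := by
      refine Module.End.eigenvectors_linearIndependent' g (fun k : ℕ => (c : ℂ) + k * d) ?_ _
        fun k => ⟨Module.End.mem_eigenspace_iff.2 (hxk k), h k⟩
      intro a b hab
      have hd' : (d : ℂ) ≠ 0 := by exact_mod_cast hd
      simpa [hd'] using hab
    have := hfin x
    have := Module.Finite.finite_basis (Module.Basis.span hli)
    exact not_finite ℕ
  | zero => exact ⟨0, by simp⟩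
  | add x y _ _ hx hy =>
    obtain ⟨a, ha⟩ := hx
    obtain ⟨b, hb⟩ := hy
    refine ⟨a + b, ?_⟩
    have h1 : (e ^ (a + b)) x = 0 := by
      rw [add_comm, pow_add, Module.End.mul_apply, ha, map_zero]
    have h2 : (e ^ (a + b)) y = 0 := by rw [pow_add, Module.End.mul_apply, hb, map_zero]
    rw [map_add, h1, h2, add_zero]

lemma shift_mem_intEigen {e g : Module.End ℂ M} {d : ℤ}
    (hge : ∀ v, g (e v) = e (g v) + (d : ℂ) • e v) {v : M} (hv : v ∈ intEigen g) :
    e v ∈ intEigen g := by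
  induction hv using Submodule.iSup_induction' with
  | mem c x hx =>
    refine Submodule.mem_iSup_of_mem (c + d) (Module.End.mem_eigenspace_iff.2 ?_)
    rw [hge, Module.End.mem_eigenspace_iff.1 hx, map_smul]
    push_cast
    module
  | zero => simp
  | add x y _ _ hx hy => rw [map_add]; exact Submodule.add_mem _ hx hy

end Sl2

/-! ### Weight decomposition of integrable modules with large annihilators. -/

section Weights

variable {M : Type*} [AddCommGroup M] [Module ℂ M] [LieRingModule gl M] [LieModule ℂ gl M]

/-- The operator by which `E i j` acts. -/
abbrev opE (M : Type*) [AddCommGroup M] [Module ℂ M] [LieRingModule gl M] [LieModule ℂ gl M]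
    (i j : ℕ) : Module.End ℂ M := LieModule.toEnd ℂ gl M (glE i j)

lemma opE_opE (i j k l : ℕ) (v : M) : opE M i j (opE M k l v) = opE M k l (opE M i j v) +
    ((if j = k then opE M i l v else 0) - (if l = i then opE M k j v else 0)) := by
  change ⁅glE i j, ⁅glE k l, v⁆⁆ = ⁅glE k l, ⁅glE i j, v⁆⁆ + _
  rw [leibniz_lie, glE_lie, sub_lie, add_comm]
  congr 2 <;> split_ifs <;> simp

/-- The eigenvalues of `E i i - E j j` are integral by `sl(2)` theory, and where `E j j` vanishes
they are those of `E i i`. The `sl(2)` argument is run on the sum of the integral eigenspaces of `E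
j j`, where `E i j` and `E j i` shift eigenvalues and so are locally nilpotent. -/
lemma exists_prod_opE_eq_zero
    (hfin : ∀ (A : gl) (m : M), Module.Finite ℂ (Submodule.span ℂ
      (Set.range fun i : ℕ => (LieModule.toEnd ℂ gl M A ^ i) m)))
    {i j : ℕ} (hij : i ≠ j) {m : M} (hm : opE M j j m = 0) :
    ∃ s : Finset ℤ, Polynomial.aeval (opE M i i)
      (∏ c ∈ s, (Polynomial.X - Polynomial.C (c : ℂ))) m = 0 := by
  have hji := hij.symm
  have t : Sl2Rel (opE M i j) (opE M j i) (opE M i i - opE M j j) := by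
    constructor
    · intro v
      rw [LinearMap.sub_apply, LinearMap.sub_apply, opE_opE i i i j, opE_opE j j i j, map_sub]
      simp [hji]
      module
    · intro v
      rw [LinearMap.sub_apply, LinearMap.sub_apply, opE_opE i i j i, opE_opE j j j i, map_sub]
      simp [hij]
      module
    · intro v
      rw [opE_opE i j j i]
      simp
  have h1 : ∀ v, opE M j j (opE M i j v) = opE M i j (opE M j j v) + ((-1 : ℤ) : ℂ) • opE M i j v := by
    intro v; rw [opE_opE j j i j]; simp [hji]
  have h2 : ∀ v, opE M j j (opE M j i v) = opE M j i (opE M j j v) + ((1 : ℤ) : ℂ) • opE M j i v := by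
    intro v; rw [opE_opE j j j i]; simp [hij]
  have h3 : ∀ v, opE M j j (opE M i i v) = opE M i i (opE M j j v) + ((0 : ℤ) : ℂ) • opE M i i v := by
    intro v; rw [opE_opE j j i i]; simp [hij, hji]
  have hmA : m ∈ intEigen (opE M j j) :=
    Submodule.mem_iSup_of_mem 0 (Module.End.mem_eigenspace_iff.2 (by simpa using hm))
  have hD : m ∈ intEigen (opE M i i - opE M j j) :=
    t.mem_intEigen (A := intEigen (opE M j j)) (fun v hv => shift_mem_intEigen h1 hv)
      (fun v hv => shift_mem_intEigen h2 hv)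
      (fun v hv => Submodule.sub_mem _ (shift_mem_intEigen h3 hv) (h_mem v hv))
      (fun v hv => exists_pow_eq_zero_of_shift (by norm_num) h1 (hfin _) hv)
      (fun v hv => exists_pow_eq_zero_of_shift (by norm_num) h2 (hfin _) hv) hmA
  obtain ⟨s, hs⟩ := exists_prod_of_mem_intEigen hD
  refine ⟨s, ?_⟩
  rw [← hs]
  -- `E j j` commutes with `E i i`, so it vanishes on all `(E i i)^n m`, and both operators have the
  -- same powers on `m`.
  have hp : ∀ n : ℕ, opE M j j ((opE M i i ^ n) m) = 0 ∧
      ((opE M i i - opE M j j) ^ n) m = (opE M i i ^ n) m := by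
    intro n
    induction n with
    | zero => exact ⟨hm, rfl⟩
    | succ n ih =>
      rw [pow_succ', pow_succ', Module.End.mul_apply, Module.End.mul_apply, ih.2,
        LinearMap.sub_apply, ih.1, sub_zero, h3, ih.1]
      simp
  induction (∏ c ∈ s, (Polynomial.X - Polynomial.C (c : ℂ))) using Polynomial.induction_on' with
  | add p q hp hq => rw [map_add, map_add, LinearMap.add_apply, LinearMap.add_apply, hp, hq]
  | monomial n a =>
    rw [Polynomial.aeval_monomial, Polynomial.aeval_monomial, Module.End.mul_apply,
      Module.End.mul_apply, (hp n).2]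

/-- The vectors that have weight `μ` for the `E i i` with `i < k` or `n ≤ i`. -/
def partialWeight (M : Type*) [AddCommGroup M] [Module ℂ M] [LieRingModule gl M]
    [LieModule ℂ gl M] (n k : ℕ) (μ : ℕ →₀ ℤ) : Submodule ℂ M :=
  ⨅ i : {i : ℕ // i < k ∨ n ≤ i}, (opE M i.1 i.1).eigenspace ((μ i.1 : ℤ) : ℂ)

lemma mem_partialWeight {n k : ℕ} {μ : ℕ →₀ ℤ} {m : M} : m ∈ partialWeight M n k μ ↔
    ∀ i, i < k ∨ n ≤ i → opE M i i m = ((μ i : ℤ) : ℂ) • m := by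
  simp [partialWeight, Submodule.mem_iInf]

/-- A vector killed by `t'_n` has weight zero in all positions `≥ n`. The positions below `n` are
then diagonalized one at a time. -/
lemma iSup_weightSpace
    (hfin : ∀ (A : gl) (m : M), Module.Finite ℂ (Submodule.span ℂ
      (Set.range fun i : ℕ => (LieModule.toEnd ℂ gl M A ^ i) m)))
    (hlac : ∀ m : M, ∃ n : ℕ, ∀ A ∈ tgl n, ⁅A, m⁆ = 0) : ⨆ μ, weightSpace M μ = ⊤ := by
  rw [eq_top_iff]
  intro m _
  obtain ⟨n, hn⟩ := hlac m
  have key : ∀ k ≤ n, m ∈ ⨆ μ : {μ : ℕ →₀ ℤ // ∀ i, n ≤ i → μ i = 0}, partialWeight M n k μ.1 := by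
    intro k
    induction k with
    | zero =>
      intro _
      refine Submodule.mem_iSup_of_mem ⟨0, by simp⟩ (mem_partialWeight.2 fun i hi => ?_)
      have hi : n ≤ i := by simpa using hi
      simpa using hn _ (glE_mem_tgl hi hi)
    | succ k ih =>
      intro hk
      suffices hle : ⨆ μ : {μ : ℕ →₀ ℤ // ∀ i, n ≤ i → μ i = 0}, partialWeight M n k μ.1 ≤
          ⨆ μ : {μ : ℕ →₀ ℤ // ∀ i, n ≤ i → μ i = 0}, partialWeight M n (k + 1) μ.1 from
        hle (ih (by omega))
      refine iSup_le fun μ w hw => ?_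
      rw [mem_partialWeight] at hw
      -- Position `n` serves as the partner of `k` in the `sl(2)`, since its weight is known to be
      -- zero.
      obtain ⟨s, hs⟩ := exists_prod_opE_eq_zero hfin (i := k) (j := n) (by omega) (m := w) (by
        rw [hw n (Or.inr le_rfl), μ.2 n le_rfl]; simp)
      have hst : ∀ v ∈ partialWeight M n k μ.1, opE M k k v ∈ partialWeight M n k μ.1 := by
        intro v hv
        rw [mem_partialWeight] at hv ⊢
        intro i hi
        have hik : i ≠ k := by omega
        rw [opE_opE]
        simp [hik, hik.symm, hv i hi]
      have hw' := mem_iSup_eigenspace_of_prod hst s (mem_partialWeight.2 hw) hs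
      suffices hle : ⨆ c : ℤ, partialWeight M n k μ.1 ⊓ (opE M k k).eigenspace (c : ℂ) ≤
          ⨆ μ : {μ : ℕ →₀ ℤ // ∀ i, n ≤ i → μ i = 0}, partialWeight M n (k + 1) μ.1 from
        hle hw'
      refine iSup_le fun c v hv => ?_
      refine Submodule.mem_iSup_of_mem ⟨μ.1.update k c, fun i hi => ?_⟩
        (mem_partialWeight.2 fun i hi => ?_)
      · rw [Finsupp.update_apply, if_neg (by omega), μ.2 i hi]
      · rw [Finsupp.update_apply]
        split_ifs with h
        · rw [h]; exact Module.End.mem_eigenspace_iff.1 hv.2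
        · exact mem_partialWeight.1 hv.1 i (by omega)
  suffices hle : ⨆ μ : {μ : ℕ →₀ ℤ // ∀ i, n ≤ i → μ i = 0}, partialWeight M n n μ.1 ≤
      ⨆ μ, weightSpace M μ from hle (key n le_rfl)
  refine iSup_le fun μ w hw => ?_
  exact Submodule.mem_iSup_of_mem μ.1 fun i => mem_partialWeight.1 hw i (by omega)

lemma iSup_weightDegree (h : ⨆ μ, weightSpace M μ = ⊤) : ⨆ k, weightDegree M k = ⊤ := by
  rw [eq_top_iff, ← h]
  exact iSup_le fun μ => le_iSup_of_le (μ.sum fun _ a => a) (le_iSup_of_le ⟨μ, rfl⟩ le_rfl)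

lemma iSupIndep_weightSpace : iSupIndep fun μ : ℕ →₀ ℤ => weightSpace M μ := by
  have hcomm : ∀ i j, Commute (opE M i i) (opE M j j) := by
    intro i j
    refine LinearMap.ext fun v => ?_
    rw [Module.End.mul_apply, Module.End.mul_apply, opE_opE]
    by_cases h : i = j
    · simp [h]
    · simp [h, Ne.symm h]
  have h1 := Module.End.independent_iInf_maxGenEigenspace_of_forall_mapsTo
    (fun i : ℕ => opE M i i) fun i j φ =>
      Module.End.mapsTo_maxGenEigenspace_of_comm (hcomm j i) φ
  have h2 := h1.comp (f := fun μ : ℕ →₀ ℤ => fun i => ((μ i : ℤ) : ℂ)) (by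
    intro μ ν h
    ext i
    have := congrFun h i
    simpa using this)
  refine h2.mono fun μ m hm => ?_
  rw [Function.comp_apply, Submodule.mem_iInf]
  intro i
  have h3 : m ∈ (opE M i i).eigenspace ((μ i : ℤ) : ℂ) := Module.End.mem_eigenspace_iff.2 (hm i)
  exact (Module.End.genEigenspace_le_maximal _ _ 1) h3

lemma iSupIndep_weightDegree : iSupIndep (weightDegree M) := by
  intro k
  have h := iSupIndep_weightSpace (M := M).disjoint_biSup_biSup
    (s := {μ | (μ.sum fun _ a => a) = k}) (t := {μ | (μ.sum fun _ a => a) ≠ k})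
    (by rw [Set.disjoint_left]; intro μ h1 h2; exact h2 h1)
  refine h.mono ?_ ?_
  · exact iSup_le fun μ => le_iSup₂_of_le μ.1 μ.2 le_rfl
  · exact iSup₂_le fun l hl => iSup_le fun μ => le_iSup₂_of_le μ.1 (by
      change _ ≠ _; rw [μ.2]; exact hl) le_rfl

/-- The decomposition by total weight. -/
lemma InTgl.isInternal_weightDegree (h : InTgl M) : DirectSum.IsInternal (weightDegree M) :=
  (DirectSum.isInternal_submodule_iff_iSupIndep_and_iSup_eq_top _).2
    ⟨iSupIndep_weightDegree, iSup_weightDegree (iSup_weightSpace h.integrable h.lac)⟩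

lemma lie_glE_mem_weightSpace {μ : ℕ →₀ ℤ} {m : M} (hm : m ∈ weightSpace M μ) (i j : ℕ) :
    ⁅glE i j, m⁆ ∈ weightSpace M (μ + Finsupp.single i 1 - Finsupp.single j 1) := by
  intro k
  have := opE_opE k k i j m
  change ⁅glE k k, ⁅glE i j, m⁆⁆ = ⁅glE i j, ⁅glE k k, m⁆⁆ + _ at this
  rw [this, hm k, lie_smul]
  simp only [Finsupp.sub_apply, Finsupp.add_apply, Finsupp.single_apply]
  by_cases h1 : i = k <;> by_cases h2 : j = k
  · subst h1; subst h2; simp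
  · subst h1
    rw [if_pos rfl, if_neg h2, if_pos rfl, if_neg h2]
    push_cast
    change _ + (⁅glE i j, m⁆ - 0) = _
    module
  · subst h2
    rw [if_neg (Ne.symm h1), if_pos rfl, if_neg h1, if_pos rfl]
    push_cast
    change _ + (0 - ⁅glE i j, m⁆) = _
    module
  · rw [if_neg (Ne.symm h1), if_neg h2, if_neg h1, if_neg h2]
    simp

lemma lie_mem_weightDegree {k : ℤ} {m : M} (hm : m ∈ weightDegree M k) (A : gl) :
    ⁅A, m⁆ ∈ weightDegree M k := by
  have hA : A ∈ Submodule.span ℂ (Set.range fun p : ℕ × ℕ => glE p.1 p.2) := by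
    rw [span_glE]; trivial
  induction hA using Submodule.span_induction with
  | mem x hx =>
    obtain ⟨p, rfl⟩ := hx
    induction hm using Submodule.iSup_induction' with
    | mem μ m hm =>
      refine Submodule.mem_iSup_of_mem ⟨_, ?_⟩ (lie_glE_mem_weightSpace hm p.1 p.2)
      rw [Finsupp.sum_sub_index (fun _ _ _ => rfl), Finsupp.sum_add_index (by simp) (by simp),
        Finsupp.sum_single_index rfl, Finsupp.sum_single_index rfl, μ.2]
      ring
    | zero => simp
    | add x y _ _ hx hy => rw [lie_add]; exact Submodule.add_mem _ hx hy
  | zero => simp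
  | add x y _ _ hx hy => rw [add_lie]; exact Submodule.add_mem _ hx hy
  | smul c x _ hx => rw [smul_lie]; exact Submodule.smul_mem _ _ hx

end Weights

/-! ### Monomials in the Grassmann algebra -/

section Grassmann

/-- The monomial `ξ_{i_1} ⋯ ξ_{i_r}`. -/
def xiL (l : List ℕ) : Lam := (l.map xi).prod

@[simp] lemma xiL_nil : xiL [] = 1 := rfl

lemma xiL_cons (i : ℕ) (l : List ℕ) : xiL (i :: l) = xi i * xiL l := by simp [xiL]

lemma range_ι_eq_span : LinearMap.range (ExteriorAlgebra.ι ℂ : V →ₗ[ℂ] Lam) =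
    Submodule.span ℂ (Set.range xi) := by
  apply le_antisymm
  · rintro _ ⟨v, rfl⟩
    induction v using Finsupp.induction_linear with
    | zero => simp
    | add f g hf hg => rw [map_add]; exact Submodule.add_mem _ hf hg
    | single a c =>
      have : (Finsupp.single a c : V) = c • Finsupp.single a 1 := by simp
      rw [this, map_smul]
      exact Submodule.smul_mem _ _ (Submodule.subset_span ⟨a, rfl⟩)
  · rw [Submodule.span_le]
    rintro _ ⟨i, rfl⟩
    exact ⟨_, rfl⟩

lemma exteriorPower_eq_span (d : ℕ) :
    ⋀[ℂ]^d V = Submodule.span ℂ {x | ∃ l : List ℕ, l.length = d ∧ x = xiL l} := by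
  rw [ExteriorAlgebra.exteriorPower, range_ι_eq_span]
  induction d with
  | zero =>
    rw [pow_zero, Submodule.one_eq_span]
    congr 1
    ext x
    constructor
    · rintro rfl; exact ⟨[], rfl, rfl⟩
    · rintro ⟨l, hl, rfl⟩; rw [List.length_eq_zero_iff.1 hl]; rfl
  | succ d ih =>
    rw [pow_succ', ih, Submodule.span_mul_span]
    congr 1
    ext x
    constructor
    · rintro ⟨_, ⟨i, rfl⟩, _, ⟨l, hl, rfl⟩, rfl⟩
      exact ⟨i :: l, by simp [hl], (xiL_cons i l).symm⟩
    · rintro ⟨l, hl, rfl⟩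
      obtain ⟨i, l, rfl⟩ := List.exists_cons_of_length_eq_add_one hl
      exact ⟨xi i, ⟨i, rfl⟩, xiL l, ⟨l, by simpa using hl, rfl⟩, (xiL_cons i l).symm⟩

lemma xiL_mem (l : List ℕ) : xiL l ∈ ⋀[ℂ]^l.length V := by
  rw [exteriorPower_eq_span]; exact Submodule.subset_span ⟨l, rfl, rfl⟩

lemma mul_mem_exteriorPower {p q : ℕ} {P Q : Lam} (hP : P ∈ ⋀[ℂ]^p V) (hQ : Q ∈ ⋀[ℂ]^q V) :
    P * Q ∈ ⋀[ℂ]^(p + q) V := by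
  have := Submodule.mul_mem_mul hP hQ
  rwa [ExteriorAlgebra.exteriorPower, ExteriorAlgebra.exteriorPower, ← pow_add] at this

lemma span_xiL : Submodule.span ℂ (Set.range xiL) = ⊤ := by
  rw [eq_top_iff]
  intro x _
  induction x using CliffordAlgebra.left_induction with
  | algebraMap r =>
    rw [Algebra.algebraMap_eq_smul_one]
    exact Submodule.smul_mem _ _ (Submodule.subset_span ⟨[], rfl⟩)
  | add x y hx hy => exact Submodule.add_mem _ (hx trivial) (hy trivial)
  | ι_mul x v hx =>
    have hx := hx trivial
    have hv : (ExteriorAlgebra.ι ℂ v : Lam) ∈ Submodule.span ℂ (Set.range xi) := by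
      rw [← range_ι_eq_span]; exact ⟨v, rfl⟩
    have := Submodule.mul_mem_mul hv hx
    rw [Submodule.span_mul_span] at this
    refine Submodule.span_mono ?_ this
    rintro _ ⟨_, ⟨i, rfl⟩, _, ⟨l, rfl⟩, rfl⟩
    exact ⟨i :: l, xiL_cons i l⟩

lemma del_xi_mul (i j : ℕ) (x : Lam) :
    del j (xi i * x) = (if i = j then x else 0) - xi i * del j x := by
  rw [xi, del_mul, Finsupp.single_apply]
  split_ifs <;> simp

lemma del_one (j : ℕ) : del j 1 = 0 := by simp [del]

lemma del_del (i j : ℕ) (x : Lam) : del i (del j x) = -del j (del i x) :=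
  CliffordAlgebra.contractLeft_comm _ _ _

lemma del_xiL_mul (j : ℕ) (l : List ℕ) (x : Lam) :
    del j (xiL l * x) = del j (xiL l) * x + (-1 : ℂ) ^ l.length • (xiL l * del j x) := by
  induction l generalizing x with
  | nil => simp [del_one]
  | cons i l ih =>
    rw [xiL_cons, mul_assoc, del_xi_mul, ih, del_xi_mul, List.length_cons, pow_succ]
    simp only [mul_add, sub_mul, mul_smul_comm, mul_assoc, ite_mul, zero_mul, mul_neg, mul_one,
      neg_smul]
    abel

lemma xi_mul_xiL (i : ℕ) (l : List ℕ) :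
    xi i * xiL l = (-1 : ℂ) ^ l.length • (xiL l * xi i) := by
  induction l with
  | nil => simp
  | cons j l ih =>
    have h : xi i * (xi j * xiL l) = -(xi j * (xi i * xiL l)) := ι_anticomm _ _ _
    rw [xiL_cons, h, ih, List.length_cons, pow_succ]
    simp [mul_assoc]

lemma xiL_mul_comm (l l' : List ℕ) :
    xiL l * xiL l' = (-1 : ℂ) ^ (l.length * l'.length) • (xiL l' * xiL l) := by
  induction l with
  | nil => simp
  | cons i l ih =>
    rw [xiL_cons, mul_assoc, ih, mul_smul_comm, ← mul_assoc, xi_mul_xiL, smul_mul_assoc, smul_smul,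
      ← pow_add, mul_assoc, List.length_cons, add_mul, one_mul]

lemma del_xiL_mem (j : ℕ) (l : List ℕ) : ∀ d, l.length = d + 1 → del j (xiL l) ∈ ⋀[ℂ]^d V := by
  induction l with
  | nil => intro d h; simp at h
  | cons i l ih =>
    intro d h
    have hl : l.length = d := by simpa using h
    rw [xiL_cons, del_xi_mul]
    refine Submodule.sub_mem _ ?_ ?_
    · split_ifs
      · rw [← hl]; exact xiL_mem l
      · exact Submodule.zero_mem _
    · cases d with
      | zero => rw [List.length_eq_zero_iff.1 hl]; simp [del_one]
      | succ d =>
        rw [add_comm]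
        refine mul_mem_exteriorPower ?_ (ih d hl)
        simpa [xiL] using xiL_mem [i]

lemma del_xiL_of_notMem {j : ℕ} {l : List ℕ} (h : j ∉ l) : del j (xiL l) = 0 := by
  induction l with
  | nil => simp [del_one]
  | cons i l ih =>
    simp only [List.mem_cons, not_or] at h
    rw [xiL_cons, del_xi_mul, if_neg (Ne.symm h.1), ih h.2]
    simp

lemma phi_mul (A : gl) (x y : Lam) : phi A (x * y) = phi A x * y + x * phi A y := by
  induction x using CliffordAlgebra.left_induction with
  | algebraMap r =>
    rw [Algebra.algebraMap_eq_smul_one]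
    simp [phi_one]
  | add x x' hx hy => simp only [add_mul, map_add, hx, hy]; abel
  | ι_mul x v hx =>
    change phi A (ExteriorAlgebra.ι ℂ v * x * y) = phi A (ExteriorAlgebra.ι ℂ v * x) * y +
      ExteriorAlgebra.ι ℂ v * x * phi A y
    rw [mul_assoc, phi_ι, phi_ι, hx]
    simp only [add_mul, mul_add, mul_assoc]
    abel

lemma phi_del (a b j : ℕ) (x : Lam) :
    phi (glE a b) (del j x) = del j (phi (glE a b) x) - (if a = j then del b x else 0) := by
  rw [phi_E]
  simp only [vf, Module.End.mul_apply, LinearMap.mulLeft_apply, del_xi_mul]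
  rw [del_del j b]
  split_ifs <;> simp

lemma phi_xi (i j k : ℕ) : phi (glE i j) (xi k) = if j = k then xi i else 0 := by
  rw [phi_E, ← mul_one (xi k)]
  simp only [vf, Module.End.mul_apply, LinearMap.mulLeft_apply, del_xi_mul, del_one]
  split_ifs <;> simp_all

lemma phi_xiL (i : ℕ) (l : List ℕ) : phi (glE i i) (xiL l) = (l.count i : ℂ) • xiL l := by
  induction l with
  | nil => simp [phi_one]
  | cons j l ih =>
    rw [xiL_cons, phi_mul, ih, phi_xi, List.count_cons]
    by_cases h : i = j
    · subst h; simp [add_smul, add_comm]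
    · simp [h, Ne.symm h]

end Grassmann

/-! ### Vector fields -/

section VectorFields

/-- `P ∂_j` as an element of `W(∞)`. -/
def vfW (P : Lam) (j : ℕ) : W := ⟨vf P j, vf_mem P j⟩

lemma coe_vfW_apply (P : Lam) (j : ℕ) (x : Lam) :
    (vfW P j : Module.End ℂ Lam) x = P * del j x := rfl

/-- The bilinear map `(P, ∑ c_j ∂_j) ↦ ∑ c_j P ∂_j`. -/
def vfB : Lam →ₗ[ℂ] V →ₗ[ℂ] W where
  toFun P := Finsupp.lsum ℂ fun j => LinearMap.toSpanSingleton ℂ W (vfW P j)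
  map_add' P Q := ext_single fun a => by
    simp only [Finsupp.lsum_apply, LinearMap.toSpanSingleton_apply, LinearMap.add_apply, zero_smul,
      Finsupp.sum_single_index, one_smul]
    apply Subtype.ext; apply LinearMap.ext; intro x
    exact add_mul _ _ _
  map_smul' c P := ext_single fun a => by
    simp only [Finsupp.lsum_apply, LinearMap.toSpanSingleton_apply, LinearMap.smul_apply, zero_smul,
      Finsupp.sum_single_index, one_smul, RingHom.id_apply]
    apply Subtype.ext; apply LinearMap.ext; intro x
    exact smul_mul_assoc _ _ _

lemma vfB_single (P : Lam) (j : ℕ) : vfB P (Finsupp.single j 1) = vfW P j := by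
  simp [vfB]

lemma vfW_add (P Q : Lam) (j : ℕ) : vfW (P + Q) j = vfW P j + vfW Q j := by
  simp only [← vfB_single, map_add, LinearMap.add_apply]

lemma vfW_smul (c : ℂ) (P : Lam) (j : ℕ) : vfW (c • P) j = c • vfW P j := by
  simp only [← vfB_single, map_smul, LinearMap.smul_apply]

lemma vfW_zero (j : ℕ) : vfW 0 j = 0 := by
  simp only [← vfB_single, map_zero, LinearMap.zero_apply]

lemma map₂_vfB (d : ℕ) : Submodule.map₂ vfB (⋀[ℂ]^d V) ⊤ = Wdeg (d - 1) := by
  apply le_antisymm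
  · refine Submodule.map₂_le.2 fun P hP c _ => ?_
    induction c using Finsupp.induction_linear with
    | zero => simp
    | add f g hf hg => rw [map_add]; exact Submodule.add_mem _ (hf trivial) (hg trivial)
    | single j c =>
      have : (Finsupp.single j c : V) = c • Finsupp.single j 1 := by simp
      rw [this, map_smul, vfB_single]
      exact Submodule.smul_mem _ _ (Submodule.subset_span ⟨d, by ring, P, hP, j, rfl⟩)
  · rw [Wdeg, Submodule.span_le]
    rintro y ⟨d', hd, P, hP, j, hy⟩
    obtain rfl : d' = d := by omega
    have : y = vfB P (Finsupp.single j 1) := by rw [vfB_single]; exact Subtype.ext hy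
    rw [this]
    exact Submodule.apply_mem_map₂ _ hP trivial

lemma Wdeg_eq_span (d : ℕ) : Wdeg (d - 1) =
    Submodule.span ℂ {y | ∃ (l : List ℕ) (j : ℕ), l.length = d ∧ y = vfW (xiL l) j} := by
  have htop : (⊤ : Submodule ℂ V) = Submodule.span ℂ (Set.range fun j => Finsupp.single j 1) := by
    rw [eq_comm, eq_top_iff]
    intro v _
    induction v using Finsupp.induction_linear with
    | zero => simp
    | add f g hf hg => exact Submodule.add_mem _ (hf trivial) (hg trivial)
    | single j c =>
      have : (Finsupp.single j c : V) = c • Finsupp.single j 1 := by simp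
      rw [this]
      exact Submodule.smul_mem _ _ (Submodule.subset_span ⟨j, rfl⟩)
  rw [← map₂_vfB, exteriorPower_eq_span, htop, Submodule.map₂_span_span]
  congr 1
  ext y
  constructor
  · rintro ⟨_, ⟨l, hl, rfl⟩, _, ⟨j, rfl⟩, rfl⟩
    exact ⟨l, j, hl, vfB_single _ _⟩
  · rintro ⟨l, j, hl, rfl⟩
    exact ⟨_, ⟨l, hl, rfl⟩, _, ⟨j, rfl⟩, vfB_single _ _⟩

lemma vfW_mem {d : ℕ} {P : Lam} (hP : P ∈ ⋀[ℂ]^d V) (j : ℕ) {k : ℤ} (hk : k = d - 1) :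
    vfW P j ∈ Wdeg k := by
  rw [hk]
  exact Submodule.subset_span ⟨d, by ring, P, hP, j, rfl⟩

lemma Wdeg_eq_bot {k : ℤ} (hk : k < -1) : Wdeg k = ⊥ := by
  rw [Wdeg, Submodule.span_eq_bot]
  rintro y ⟨d, hd, -⟩
  omega

lemma exists_nat_of_Wdeg_ne {k : ℤ} {y : W} (hy : y ∈ Wdeg k) (h0 : y ≠ 0) :
    ∃ d : ℕ, k = d - 1 := by
  by_contra! h
  have hk : k < -1 := by
    by_contra hk
    exact h (k + 1).toNat (by omega)
  rw [Wdeg_eq_bot hk] at hy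
  exact h0 hy

lemma span_vfW : Submodule.span ℂ {y | ∃ (l : List ℕ) (j : ℕ), y = vfW (xiL l) j} = ⊤ := by
  rw [eq_top_iff]
  rintro ⟨T, hT⟩ -
  induction hT using Submodule.span_induction with
  | mem x hx =>
    obtain ⟨P, j, rfl⟩ := hx
    change vfW P j ∈ _
    have hP : P ∈ Submodule.span ℂ (Set.range xiL) := by rw [span_xiL]; trivial
    induction hP using Submodule.span_induction with
    | mem x hx => obtain ⟨l, rfl⟩ := hx; exact Submodule.subset_span ⟨l, j, rfl⟩
    | zero => rw [vfW_zero]; exact Submodule.zero_mem _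
    | add x y _ _ hx hy => rw [vfW_add]; exact Submodule.add_mem _ hx hy
    | smul c x _ hx => rw [vfW_smul]; exact Submodule.smul_mem _ _ hx
  | zero => exact Submodule.zero_mem _
  | add x y hx hy h1 h2 => exact Submodule.add_mem _ h1 h2
  | smul c x hx h1 => exact Submodule.smul_mem _ c h1

lemma iSup_Wdeg : ⨆ k, Wdeg k = ⊤ := by
  rw [eq_top_iff, ← span_vfW, Submodule.span_le]
  rintro _ ⟨l, j, rfl⟩
  exact Submodule.mem_iSup_of_mem (l.length - 1 : ℤ) (vfW_mem (xiL_mem l) j rfl)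

lemma phiW_glE (i j : ℕ) : phiW (glE i j) = vfW (xi i) j := Subtype.ext (phi_E i j)

lemma exists_phiW_eq {y : W} (hy : y ∈ Wdeg 0) : ∃ A, y = phiW A := by
  have h : Wdeg 0 = Wdeg ((1 : ℕ) - 1) := by norm_num
  rw [h, Wdeg_eq_span] at hy
  induction hy using Submodule.span_induction with
  | mem x hx =>
    obtain ⟨l, j, hl, rfl⟩ := hx
    obtain ⟨i, rfl⟩ := List.length_eq_one_iff.1 hl
    exact ⟨glE i j, by rw [phiW_glE]; simp [xiL]⟩
  | zero => exact ⟨0, by simp⟩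
  | add x y _ _ hx hy =>
    obtain ⟨A, rfl⟩ := hx
    obtain ⟨B, rfl⟩ := hy
    exact ⟨A + B, by simp⟩
  | smul c x _ hx =>
    obtain ⟨A, rfl⟩ := hx
    exact ⟨c • A, by simp⟩

/-- Since `p - 1` and `p + 1` have the same parity, the sign can be written with a natural exponent.
-/
lemma sgn_eq (p q : ℕ) : sgn (p - 1) (q - 1) = (-1) ^ ((p + 1) * (q + 1)) := by
  have h : ((p : ℤ) - 1) * (q - 1) = ((p + 1) * (q + 1) : ℕ) + 2 * (-(p + q)) := by
    push_cast; ring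
  rw [sgn, h, zpow_add, zpow_mul, zpow_natCast]
  simp

lemma sgn_zero_left (l : ℤ) : sgn 0 l = 1 := by simp [sgn]

/-- The superbracket of two monomial vector fields. -/
lemma superbracket_vfW (a b : List ℕ) (i j : ℕ) :
    (vfW (xiL a) i : Module.End ℂ Lam) * vfW (xiL b) j -
      sgn (a.length - 1) (b.length - 1) • ((vfW (xiL b) j : Module.End ℂ Lam) * vfW (xiL a) i) =
    ((vfW (xiL a * del i (xiL b)) j - sgn (a.length - 1) (b.length - 1) •
      vfW (xiL b * del j (xiL a)) i : W) : Module.End ℂ Lam) := by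
  refine LinearMap.ext fun x => ?_
  simp only [LinearMap.sub_apply, LinearMap.smul_apply, Module.End.mul_apply, coe_vfW_apply,
    Submodule.coe_sub, Submodule.coe_smul, del_xiL_mul, mul_add, mul_smul_comm]
  rw [del_del j i, mul_neg, mul_neg, ← mul_assoc (xiL b) (xiL a), xiL_mul_comm b a, sgn_eq]
  simp only [← mul_assoc, smul_add, smul_neg, smul_mul_assoc, smul_smul]
  -- This sign makes the second-order terms, those with `∂_i ∂_j`, cancel.
  have h : (-1 : ℂ) ^ ((a.length + 1) * (b.length + 1)) *
      (-1) ^ a.length * (-1) ^ (b.length * a.length) = -(-1) ^ b.length := by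
    rw [← pow_add, ← pow_add,
      show (a.length + 1) * (b.length + 1) + a.length + b.length * a.length =
        2 * (a.length * b.length + a.length) + b.length + 1 by ring, pow_succ, pow_add, pow_mul]
    simp
  rw [h]
  module

lemma exists_superbracket {k l : ℤ} {x y : W} (hx : x ∈ Wdeg k) (hy : y ∈ Wdeg l) :
    ∃ z ∈ Wdeg (k + l), (z : Module.End ℂ Lam) = (x : Module.End ℂ Lam) * y - sgn k l • (y * x) := by
  rcases eq_or_ne x 0 with rfl | hx0
  · exact ⟨0, Submodule.zero_mem _, by simp⟩
  rcases eq_or_ne y 0 with rfl | hy0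
  · exact ⟨0, Submodule.zero_mem _, by simp⟩
  obtain ⟨p, rfl⟩ := exists_nat_of_Wdeg_ne hx hx0
  obtain ⟨q, rfl⟩ := exists_nat_of_Wdeg_ne hy hy0
  clear hx0 hy0
  rw [Wdeg_eq_span] at hx hy
  induction hx using Submodule.span_induction with
  | mem x hx =>
    obtain ⟨a, i, rfl, rfl⟩ := hx
    induction hy using Submodule.span_induction with
    | mem y hy =>
      obtain ⟨b, j, rfl, rfl⟩ := hy
      refine ⟨_, Submodule.sub_mem _ ?_ (Submodule.smul_mem _ _ ?_),
        (superbracket_vfW a b i j).symm⟩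
      · cases hb : b.length with
        | zero =>
          rw [List.length_eq_zero_iff.1 hb, xiL_nil, del_one, mul_zero, vfW_zero]
          exact Submodule.zero_mem _
        | succ d =>
          exact vfW_mem (mul_mem_exteriorPower (xiL_mem a) (del_xiL_mem i b d hb)) j
            (by push_cast; ring)
      · cases ha : a.length with
        | zero =>
          rw [List.length_eq_zero_iff.1 ha, xiL_nil, del_one, mul_zero, vfW_zero]
          exact Submodule.zero_mem _
        | succ d =>
          exact vfW_mem (mul_mem_exteriorPower (xiL_mem b) (del_xiL_mem j a d ha)) i
            (by push_cast; ring)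
    | zero => exact ⟨0, Submodule.zero_mem _, by simp⟩
    | add y y' _ _ h h' =>
      obtain ⟨z, hz, hz1⟩ := h
      obtain ⟨z', hz', hz1'⟩ := h'
      refine ⟨z + z', Submodule.add_mem _ hz hz', ?_⟩
      rw [Submodule.coe_add, hz1, hz1', Submodule.coe_add, mul_add, add_mul, smul_add]
      abel
    | smul c y _ h =>
      obtain ⟨z, hz, hz1⟩ := h
      refine ⟨c • z, Submodule.smul_mem _ _ hz, ?_⟩
      rw [Submodule.coe_smul, hz1, Submodule.coe_smul, mul_smul_comm, smul_mul_assoc, smul_sub,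
        smul_comm c]
  | zero => exact ⟨0, Submodule.zero_mem _, by simp⟩
  | add y y' _ _ h h' =>
    obtain ⟨z, hz, hz1⟩ := h
    obtain ⟨z', hz', hz1'⟩ := h'
    refine ⟨z + z', Submodule.add_mem _ hz hz', ?_⟩
    rw [Submodule.coe_add, hz1, hz1', Submodule.coe_add, mul_add, add_mul, smul_add]
    abel
  | smul c y _ h =>
    obtain ⟨z, hz, hz1⟩ := h
    refine ⟨c • z, Submodule.smul_mem _ _ hz, ?_⟩
    rw [Submodule.coe_smul, hz1, Submodule.coe_smul, mul_smul_comm, smul_mul_assoc, smul_sub,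
      smul_comm c]

lemma iU_mul_iU {k l : ℤ} {x y z : W} (hx : x ∈ Wdeg k) (hy : y ∈ Wdeg l)
    (hz : (z : Module.End ℂ Lam) = (x : Module.End ℂ Lam) * y - sgn k l • (y * x)) :
    iU x * iU y = sgn k l • (iU y * iU x) + iU z := by
  have h : mkU _ = mkU _ := RingQuot.mkAlgHom_rel ℂ (URel.bracket k l x y z hx hy hz)
  rw [map_mul, map_add, map_smul, map_mul] at h
  exact h

/-- Neither derivation meets the coefficient of the other, so the superbracket vanishes. -/
lemma iU_comm_of_disjoint {a b : List ℕ} {i j : ℕ} (hi : i ∉ b) (hj : j ∉ a) :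
    iU (vfW (xiL a) i) * iU (vfW (xiL b) j) = sgn (a.length - 1) (b.length - 1) •
      (iU (vfW (xiL b) j) * iU (vfW (xiL a) i)) := by
  have h := iU_mul_iU (vfW_mem (xiL_mem a) i rfl) (vfW_mem (xiL_mem b) j rfl)
    (superbracket_vfW a b i j).symm
  rw [del_xiL_of_notMem hi, del_xiL_of_notMem hj, mul_zero, mul_zero, vfW_zero, vfW_zero, smul_zero,
    sub_zero, map_zero, add_zero] at h
  exact h

/-- The pairing of coefficients in the Grassmann algebra with derivations in `V_*` is equivariant;
this transfers tensoriality and local finiteness to `W(∞)`. -/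
lemma lie_glE_vfB (a b : ℕ) (P : Lam) (c : V) :
    phi (glE a b) * (vfB P c : Module.End ℂ Lam) - vfB P c * phi (glE a b) =
      ((vfB (phi (glE a b) P) c + vfB P (dualE a b c) : W) : Module.End ℂ Lam) := by
  induction c using Finsupp.induction_linear with
  | zero => simp
  | add f g hf hg =>
    simp only [map_add, Submodule.coe_add, mul_add, add_mul] at hf hg ⊢
    rw [add_sub_add_comm, hf, hg]
    abel
  | single j c =>
    have : (Finsupp.single j c : V) = c • Finsupp.single j 1 := by simp
    rw [this]
    simp only [map_smul, Submodule.coe_smul, mul_smul_comm, smul_mul_assoc, ← smul_sub, ← smul_add]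
    congr 1
    have hd : dualE a b (Finsupp.single j 1) = if a = j then -Finsupp.single b 1 else 0 := by
      rw [dualE, LinearMap.neg_apply, E_apply, Finsupp.single_apply]
      split_ifs with h1 h2 h2
      · rfl
      · exact absurd h1.symm h2
      · exact absurd h2.symm h1
      · simp
    rw [hd, vfB_single, vfB_single]
    refine LinearMap.ext fun x => ?_
    simp only [LinearMap.sub_apply, Module.End.mul_apply, coe_vfW_apply, phi_mul, phi_del]
    split_ifs
    · rw [map_neg, vfB_single]
      simp only [Submodule.coe_add, Submodule.coe_neg, LinearMap.add_apply, LinearMap.neg_apply,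
        coe_vfW_apply, mul_sub]
      abel
    · rw [map_zero, add_zero, coe_vfW_apply, sub_zero]
      abel

lemma lie_phi_mem (A : gl) (y : W) :
    phi A * (y : Module.End ℂ Lam) - (y : Module.End ℂ Lam) * phi A ∈ W := by
  have hy : y ∈ ⨆ k, Wdeg k := by rw [iSup_Wdeg]; trivial
  induction hy using Submodule.iSup_induction' with
  | mem k y hy =>
    obtain ⟨z, -, hz⟩ := exists_superbracket (phiW_mem A) hy
    rw [sgn_zero_left, one_smul] at hz
    change (z : Module.End ℂ Lam) = phi A * y - y * phi A at hz
    rw [← hz]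
    exact z.2
  | zero => simp
  | add x y _ _ hx hy =>
    rw [Submodule.coe_add, mul_add, add_mul, add_sub_add_comm]
    exact W.add_mem hx hy

/-- The action of `gl(∞)` on `W(∞)`. -/
def adW (A : gl) : Module.End ℂ W where
  toFun y := ⟨phi A * y - y * phi A, lie_phi_mem A y⟩
  map_add' x y := Subtype.ext (by
    simp only [Submodule.coe_add, mul_add, add_mul]; abel)
  map_smul' c x := Subtype.ext (by
    simp only [Submodule.coe_smul, mul_smul_comm, smul_mul_assoc, smul_sub, RingHom.id_apply])

lemma coe_adW (A : gl) (y : W) :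
    (adW A y : Module.End ℂ Lam) = phi A * (y : Module.End ℂ Lam) - y * phi A := rfl

lemma adW_vfB (a b : ℕ) (P : Lam) (c : V) :
    adW (glE a b) (vfB P c) = vfB (phi (glE a b) P) c + vfB P (dualE a b c) :=
  Subtype.ext (lie_glE_vfB a b P c)

lemma iU_phiW_mul (A : gl) (y : W) :
    iU (phiW A) * iU y = iU y * iU (phiW A) + iU (adW A y) := by
  have hy : y ∈ ⨆ k, Wdeg k := by rw [iSup_Wdeg]; trivial
  induction hy using Submodule.iSup_induction' with
  | mem k y hy =>
    have := iU_mul_iU (phiW_mem A) hy (z := adW A y) (by rw [sgn_zero_left, one_smul]; rfl)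
    rwa [sgn_zero_left, one_smul] at this
  | zero => simp
  | add x y _ _ hx hy => simp only [map_add, mul_add, add_mul, hx, hy]; abel

lemma adW_vfW (i j : ℕ) (l : List ℕ) : adW (glE i i) (vfW (xiL l) j) =
    ((l.count i : ℂ) - if i = j then 1 else 0) • vfW (xiL l) j := by
  rw [← vfB_single, adW_vfB, phi_xiL, map_smul, LinearMap.smul_apply, dualE, LinearMap.neg_apply,
    E_apply, Finsupp.single_apply, map_neg, vfB_single]
  by_cases h : i = j
  · subst h; simp only [if_true, vfB_single]; module
  · simp [h, Ne.symm h]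

lemma tensorial_exteriorPower (n d : ℕ) :
    Tensorial (fun i j => phi (glE (n + i) (n + j))) (⋀[ℂ]^d V) := by
  rw [ExteriorAlgebra.exteriorPower]
  have h1 : Tensorial (fun i j => phi (glE (n + i) (n + j)))
      (LinearMap.range (ExteriorAlgebra.ι ℂ : V →ₗ[ℂ] Lam)) := by
    rw [LinearMap.range_eq_map]
    refine (tensorial_V n).map _ fun i j v => ?_
    have := phi_ι (glE (n + i) (n + j)) v 1
    rw [phi_one, mul_zero, add_zero, mul_one, mul_one] at this
    exact this
  induction d with
  | zero =>
    rw [pow_zero, Submodule.one_eq_span]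
    exact Tensorial.span_singleton fun i j => phi_one _
  | succ d ih =>
    rw [pow_succ, Submodule.mul_eq_map₂]
    exact ih.map₂ h1 _ fun i j x y => phi_mul _ x y

/-- The component of degree `d - 1` is an equivariant image of the tensor product of an exterior
power of `V` with `V_*`. -/
lemma tensorial_Wdeg (n : ℕ) (k : ℤ) :
    Tensorial (fun i j => adW (glE (n + i) (n + j))) (Wdeg k) := by
  rcases lt_or_ge k (-1) with hk | hk
  · rw [Wdeg_eq_bot hk]; exact Tensorial.bot
  · obtain ⟨d, rfl⟩ : ∃ d : ℕ, k = d - 1 := ⟨(k + 1).toNat, by omega⟩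
    rw [← map₂_vfB]
    exact (tensorial_exteriorPower n d).map₂ (tensorial_dual n) vfB
      fun i j P c => adW_vfB _ _ P c

end VectorFields

/-! ### The grading automorphisms -/

section Scaling

/-- The automorphism of the Grassmann algebra that multiplies the generators by `c`. -/
def scaleLam (c : ℂ) : Lam →ₐ[ℂ] Lam := ExteriorAlgebra.map (c • LinearMap.id)

lemma scaleLam_ι (c : ℂ) (v : V) :
    scaleLam c (ExteriorAlgebra.ι ℂ v) = c • ExteriorAlgebra.ι ℂ v := by
  rw [scaleLam, ExteriorAlgebra.map_apply_ι]
  simp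

lemma scaleLam_xiL (c : ℂ) (l : List ℕ) : scaleLam c (xiL l) = c ^ l.length • xiL l := by
  induction l with
  | nil => simp
  | cons i l ih =>
    rw [xiL_cons, map_mul, ih, xi, scaleLam_ι, List.length_cons, pow_succ]
    simp [smul_smul]

lemma scaleLam_comp (c d : ℂ) (x : Lam) : scaleLam c (scaleLam d x) = scaleLam (c * d) x := by
  have : (scaleLam c).comp (scaleLam d) = scaleLam (c * d) := by
    refine ExteriorAlgebra.hom_ext (LinearMap.ext fun v => ?_)
    simp only [LinearMap.comp_apply, AlgHom.toLinearMap_apply, AlgHom.comp_apply, scaleLam_ι,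
      map_smul, smul_smul]
    rw [mul_comm]
  exact DFunLike.congr_fun this x

lemma scaleLam_one (x : Lam) : scaleLam 1 x = x := by
  have : scaleLam 1 = AlgHom.id ℂ Lam := by
    refine ExteriorAlgebra.hom_ext (LinearMap.ext fun v => ?_)
    simp [scaleLam_ι]
  exact DFunLike.congr_fun this x

lemma del_scaleLam (c : ℂ) (j : ℕ) (x : Lam) :
    del j (scaleLam c x) = c • scaleLam c (del j x) := by
  induction x using CliffordAlgebra.left_induction with
  | algebraMap r =>
    rw [Algebra.algebraMap_eq_smul_one]
    simp [del_one]
  | add x y hx hy => simp only [map_add, hx, hy, smul_add]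
  | ι_mul x v hx =>
    change del j (scaleLam c (ExteriorAlgebra.ι ℂ v * x)) =
      c • scaleLam c (del j (ExteriorAlgebra.ι ℂ v * x))
    rw [map_mul, scaleLam_ι, smul_mul_assoc, map_smul, del_mul, hx, del_mul, map_sub, map_smul,
      map_mul, scaleLam_ι]
    simp

/-- Conjugation by `scaleLam c`. -/
def scaleEnd (c : ℂˣ) (T : Module.End ℂ Lam) : Module.End ℂ Lam :=
  (scaleLam c).toLinearMap ∘ₗ T ∘ₗ (scaleLam (c⁻¹ : ℂˣ)).toLinearMap

lemma scaleEnd_apply (c : ℂˣ) (T : Module.End ℂ Lam) (x : Lam) :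
    scaleEnd c T x = scaleLam c (T (scaleLam (c⁻¹ : ℂˣ) x)) := rfl

lemma scaleEnd_mul (c : ℂˣ) (S T : Module.End ℂ Lam) :
    scaleEnd c (S * T) = scaleEnd c S * scaleEnd c T := by
  refine LinearMap.ext fun x => ?_
  rw [Module.End.mul_apply, scaleEnd_apply, scaleEnd_apply, scaleEnd_apply, Module.End.mul_apply,
    scaleLam_comp, ← Units.val_mul, inv_mul_cancel, Units.val_one, scaleLam_one]

lemma scaleEnd_add (c : ℂˣ) (S T : Module.End ℂ Lam) :
    scaleEnd c (S + T) = scaleEnd c S + scaleEnd c T := by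
  refine LinearMap.ext fun x => ?_
  simp [scaleEnd_apply]

lemma scaleEnd_smul (c : ℂˣ) (a : ℂ) (T : Module.End ℂ Lam) :
    scaleEnd c (a • T) = a • scaleEnd c T := by
  refine LinearMap.ext fun x => ?_
  simp [scaleEnd_apply]

lemma scaleEnd_vf (c : ℂˣ) (P : Lam) (j : ℕ) :
    scaleEnd c (vf P j) = vf (((c⁻¹ : ℂˣ) : ℂ) • scaleLam c P) j := by
  refine LinearMap.ext fun x => ?_
  change scaleLam c (P * del j (scaleLam (c⁻¹ : ℂˣ) x)) = (_ • scaleLam c P) * del j x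
  rw [del_scaleLam, map_mul, map_smul, scaleLam_comp, ← Units.val_mul, mul_inv_cancel,
    Units.val_one, scaleLam_one]
  simp

lemma scaleEnd_mem (c : ℂˣ) {T : Module.End ℂ Lam} (hT : T ∈ W) : scaleEnd c T ∈ W := by
  induction hT using Submodule.span_induction with
  | mem x hx => obtain ⟨P, j, rfl⟩ := hx; rw [scaleEnd_vf]; exact vf_mem _ _
  | zero =>
    have : scaleEnd c 0 = 0 := LinearMap.ext fun x => by simp [scaleEnd_apply]
    rw [this]; exact W.zero_mem
  | add x y _ _ hx hy => rw [scaleEnd_add]; exact W.add_mem hx hy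
  | smul a x _ hx => rw [scaleEnd_smul]; exact W.smul_mem a hx

/-- The automorphism of `W(∞)` that multiplies the component of degree `k` by `c ^ k`. -/
def scaleW (c : ℂˣ) : Module.End ℂ W where
  toFun y := ⟨scaleEnd c y, scaleEnd_mem c y.2⟩
  map_add' x y := Subtype.ext (scaleEnd_add c x y)
  map_smul' a x := Subtype.ext (scaleEnd_smul c a x)

lemma scaleW_of_mem (c : ℂˣ) {k : ℤ} {y : W} (hy : y ∈ Wdeg k) : scaleW c y = ((c : ℂ) ^ k) • y := by
  rcases eq_or_ne y 0 with rfl | h0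
  · simp
  obtain ⟨d, rfl⟩ := exists_nat_of_Wdeg_ne hy h0
  clear h0
  rw [Wdeg_eq_span] at hy
  induction hy using Submodule.span_induction with
  | mem y hy =>
    obtain ⟨l, j, rfl, rfl⟩ := hy
    have h : scaleW c (vfW (xiL l) j) = vfW (((c⁻¹ : ℂˣ) : ℂ) • scaleLam c (xiL l)) j :=
      Subtype.ext (scaleEnd_vf c _ j)
    rw [h, scaleLam_xiL, vfW_smul, vfW_smul, smul_smul]
    congr 1
    rw [zpow_sub₀ c.ne_zero, zpow_natCast, zpow_one, Units.val_inv_eq_inv_val, div_eq_mul_inv,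
      mul_comm]
  | zero => simp
  | add x y _ _ hx hy => rw [map_add, hx, hy, smul_add]
  | smul a x _ hx => rw [map_smul, hx, smul_comm]

/-- The corresponding automorphism of the enveloping superalgebra. -/
def scaleU (c : ℂˣ) : U →ₐ[ℂ] U :=
  RingQuot.liftAlgHom ℂ ⟨TensorAlgebra.lift ℂ (iU ∘ₗ scaleW c), by
    intro s t h
    obtain ⟨k, l, x, y, z, hx, hy, hz⟩ := h
    simp only [map_mul, map_add, map_smul, TensorAlgebra.lift_ι_apply, LinearMap.comp_apply]
    refine iU_mul_iU (k := k) (l := l) ?_ ?_ ?_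
    · rw [scaleW_of_mem c hx]; exact Submodule.smul_mem _ _ hx
    · rw [scaleW_of_mem c hy]; exact Submodule.smul_mem _ _ hy
    · change scaleEnd c z = scaleEnd c x * scaleEnd c y - _ • (scaleEnd c y * scaleEnd c x)
      rw [hz, ← scaleEnd_mul, ← scaleEnd_mul, ← scaleEnd_smul, sub_eq_add_neg, scaleEnd_add,
        sub_eq_add_neg, ← neg_one_smul ℂ, scaleEnd_smul, neg_one_smul]⟩

lemma scaleU_iU (c : ℂˣ) (y : W) : scaleU c (iU y) = iU (scaleW c y) := by
  have h : scaleU c (mkU (TensorAlgebra.ι ℂ y)) = TensorAlgebra.lift ℂ (iU ∘ₗ scaleW c)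
      (TensorAlgebra.ι ℂ y) :=
    RingQuot.liftAlgHom_mkAlgHom_apply ℂ _ _ _
  rw [TensorAlgebra.lift_ι_apply] at h
  exact h

lemma scaleU_of_monomials (c : ℂˣ) {C : Set ℤ} {j : ℤ} {u : U} (hu : monomials C j u) :
    scaleU c u = ((c : ℂ) ^ j) • u := by
  induction hu with
  | one => simp
  | mul k j y u hk hy hu ih =>
    rw [map_mul, ih, scaleU_iU, scaleW_of_mem c hy, map_smul, smul_mul_smul_comm, Int.cast_id,
      zpow_add₀ c.ne_zero]

/-- Compare `2`-adic and `3`-adic valuations. Two independent degrees can thus be read off from one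
eigenvalue. -/
lemma eq_of_two_zpow_mul_three_zpow {a b a' b' : ℤ}
    (h : (2 : ℂ) ^ a * (3 : ℂ) ^ b = 2 ^ a' * 3 ^ b') : a = a' ∧ b = b' := by
  have h' : (2 : ℚ) ^ a * (3 : ℚ) ^ b = 2 ^ a' * 3 ^ b' := by
    have h1 : (((2 : ℚ) ^ a * (3 : ℚ) ^ b : ℚ) : ℂ) = ((2 ^ a' * 3 ^ b' : ℚ) : ℂ) := by
      push_cast; exact h
    exact Rat.cast_injective h1
  have : Fact (Nat.Prime 2) := ⟨Nat.prime_two⟩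
  have : Fact (Nat.Prime 3) := ⟨Nat.prime_three⟩
  have v22 : padicValRat 2 (2 : ℚ) = 1 := by
    simpa using padicValRat.self (p := 2) (by norm_num)
  have v23 : padicValRat 2 (3 : ℚ) = 0 := by
    have := padicValRat.of_nat (p := 2) (n := 3)
    rw [padicValNat.eq_zero_of_not_dvd (by norm_num)] at this
    exact_mod_cast this
  have v33 : padicValRat 3 (3 : ℚ) = 1 := by
    simpa using padicValRat.self (p := 3) (by norm_num)
  have v32 : padicValRat 3 (2 : ℚ) = 0 := by
    have := padicValRat.of_nat (p := 3) (n := 2)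
    rw [padicValNat.eq_zero_of_not_dvd (by norm_num)] at this
    exact_mod_cast this
  have h2 := congrArg (padicValRat 2) h'
  have h3 := congrArg (padicValRat 3) h'
  have n2 : ∀ a : ℤ, (2 : ℚ) ^ a ≠ 0 := fun a => zpow_ne_zero a (by norm_num)
  have n3 : ∀ a : ℤ, (3 : ℚ) ^ a ≠ 0 := fun a => zpow_ne_zero a (by norm_num)
  rw [padicValRat.mul (n2 _) (n3 _), padicValRat.mul (n2 _) (n3 _), padicValRat.zpow,
    padicValRat.zpow, padicValRat.zpow, padicValRat.zpow] at h2 h3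
  rw [v22, v23] at h2
  rw [v32, v33] at h3
  constructor <;> linarith

lemma iSupIndep_Wdeg : iSupIndep Wdeg := by
  have h := (scaleW (Units.mk0 2 (by norm_num))).eigenspaces_iSupIndep.comp
    (f := fun k : ℤ => (2 : ℂ) ^ k) (by
      intro a b hab
      exact (eq_of_two_zpow_mul_three_zpow (b := 0) (b' := 0) (by simpa using hab)).1)
  exact h.mono fun k y hy => Module.End.mem_eigenspace_iff.2 (scaleW_of_mem _ hy)

/-- The elements of `t n` with degrees in a given set. -/
lemma mem_span_of_mem_t {n : ℕ} {p : ℤ → Prop} {y : W} (hy : y ∈ t n)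
    (hp : y ∈ ⨆ k : {k : ℤ // p k}, Wdeg k.1) :
    y ∈ Submodule.span ℂ {y | ∃ (l : List ℕ) (j : ℕ), (∀ i ∈ l, n ≤ i) ∧ n ≤ j ∧
      p (l.length - 1) ∧ y = vfW (xiL l) j} := by
  set A := {y : W | ∃ (l : List ℕ) (j : ℕ), (∀ i ∈ l, n ≤ i) ∧ n ≤ j ∧
      p (l.length - 1) ∧ y = vfW (xiL l) j} with hA
  set B := {y : W | ∃ (l : List ℕ) (j : ℕ), (∀ i ∈ l, n ≤ i) ∧ n ≤ j ∧
      ¬ p (l.length - 1) ∧ y = vfW (xiL l) j} with hB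
  have h1 : t n ≤ Submodule.span ℂ A ⊔ Submodule.span ℂ B := by
    rw [← Submodule.span_union, t]
    refine Submodule.span_mono ?_
    rintro y ⟨l, j, hl, hj, hy⟩
    by_cases h : p (l.length - 1)
    · exact Or.inl ⟨l, j, hl, hj, h, Subtype.ext hy⟩
    · exact Or.inr ⟨l, j, hl, hj, h, Subtype.ext hy⟩
  obtain ⟨a, ha, b, hb, rfl⟩ := Submodule.mem_sup.1 (h1 hy)
  have hle : ∀ (q : ℤ → Prop), Submodule.span ℂ {y : W | ∃ (l : List ℕ) (j : ℕ),
      (∀ i ∈ l, n ≤ i) ∧ n ≤ j ∧ q (l.length - 1) ∧ y = vfW (xiL l) j} ≤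
        ⨆ k ∈ {k | q k}, Wdeg k := by
    intro q
    rw [Submodule.span_le]
    rintro _ ⟨l, j, -, -, h, rfl⟩
    exact (le_iSup₂_of_le (f := fun k (_ : k ∈ {k | q k}) => Wdeg k) _ h le_rfl)
      (vfW_mem (xiL_mem l) j rfl)
  have hd := iSupIndep_Wdeg.disjoint_biSup_biSup (s := {k | p k}) (t := {k | ¬ p k})
    (by rw [Set.disjoint_left]; intro k h1 h2; exact h2 h1)
  have hb1 : b ∈ ⨆ k ∈ {k | p k}, Wdeg k := by
    have h2 : a + b ∈ ⨆ k ∈ {k | p k}, Wdeg k := by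
      rw [iSup_subtype] at hp
      exact hp
    simpa using Submodule.sub_mem _ h2 (hle p ha)
  -- The part `b` has only degrees outside `p`, but as a difference of elements with degrees in `p`
  -- it also has only degrees in `p`.
  have hb0 : b = 0 := Submodule.disjoint_def.1 hd b hb1 (hle (fun k => ¬ p k) hb)
  rw [hb0, add_zero]
  exact ha

end Scaling

/-! ### Locally finite operators -/

section LocallyFinite

variable {M M₁ M₂ M₃ : Type*} [AddCommGroup M] [Module ℂ M] [AddCommGroup M₁] [Module ℂ M₁]
  [AddCommGroup M₂] [Module ℂ M₂] [AddCommGroup M₃] [Module ℂ M₃]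

/-- `m` lies in a finite-dimensional subspace that is invariant under `a`. -/
def LocFin (a : Module.End ℂ M) (m : M) : Prop :=
  ∃ F : Submodule ℂ M, F.FG ∧ m ∈ F ∧ ∀ x ∈ F, a x ∈ F

lemma LocFin.finite {a : Module.End ℂ M} {m : M} (h : LocFin a m) :
    Module.Finite ℂ (Submodule.span ℂ (Set.range fun i : ℕ => (a ^ i) m)) := by
  obtain ⟨F, hF, hm, ha⟩ := h
  have : Module.Finite ℂ F := Module.Finite.iff_fg.2 hF
  have hle : Submodule.span ℂ (Set.range fun i : ℕ => (a ^ i) m) ≤ F := by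
    rw [Submodule.span_le]
    rintro _ ⟨i, rfl⟩
    exact pow_mem ha i hm
  exact Submodule.finiteDimensional_of_le hle

lemma locFin_of_finite {a : Module.End ℂ M} {m : M}
    (h : Module.Finite ℂ (Submodule.span ℂ (Set.range fun i : ℕ => (a ^ i) m))) :
    LocFin a m := by
  refine ⟨_, Module.Finite.iff_fg.1 h, Submodule.subset_span ⟨0, rfl⟩, fun x hx => ?_⟩
  induction hx using Submodule.span_induction with
  | mem x hx =>
    obtain ⟨i, rfl⟩ := hx
    refine Submodule.subset_span ⟨i + 1, ?_⟩
    simp only [pow_succ', Module.End.mul_apply]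
  | zero => simp
  | add x y _ _ hx hy => rw [map_add]; exact Submodule.add_mem _ hx hy
  | smul c x _ hx => rw [map_smul]; exact Submodule.smul_mem _ _ hx

lemma LocFin.add {a : Module.End ℂ M} {m m' : M} (h : LocFin a m) (h' : LocFin a m') :
    LocFin a (m + m') := by
  obtain ⟨F, hF, hm, ha⟩ := h
  obtain ⟨F', hF', hm', ha'⟩ := h'
  refine ⟨F ⊔ F', hF.sup hF', Submodule.add_mem_sup hm hm', fun x hx => ?_⟩
  obtain ⟨y, hy, z, hz, rfl⟩ := Submodule.mem_sup.1 hx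
  rw [map_add]
  exact Submodule.add_mem_sup (ha y hy) (ha' z hz)

lemma locFin_zero (a : Module.End ℂ M) : LocFin a 0 :=
  ⟨⊥, Submodule.fg_bot, Submodule.zero_mem _, fun x hx => by
    rw [Submodule.mem_bot] at hx; simp [hx]⟩

lemma LocFin.smul {a : Module.End ℂ M} {m : M} (c : ℂ) (h : LocFin a m) : LocFin a (c • m) := by
  obtain ⟨F, hF, hm, ha⟩ := h
  exact ⟨F, hF, F.smul_mem c hm, ha⟩

lemma LocFin.map {a₁ : Module.End ℂ M₁} {a₂ : Module.End ℂ M₂} (f : M₁ →ₗ[ℂ] M₂)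
    (hf : ∀ x, a₂ (f x) = f (a₁ x)) {x : M₁} (h : LocFin a₁ x) : LocFin a₂ (f x) := by
  obtain ⟨F, hF, hm, ha⟩ := h
  refine ⟨F.map f, hF.map f, ⟨x, hm, rfl⟩, ?_⟩
  rintro _ ⟨y, hy, rfl⟩
  rw [hf]
  exact ⟨_, ha y hy, rfl⟩

lemma LocFin.map₂ {a₁ : Module.End ℂ M₁} {a₂ : Module.End ℂ M₂} {a₃ : Module.End ℂ M₃}
    (B : M₁ →ₗ[ℂ] M₂ →ₗ[ℂ] M₃) (hB : ∀ x y, a₃ (B x y) = B (a₁ x) y + B x (a₂ y)) {x : M₁} {y : M₂}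
    (h : LocFin a₁ x) (h' : LocFin a₂ y) : LocFin a₃ (B x y) := by
  obtain ⟨F, hF, hm, ha⟩ := h
  obtain ⟨F', hF', hm', ha'⟩ := h'
  refine ⟨Submodule.map₂ B F F', hF.map₂ B hF', Submodule.apply_mem_map₂ _ hm hm', fun z hz => ?_⟩
  have : Submodule.map₂ B F F' ≤ (Submodule.map₂ B F F').comap a₃ := by
    refine Submodule.map₂_le.2 fun x hx y hy => ?_
    rw [Submodule.mem_comap, hB]
    exact Submodule.add_mem _ (Submodule.apply_mem_map₂ _ (ha x hx) hy)
      (Submodule.apply_mem_map₂ _ hx (ha' y hy))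
  exact this hz

/-- The line through `m` together with the range is stable. -/
lemma locFin_of_range_fg {a : Module.End ℂ M} (h : (LinearMap.range a).FG) (m : M) :
    LocFin a m :=
  ⟨Submodule.span ℂ {m} ⊔ LinearMap.range a, (Submodule.fg_span_singleton m).sup h,
    Submodule.mem_sup_left (Submodule.mem_span_singleton_self m),
    fun x _ => Submodule.mem_sup_right ⟨x, rfl⟩⟩

lemma fg_range_E (i j : ℕ) : (LinearMap.range (E i j)).FG := by
  have : LinearMap.range (E i j) ≤ Submodule.span ℂ {Finsupp.single i (1 : ℂ)} := by
    rintro _ ⟨v, rfl⟩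
    rw [E_apply, Submodule.mem_span_singleton]
    exact ⟨v j, by simp⟩
  have h2 : FiniteDimensional ℂ (Submodule.span ℂ {(Finsupp.single i (1 : ℂ) : V)}) :=
    inferInstance
  exact Module.Finite.iff_fg.1 (Submodule.finiteDimensional_of_le this)

lemma fg_range_add {a b : Module.End ℂ M} (ha : (LinearMap.range a).FG)
    (hb : (LinearMap.range b).FG) : (LinearMap.range (a + b)).FG := by
  have hle : LinearMap.range (a + b) ≤ LinearMap.range a ⊔ LinearMap.range b := by
    rintro _ ⟨v, rfl⟩
    exact Submodule.add_mem_sup ⟨v, rfl⟩ ⟨v, rfl⟩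
  have : FiniteDimensional ℂ (LinearMap.range a ⊔ LinearMap.range b : Submodule ℂ M) :=
    Module.Finite.iff_fg.2 (ha.sup hb)
  exact Module.Finite.iff_fg.1 (Submodule.finiteDimensional_of_le hle)

lemma fg_range_smul {a : Module.End ℂ M} (c : ℂ) (ha : (LinearMap.range a).FG) :
    (LinearMap.range (c • a)).FG := by
  have hle : LinearMap.range (c • a) ≤ LinearMap.range a := by
    rintro _ ⟨v, rfl⟩
    exact Submodule.smul_mem _ c ⟨v, rfl⟩
  have : FiniteDimensional ℂ (LinearMap.range a) := Module.Finite.iff_fg.2 ha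
  exact Module.Finite.iff_fg.1 (Submodule.finiteDimensional_of_le hle)

/-- Elements of `gl(∞)` act with finite rank on `V` and on `V_*`; `δ` is the action on `V_*`,
obtained by linearity from the matrix units. -/
lemma exists_dual (A : gl) : ((LinearMap.range (A : Module.End ℂ V)).FG) ∧
    ∃ δ : Module.End ℂ V, (LinearMap.range δ).FG ∧
      ∀ P c, adW A (vfB P c) = vfB (phi A P) c + vfB P (δ c) := by
  have hA : A ∈ Submodule.span ℂ (Set.range fun p : ℕ × ℕ => glE p.1 p.2) := by
    rw [span_glE]; trivial
  induction hA using Submodule.span_induction with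
  | mem x hx =>
    obtain ⟨p, rfl⟩ := hx
    refine ⟨fg_range_E _ _, dualE p.1 p.2, ?_, fun P c => adW_vfB _ _ P c⟩
    rw [dualE, LinearMap.range_neg]
    exact fg_range_E _ _
  | zero =>
    refine ⟨by simpa using Submodule.fg_bot, 0, by simpa using Submodule.fg_bot, fun P c => ?_⟩
    apply Subtype.ext
    simp [coe_adW]
  | add A B _ _ hA hB =>
    obtain ⟨h1, δ, h2, h3⟩ := hA
    obtain ⟨h1', δ', h2', h3'⟩ := hB
    refine ⟨fg_range_add h1 h1', δ + δ', fg_range_add h2 h2', fun P c => ?_⟩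
    have : adW (A + B) (vfB P c) = adW A (vfB P c) + adW B (vfB P c) := Subtype.ext (by
      simp only [coe_adW, Submodule.coe_add, map_add, add_mul, mul_add]; abel)
    rw [this, h3, h3']
    simp only [map_add, LinearMap.add_apply]
    abel
  | smul a A _ hA =>
    obtain ⟨h1, δ, h2, h3⟩ := hA
    refine ⟨fg_range_smul a h1, a • δ, fg_range_smul a h2, fun P c => ?_⟩
    have : adW (a • A) (vfB P c) = a • adW A (vfB P c) := Subtype.ext (by
      simp only [coe_adW, Submodule.coe_smul, map_smul, smul_mul_assoc, mul_smul_comm, smul_sub])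
    rw [this, h3]
    simp only [map_smul, LinearMap.smul_apply, smul_add]

/-- Finite rank operators on `V` and `V_*` are locally finite, and the Leibniz rule carries this to
products of generators and to vector fields. -/
lemma locFin_adW (A : gl) (y : W) : LocFin (adW A) y := by
  obtain ⟨hA, δ, hδ, hδ'⟩ := exists_dual A
  have hxi : ∀ i, LocFin (phi A) (xi i) := fun i =>
    (locFin_of_range_fg hA (Finsupp.single i 1)).map (ExteriorAlgebra.ι ℂ) fun v => by
      have := phi_ι A v 1
      rwa [phi_one, mul_zero, add_zero, mul_one, mul_one] at this
  have hxiL : ∀ l, LocFin (phi A) (xiL l) := by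
    intro l
    induction l with
    | nil =>
      refine ⟨Submodule.span ℂ {1}, Submodule.fg_span_singleton _,
        Submodule.mem_span_singleton_self _, fun x hx => ?_⟩
      obtain ⟨c, rfl⟩ := Submodule.mem_span_singleton.1 hx
      rw [map_smul, phi_one, smul_zero]
      exact Submodule.zero_mem _
    | cons i l ih =>
      rw [xiL_cons]
      exact (hxi i).map₂ (LinearMap.mul ℂ Lam) (fun x y => phi_mul A x y) ih
  have hy : y ∈ Submodule.span ℂ {y | ∃ (l : List ℕ) (j : ℕ), y = vfW (xiL l) j} := by
    rw [span_vfW]; trivial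
  induction hy using Submodule.span_induction with
  | mem y hy =>
    obtain ⟨l, j, rfl⟩ := hy
    rw [← vfB_single]
    exact (hxiL l).map₂ vfB hδ' (locFin_of_range_fg hδ _)
  | zero => exact locFin_zero _
  | add x y _ _ hx hy => exact hx.add hy
  | smul c x _ hx => exact hx.smul c

end LocallyFinite

/-! ### The structure of the induced modules -/

lemma U_induction {p : U → Prop} (algebraMap : ∀ c : ℂ, p (algebraMap ℂ U c))
    (iU : ∀ y, p (iU y)) (mul : ∀ u v, p u → p v → p (u * v)) (add : ∀ u v, p u → p v → p (u + v))
    (u : U) : p u := by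
  obtain ⟨a, rfl⟩ : ∃ a, mkU a = u := RingQuot.mkAlgHom_surjective ℂ URel u
  induction a using TensorAlgebra.induction with
  | algebraMap c => rw [AlgHom.commutes]; exact algebraMap c
  | ι y => exact iU y
  | mul a b ha hb => rw [map_mul]; exact mul _ _ ha hb
  | add a b ha hb => rw [map_add]; exact add _ _ ha hb

section InducedStructure

variable {D C : Set ℤ} {X : Type*} [AddCommGroup X] [Module ℂ X] [LieRingModule gl X]
  [LieModule ℂ gl X]

lemma smul_tmk (u v : U) (x : X) : u • (tmk v x : Ind D X) = tmk (u * v) x := rfl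

variable (D X) in
/-- The bilinear map `(u, x) ↦ u ⊗ x`. -/
def tmkB : U →ₗ[ℂ] X →ₗ[ℂ] Ind D X :=
  (TensorProduct.mk ℂ U X).compr₂ ((indRel D X).mkQ.restrictScalars ℂ)

lemma tmkB_apply (u : U) (x : X) : tmkB D X u x = tmk u x := rfl

variable (D X) in
/-- The action of `W(∞)` as a bilinear map. -/
def actB : W →ₗ[ℂ] Ind D X →ₗ[ℂ] Ind D X :=
  LinearMap.mk₂ ℂ (fun y m => iU y • m) (fun x y m => by rw [map_add, add_smul])
    (fun c y m => by rw [map_smul, smul_assoc]) (fun y m n => smul_add _ _ _)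
    (fun c y m => smul_algebra_smul_comm _ _ _)

lemma actB_apply (y : W) (m : Ind D X) : actB D X y m = iU y • m := rfl

lemma lie_eq_smul (A : gl) (m : Ind D X) : ⁅A, m⁆ = iU (phiW A) • m := rfl

lemma tmk_mul_phiW (u : U) (A : gl) (x : X) :
    (tmk (u * iU (phiW A)) x : Ind D X) = tmk u ⁅A, x⁆ :=
  (Submodule.Quotient.eq (indRel D X)).2 (Submodule.subset_span (Or.inl ⟨u, A, x, rfl⟩))

lemma tmk_mul_eq_zero (u : U) {k : ℤ} {y : W} (hk : k ∈ D) (hy : y ∈ Wdeg k) (x : X) :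
    (tmk (u * iU y) x : Ind D X) = 0 :=
  (Submodule.Quotient.mk_eq_zero (indRel D X)).2
    (Submodule.subset_span (Or.inr ⟨u, k, y, x, hk, hy, rfl⟩))

lemma lie_tmk_one (A : gl) (x : X) : ⁅A, (tmk 1 x : Ind D X)⁆ = tmk 1 ⁅A, x⁆ := by
  rw [lie_eq_smul, smul_tmk, mul_one, ← tmk_mul_phiW, one_mul]

lemma lie_smul_eq (A : gl) (y : W) (m : Ind D X) :
    ⁅A, iU y • m⁆ = iU (adW A y) • m + iU y • ⁅A, m⁆ := by
  rw [lie_eq_smul, lie_eq_smul, ← mul_smul, iU_phiW_mul, add_smul, mul_smul, add_comm]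

lemma span_tmk : Submodule.span ℂ {w : Ind D X | ∃ u x, w = tmk u x} = ⊤ := by
  rw [eq_top_iff]
  rintro w -
  obtain ⟨w, rfl⟩ := Submodule.mkQ_surjective (indRel D X) w
  induction w using TensorProduct.induction_on with
  | zero => rw [map_zero]; exact Submodule.zero_mem _
  | tmul u x => exact Submodule.subset_span ⟨u, x, rfl⟩
  | add v w hv hw => rw [map_add]; exact Submodule.add_mem _ hv hw

@[elab_as_elim]
lemma iSup_eq_top_induction {M : Type*} [AddCommGroup M] [Module ℂ M] {ι : Type*}
    {S : ι → Submodule ℂ M} (h : ⨆ i, S i = ⊤) {p : M → Prop} (mem : ∀ i, ∀ m ∈ S i, p m)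
    (zero : p 0) (add : ∀ m n, p m → p n → p (m + n)) (m : M) : p m :=
  Submodule.iSup_induction S (motive := p) (x := m) (by rw [h]; trivial) mem zero add

/-- Vectors generated by `1 ⊗ X` exhaust the induced module. -/
lemma mem_of_stable {S : Submodule ℂ (Ind D X)} (h1 : ∀ x, tmk 1 x ∈ S)
    (hS : ∀ y, ∀ m ∈ S, iU y • m ∈ S) (m : Ind D X) : m ∈ S := by
  have hU : ∀ u : U, ∀ m ∈ S, u • m ∈ S := by
    intro u
    induction u using U_induction with
    | algebraMap c => intro m hm; rw [algebraMap_smul]; exact S.smul_mem c hm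
    | iU y => exact hS y
    | mul u v hu hv => intro m hm; rw [mul_smul]; exact hu _ (hv m hm)
    | add u v hu hv => intro m hm; rw [add_smul]; exact S.add_mem (hu m hm) (hv m hm)
  have hm : m ∈ Submodule.span ℂ {w : Ind D X | ∃ u x, w = tmk u x} := by
    rw [span_tmk]; trivial
  refine (Submodule.span_le.2 ?_) hm
  rintro _ ⟨u, x, rfl⟩
  have := hU u _ (h1 x)
  rwa [smul_tmk, mul_one] at this

/-! ### Monomials -/

lemma monomials.cast {A : Type} [AddGroupWithOne A] {j : ℤ} {u : U} (hu : monomials C j u) :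
    monomials (A := A) Set.univ (j : A) u := by
  induction hu with
  | one => rw [Int.cast_zero]; exact monomials.one
  | mul k j y u hk hy hu ih =>
    rw [Int.cast_add, Int.cast_id]
    exact monomials.mul k _ y u (Set.mem_univ k) hy ih

lemma monomials.exists_lift {A : Type} [AddGroupWithOne A] {a : A} {u : U}
    (hu : monomials C a u) : ∃ j : ℤ, (j : A) = a ∧ monomials C j u := by
  induction hu with
  | one => exact ⟨0, Int.cast_zero, monomials.one⟩
  | mul k j y u hk hy hu ih =>
    obtain ⟨j, rfl, hj⟩ := ih
    exact ⟨_, by rw [Int.cast_add, Int.cast_id], monomials.mul k j y u hk hy hj⟩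

variable (D X C) in
/-- The span of the `y_1 ⋯ y_m ⊗ x`, with `x ∈ X^k` and the `y_s` homogeneous of degrees in `C` of
sum `j`. -/
def monomialSpan (j k : ℤ) : Submodule ℂ (Ind D X) :=
  Submodule.span ℂ {w | ∃ (u : U) (x : X), monomials C j u ∧ x ∈ weightDegree X k ∧ w = tmk u x}

lemma tmk_mem_monomialSpan {j k : ℤ} {u : U} (hu : monomials C j u) {x : X}
    (hx : x ∈ weightDegree X k) : tmk u x ∈ monomialSpan D C X j k :=
  Submodule.subset_span ⟨u, x, hu, hx, rfl⟩

lemma monomials_mul {i j : ℤ} {y : W} {u : U} (hi : i ∈ C) (hy : y ∈ Wdeg i)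
    (hu : monomials C j u) : monomials C (i + j) (iU y * u) := by
  have := monomials.mul i j y u hi hy hu
  rwa [Int.cast_id] at this

lemma smul_mem_monomialSpan_of_mem {i j k : ℤ} (hi : i ∈ C) {y : W} (hy : y ∈ Wdeg i)
    {m : Ind D X} (hm : m ∈ monomialSpan D C X j k) : iU y • m ∈ monomialSpan D C X (i + j) k := by
  rw [← actB_apply]
  refine (Submodule.span_le (p := (monomialSpan D C X (i + j) k).comap (actB D X y))).2 ?_ hm
  rintro _ ⟨u, x, hu, hx, rfl⟩
  exact tmk_mem_monomialSpan (monomials_mul hi hy hu) hx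

/-- Straightening: a homogeneous `y` of any degree is moved past the first letter at the price of a
bracket, by induction on the number of letters. At `1 ⊗ x` it extends the monomial, acts through
`gl(∞)`, or gives zero. -/
lemma smul_tmk_mem_monomialSpan (hDC : ∀ i, i ∈ C ∨ i = 0 ∨ i ∈ D) {j k : ℤ} {u : U}
    (hu : monomials C j u) {x : X} (hx : x ∈ weightDegree X k) :
    ∀ {i : ℤ} {y : W}, y ∈ Wdeg i → iU y • tmk u x ∈ monomialSpan D C X (i + j) k := by
  induction hu with
  | one =>
    intro i y hy
    rcases hDC i with hi | rfl | hi
    · exact smul_mem_monomialSpan_of_mem hi hy (tmk_mem_monomialSpan monomials.one hx)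
    · obtain ⟨A, rfl⟩ := exists_phiW_eq hy
      rw [← lie_eq_smul, lie_tmk_one, add_zero]
      exact tmk_mem_monomialSpan monomials.one (lie_mem_weightDegree hx A)
    · rw [smul_tmk, mul_one, ← one_mul (iU y), tmk_mul_eq_zero _ hi hy]
      exact Submodule.zero_mem _
  | mul l j y' u hl hy' hu ih =>
    intro i y hy
    obtain ⟨z, hz, hz'⟩ := exists_superbracket hy hy'
    rw [Int.cast_id, ← smul_tmk, ← mul_smul, iU_mul_iU hy hy' hz', add_smul, smul_assoc, mul_smul]
    -- Both terms meet a shorter monomial: `y` acts on it before `y'` is put back, and so does the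
    -- bracket, whose degree is arbitrary.
    refine Submodule.add_mem _ (Submodule.smul_mem _ _ ?_) ?_
    · rw [add_left_comm]
      exact smul_mem_monomialSpan_of_mem hl hy' (ih hy)
    · rw [← add_assoc]
      exact ih hz

lemma smul_mem_monomialSpan (hDC : ∀ i, i ∈ C ∨ i = 0 ∨ i ∈ D) {i j k : ℤ} {y : W}
    (hy : y ∈ Wdeg i) {m : Ind D X} (hm : m ∈ monomialSpan D C X j k) :
    iU y • m ∈ monomialSpan D C X (i + j) k := by
  rw [← actB_apply]
  refine (Submodule.span_le (p := (monomialSpan D C X (i + j) k).comap (actB D X y))).2 ?_ hm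
  rintro _ ⟨u, x, hu, hx, rfl⟩
  exact smul_tmk_mem_monomialSpan hDC hu hx hy

lemma T_toSubmodule (hDC : ∀ i, i ∈ C ∨ i = 0 ∨ i ∈ D) (j k : ℤ) :
    (T D X C j k).toSubmodule = monomialSpan D C X j k := by
  refine le_antisymm ?_ (Submodule.span_le.2 LieSubmodule.subset_lieSpan)
  let L : LieSubmodule ℂ gl (Ind D X) :=
    { monomialSpan D C X j k with
      lie_mem := fun {A m} hm => by
        have := smul_mem_monomialSpan hDC (phiW_mem A) hm
        rwa [zero_add] at this }
  have : T D X C j k ≤ L := LieSubmodule.lieSpan_le.2 Submodule.subset_span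
  exact this

lemma Tdeg_toSubmodule (hDC : ∀ i, i ∈ C ∨ i = 0 ∨ i ∈ D) (j : ℤ) :
    (Tdeg D X C j).toSubmodule = ⨆ k, monomialSpan D C X j k := by
  rw [Tdeg, LieSubmodule.iSup_toSubmodule]
  simp only [T_toSubmodule hDC]

lemma iSup_monomialSpan (hDC : ∀ i, i ∈ C ∨ i = 0 ∨ i ∈ D) (hX : ⨆ k, weightDegree X k = ⊤) :
    ⨆ p : ℤ × ℤ, monomialSpan D C X p.1 p.2 = ⊤ := by
  rw [eq_top_iff]
  rintro m -
  refine mem_of_stable (fun x => ?_) (fun y => ?_) m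
  · induction x using iSup_eq_top_induction hX with
    | mem k x hx => exact Submodule.mem_iSup_of_mem (0, k) (tmk_mem_monomialSpan monomials.one hx)
    | zero => rw [← tmkB_apply, map_zero]; exact Submodule.zero_mem _
    | add x y hx hy => rw [← tmkB_apply, map_add]; exact Submodule.add_mem _ hx hy
  · induction y using iSup_eq_top_induction iSup_Wdeg with
    | mem i y hy =>
      have : ⨆ p : ℤ × ℤ, monomialSpan D C X p.1 p.2 ≤
          (⨆ p : ℤ × ℤ, monomialSpan D C X p.1 p.2).comap (actB D X y) := iSup_le fun p m hm => Submodule.mem_iSup_of_mem (i + p.1, p.2) (smul_mem_monomialSpan hDC hy hm)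
      exact fun m hm => this hm
    | zero => intro m _; rw [map_zero, zero_smul]; exact Submodule.zero_mem _
    | add x y hx hy => intro m hm; rw [map_add, add_smul]; exact Submodule.add_mem _ (hx m hm) (hy m hm)

lemma iSup_Tdeg (hDC : ∀ i, i ∈ C ∨ i = 0 ∨ i ∈ D) (hX : ⨆ k, weightDegree X k = ⊤) :
    ⨆ j, (Tdeg D X C j).toSubmodule = ⊤ := by
  rw [eq_top_iff, ← iSup_monomialSpan hDC hX]
  refine iSup_le fun p => le_iSup_of_le p.1 ?_
  rw [Tdeg_toSubmodule hDC]
  exact le_iSup (fun k => monomialSpan D C X p.1 k) p.2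

lemma Tdeg_le (hDC : ∀ i, i ∈ C ∨ i = 0 ∨ i ∈ D) {j : ℤ} {S : Submodule ℂ (Ind D X)}
    (h : ∀ (u : U) (x : X), monomials C j u → tmk u x ∈ S) : (Tdeg D X C j).toSubmodule ≤ S := by
  rw [Tdeg_toSubmodule hDC]
  refine iSup_le fun k => Submodule.span_le.2 ?_
  rintro _ ⟨u, x, hu, -, rfl⟩
  exact h u x hu

lemma Tdeg_le_par (hDC : ∀ i, i ∈ C ∨ i = 0 ∨ i ∈ D) (j : ℤ) :
    (Tdeg D X C j).toSubmodule ≤ par D X (j : ZMod 2) :=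
  Tdeg_le hDC fun u x hu => Submodule.subset_span ⟨u, x, hu.cast, rfl⟩

/-! ### Independence -/

/-- The endomorphism of `X` that multiplies the component of weight degree `k` by `d ^ k`. -/
lemma exists_scaleX (hX : DirectSum.IsInternal (weightDegree X)) (d : ℂ) :
    ∃ f : Module.End ℂ X, (∀ k, ∀ x ∈ weightDegree X k, f x = d ^ k • x) ∧
      ∀ (A : gl) x, f ⁅A, x⁆ = ⁅A, f x⁆ := by
  let e := LinearEquiv.ofBijective (DirectSum.coeLinearMap (weightDegree X)) hX
  let f : Module.End ℂ X :=
    DirectSum.toModule ℂ ℤ X (fun k => d ^ k • (weightDegree X k).subtype) ∘ₗ e.symm.toLinearMap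
  have hf : ∀ k, ∀ x ∈ weightDegree X k, f x = d ^ k • x := by
    intro k x hx
    have he : e (DirectSum.lof ℂ ℤ (fun k => weightDegree X k) k ⟨x, hx⟩) = x :=
      DirectSum.coeLinearMap_lof (weightDegree X) k ⟨x, hx⟩
    have he' : e.symm x = DirectSum.lof ℂ ℤ (fun k => weightDegree X k) k ⟨x, hx⟩ := by
      rw [LinearEquiv.symm_apply_eq, he]
    change DirectSum.toModule ℂ ℤ X _ (e.symm x) = _
    rw [he', DirectSum.toModule_lof]
    rfl
  refine ⟨f, hf, fun A x => ?_⟩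
  induction x using iSup_eq_top_induction hX.submodule_iSup_eq_top with
  | mem k x hx => rw [hf k x hx, hf k _ (lie_mem_weightDegree hx A), lie_smul]
  | zero => simp
  | add x y hx hy => rw [lie_add, map_add, map_add, lie_add, hx, hy]

/-- The product map descends to the induced module: `scaleU` fixes the image of `gl(∞)`, with which
`f` commutes, and it preserves homogeneous components. -/
lemma exists_scaleInd (c : ℂˣ) {f : Module.End ℂ X} (hf : ∀ (A : gl) x, f ⁅A, x⁆ = ⁅A, f x⁆) :
    ∃ Θ : Module.End ℂ (Ind D X), ∀ u x, Θ (tmk u x) = tmk (scaleU c u) (f x) := by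
  let Ψ : U ⊗[ℂ] X →ₗ[ℂ] Ind D X :=
    TensorProduct.lift ((tmkB D X).compl₁₂ (scaleU c).toLinearMap f)
  have hΨ : ∀ u x, Ψ (u ⊗ₜ x) = tmk (scaleU c u) (f x) := fun u x => rfl
  have hs : ∀ (u : U) w, Ψ (u • w) = scaleU c u • Ψ w := by
    intro u w
    induction w using TensorProduct.induction_on with
    | zero => simp
    | tmul v x => rw [TensorProduct.smul_tmul', hΨ, hΨ, smul_eq_mul, map_mul, smul_tmk]
    | add v w hv hw => rw [smul_add, map_add, map_add, smul_add, hv, hw]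
  have hker : (indRel D X).restrictScalars ℂ ≤ LinearMap.ker Ψ := by
    intro w hw
    rw [Submodule.restrictScalars_mem] at hw
    rw [LinearMap.mem_ker]
    induction hw using Submodule.span_induction with
    | mem w hw =>
      rcases hw with ⟨u, A, x, rfl⟩ | ⟨u, k, y, x, hk, hy, rfl⟩
      · rw [map_sub, hΨ, hΨ, map_mul, scaleU_iU, scaleW_of_mem c (phiW_mem A), zpow_zero, one_smul,
          tmk_mul_phiW, hf, sub_self]
      · rw [hΨ, map_mul, scaleU_iU, tmk_mul_eq_zero _ hk]
        rw [scaleW_of_mem c hy]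
        exact Submodule.smul_mem _ _ hy
    | zero => exact map_zero _
    | add v w _ _ hv hw => rw [map_add, hv, hw, add_zero]
    | smul u w _ hw => rw [hs, hw, smul_zero]
  exact ⟨(((indRel D X).restrictScalars ℂ).liftQ Ψ hker) ∘ₗ
    (Submodule.Quotient.restrictScalarsEquiv ℂ (indRel D X)).symm.toLinearMap, fun u x => rfl⟩

/-- Scaling by `2` on `W(∞)` and by `3` on `X` places each span in an eigenspace of one operator,
with different eigenvalues `2^j 3^k`. No basis of the induced module is required. -/
lemma iSupIndep_monomialSpan (hX : DirectSum.IsInternal (weightDegree X)) :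
    iSupIndep fun p : ℤ × ℤ => monomialSpan D C X p.1 p.2 := by
  obtain ⟨f, hf, hf'⟩ := exists_scaleX hX 3
  obtain ⟨Θ, hΘ⟩ := exists_scaleInd (D := D) (Units.mk0 2 (by norm_num)) hf'
  have h := Θ.eigenspaces_iSupIndep.comp
    (f := fun p : ℤ × ℤ => (2 : ℂ) ^ p.1 * (3 : ℂ) ^ p.2) (by
      intro p q hpq
      exact Prod.ext (eq_of_two_zpow_mul_three_zpow hpq).1 (eq_of_two_zpow_mul_three_zpow hpq).2)
  refine h.mono fun p => Submodule.span_le.2 ?_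
  rintro _ ⟨u, x, hu, hx, rfl⟩
  refine Module.End.mem_eigenspace_iff.2 ?_
  rw [hΘ, scaleU_of_monomials _ hu, hf _ _ hx, ← tmkB_apply, map_smul, map_smul,
    LinearMap.smul_apply, smul_smul, mul_comm]
  rfl

lemma iSupIndep_Tdeg (hDC : ∀ i, i ∈ C ∨ i = 0 ∨ i ∈ D) :
    iSupIndep fun j => (Tdeg D X C j).toSubmodule := by
  obtain ⟨Θ, hΘ⟩ := exists_scaleInd (D := D) (X := X) (Units.mk0 2 (by norm_num))
    (f := LinearMap.id) (fun A x => rfl)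
  have h := Θ.eigenspaces_iSupIndep.comp (f := fun j : ℤ => (2 : ℂ) ^ j) (by
      intro a b hab
      exact (eq_of_two_zpow_mul_three_zpow (b := 0) (b' := 0) (by simpa using hab)).1)
  refine h.mono fun j => Tdeg_le hDC fun u x hu => Module.End.mem_eigenspace_iff.2 ?_
  rw [hΘ, scaleU_of_monomials _ hu, ← tmkB_apply, map_smul]
  rfl

/-- The parity operator is the scaling by `-1`, with the identity on the purely even `X`. -/
lemma iSupIndep_par : iSupIndep (par D X) := by
  obtain ⟨Θ, hΘ⟩ := exists_scaleInd (D := D) (X := X) (Units.mk0 (-1) (by norm_num))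
    (f := LinearMap.id) (fun A x => rfl)
  have h := Θ.eigenspaces_iSupIndep.comp (f := fun a : ZMod 2 => if a = 0 then (1 : ℂ) else -1) (by
    intro a b hab
    have h2 : ∀ a : ZMod 2, a = 0 ∨ a = 1 := by decide
    have h10 : (1 : ZMod 2) ≠ 0 := by decide
    rcases h2 a with rfl | rfl <;> rcases h2 b with rfl | rfl <;>
      first | rfl | (simp only [h10, if_true, if_false] at hab; norm_num at hab))
  refine h.mono fun a => Submodule.span_le.2 ?_
  rintro _ ⟨u, x, hu, rfl⟩
  obtain ⟨j, rfl, hj⟩ := hu.exists_lift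
  refine Module.End.mem_eigenspace_iff.2 ?_
  rw [hΘ, scaleU_of_monomials _ hj, ← tmkB_apply, map_smul]
  have : ((Units.mk0 (-1 : ℂ) (by norm_num) : ℂˣ) : ℂ) ^ j =
      if (j : ZMod 2) = 0 then (1 : ℂ) else -1 := by
    rw [Units.val_mk0]
    split_ifs with h
    · exact Even.neg_one_zpow (ZMod.intCast_eq_zero_iff_even.1 h)
    · exact Odd.neg_one_zpow (Int.not_even_iff_odd.1 fun h' => h (ZMod.intCast_eq_zero_iff_even.2 h'))
  rw [this]
  rfl

lemma isInternal_Tdeg (hDC : ∀ i, i ∈ C ∨ i = 0 ∨ i ∈ D) (hX : ⨆ k, weightDegree X k = ⊤) :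
    DirectSum.IsInternal fun j => (Tdeg D X C j).toSubmodule :=
  (DirectSum.isInternal_submodule_iff_iSupIndep_and_iSup_eq_top _).2
    ⟨iSupIndep_Tdeg hDC, iSup_Tdeg hDC hX⟩

lemma isSuper_par (hDC : ∀ i, i ∈ C ∨ i = 0 ∨ i ∈ D) (hX : ⨆ k, weightDegree X k = ⊤) :
    IsSuper (Ind D X) (par D X) where
  internal := by
    refine (DirectSum.isInternal_submodule_iff_iSupIndep_and_iSup_eq_top _).2
      ⟨iSupIndep_par, ?_⟩
    rw [eq_top_iff, ← iSup_Tdeg hDC hX]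
    exact iSup_le fun j => le_iSup_of_le (j : ZMod 2) (Tdeg_le_par hDC j)
  act i y hy a m hm := by
    rw [← actB_apply]
    refine (Submodule.span_le (p := (par D X (i + a)).comap (actB D X y))).2 ?_ hm
    rintro _ ⟨u, x, hu, rfl⟩
    exact Submodule.subset_span ⟨_, x, monomials.mul i a y u (Set.mem_univ _) hy hu, rfl⟩

lemma isZGrading_Tdeg (hDC : ∀ i, i ∈ C ∨ i = 0 ∨ i ∈ D) (hX : ⨆ k, weightDegree X k = ⊤) :
    IsZGrading (Ind D X) (par D X) fun j => (Tdeg D X C j).toSubmodule where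
  internal := isInternal_Tdeg hDC hX
  act i y hy j m hm := by
    rw [← actB_apply]
    rw [Tdeg_toSubmodule hDC] at hm ⊢
    have : ⨆ k, monomialSpan D C X j k ≤
        (⨆ k, monomialSpan D C X (i + j) k).comap (actB D X y) := iSup_le fun k m hm =>
      Submodule.mem_iSup_of_mem k (smul_mem_monomialSpan hDC hy hm)
    exact this hm
  parity := Tdeg_le_par hDC

end InducedStructure

section InducedCategory

variable {D C : Set ℤ} {X : Type*} [AddCommGroup X] [Module ℂ X] [LieRingModule gl X]
  [LieModule ℂ gl X]

/-! ### Weights of the induced modules -/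

/-- The weight of the monomial `ξ_{i_1} ⋯ ξ_{i_r}`. -/
def listWeight (l : List ℕ) : ℕ →₀ ℤ := (l.map fun i => Finsupp.single i 1).sum

lemma listWeight_cons (a : ℕ) (l : List ℕ) :
    listWeight (a :: l) = Finsupp.single a 1 + listWeight l := by simp [listWeight]

lemma listWeight_apply (l : List ℕ) (i : ℕ) : listWeight l i = l.count i := by
  induction l with
  | nil => simp [listWeight]
  | cons a l ih =>
    rw [listWeight_cons, Finsupp.add_apply, ih, Finsupp.single_apply, List.count_cons]
    by_cases h : a = i
    · simp [h, add_comm]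
    · simp [h]

lemma sum_add_listWeight_sub (μ : ℕ →₀ ℤ) (l : List ℕ) (j : ℕ) :
    ((μ + listWeight l - Finsupp.single j 1).sum fun _ a => a) =
      (μ.sum fun _ a => a) + (l.length - 1) := by
  have hl : ((listWeight l).sum fun _ a => a) = l.length := by
    induction l with
    | nil => simp [listWeight]
    | cons a l ih =>
      rw [listWeight_cons, Finsupp.sum_add_index (by simp) (by simp), ih,
        Finsupp.sum_single_index rfl, List.length_cons]
      push_cast
      ring
  rw [Finsupp.sum_sub_index (fun _ _ _ => rfl), Finsupp.sum_add_index (by simp) (by simp), hl,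
    Finsupp.sum_single_index rfl, add_sub_assoc]

lemma smul_vfW_mem_weightSpace {μ : ℕ →₀ ℤ} {m : Ind D X} (hm : m ∈ weightSpace (Ind D X) μ)
    (l : List ℕ) (j : ℕ) : iU (vfW (xiL l) j) • m ∈
      weightSpace (Ind D X) (μ + listWeight l - Finsupp.single j 1) := by
  intro i
  rw [lie_smul_eq, adW_vfW, map_smul, smul_assoc, hm i, smul_algebra_smul_comm, ← add_smul]
  congr 1
  rw [Finsupp.sub_apply, Finsupp.add_apply, listWeight_apply, Finsupp.single_apply]
  by_cases h : i = j
  · simp [h]; ring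
  · simp [h, Ne.symm h]; ring

lemma smul_mem_weightDegree {i k : ℤ} {y : W} (hy : y ∈ Wdeg i) {m : Ind D X}
    (hm : m ∈ weightDegree (Ind D X) k) : iU y • m ∈ weightDegree (Ind D X) (i + k) := by
  rcases eq_or_ne y 0 with rfl | h0
  · rw [map_zero, zero_smul]; exact Submodule.zero_mem _
  obtain ⟨d, rfl⟩ := exists_nat_of_Wdeg_ne hy h0
  clear h0
  rw [Wdeg_eq_span] at hy
  induction hy using Submodule.span_induction with
  | mem y hy =>
    obtain ⟨l, j, rfl, rfl⟩ := hy
    have : weightDegree (Ind D X) k ≤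
        (weightDegree (Ind D X) (l.length - 1 + k)).comap (actB D X (vfW (xiL l) j)) := by
      refine iSup_le fun μ m hm => Submodule.mem_iSup_of_mem
        ⟨μ.1 + listWeight l - Finsupp.single j 1, ?_⟩ (smul_vfW_mem_weightSpace hm l j)
      rw [sum_add_listWeight_sub, μ.2, add_comm]
    exact this hm
  | zero => rw [map_zero, zero_smul]; exact Submodule.zero_mem _
  | add x y _ _ hx hy => rw [map_add, add_smul]; exact Submodule.add_mem _ hx hy
  | smul c x _ hx => rw [map_smul, smul_assoc]; exact Submodule.smul_mem _ _ hx

lemma tmk_one_mem_weightDegree {k : ℤ} {x : X} (hx : x ∈ weightDegree X k) :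
    tmk 1 x ∈ weightDegree (Ind D X) k := by
  have : weightDegree X k ≤ (weightDegree (Ind D X) k).comap (tmkB D X 1) := by
    refine iSup_le fun μ x hx => Submodule.mem_iSup_of_mem μ ?_
    intro i
    rw [tmkB_apply, lie_tmk_one, hx i, ← tmkB_apply, map_smul, tmkB_apply]
  exact this hx

lemma monomialSpan_le_weightDegree (j k : ℤ) :
    monomialSpan D C X j k ≤ weightDegree (Ind D X) (j + k) := by
  refine Submodule.span_le.2 ?_
  rintro _ ⟨u, x, hu, hx, rfl⟩
  induction hu with
  | one => rw [zero_add]; exact tmk_one_mem_weightDegree hx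
  | mul i j y u _ hy _ ih =>
    rw [Int.cast_id, ← smul_tmk, add_assoc]
    exact smul_mem_weightDegree hy ih

/-! ### Integrability -/

/-- Locally finite vectors form a subspace that contains `1 ⊗ X` and is stable under `W(∞)`, because
the adjoint action on `W(∞)` is locally finite. -/
lemma locFin_toEnd (hX : ∀ (A : gl) (x : X), LocFin (LieModule.toEnd ℂ gl X A) x) (A : gl)
    (m : Ind D X) : LocFin (LieModule.toEnd ℂ gl (Ind D X) A) m := by
  let S : Submodule ℂ (Ind D X) :=
    { carrier := {m | LocFin (LieModule.toEnd ℂ gl (Ind D X) A) m}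
      zero_mem' := locFin_zero _
      add_mem' := LocFin.add
      smul_mem' := fun c _ => LocFin.smul c }
  refine mem_of_stable (S := S) (fun x => ?_) (fun y m hm => ?_) m
  · exact (hX A x).map (tmkB D X 1) fun x => lie_tmk_one A x
  · exact (locFin_adW A y).map₂ (actB D X) (fun y m => lie_smul_eq A y m) hm

lemma LocFin.restrict {M : Type*} [AddCommGroup M] [Module ℂ M] [LieRingModule gl M]
    [LieModule ℂ gl M] {A : gl} (N : LieSubmodule ℂ gl M) {m : N}
    (h : LocFin (LieModule.toEnd ℂ gl M A) m) : LocFin (LieModule.toEnd ℂ gl N A) m := by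
  obtain ⟨F, hF, hm, hA⟩ := h
  refine ⟨F.comap N.toSubmodule.subtype, ?_, hm, fun x hx => hA _ hx⟩
  have : FiniteDimensional ℂ F := Module.Finite.iff_fg.2 hF
  exact Submodule.fg_of_fg_map_injective _ N.toSubmodule.injective_subtype
    (Module.Finite.iff_fg.1 (Submodule.finiteDimensional_of_le (Submodule.map_comap_le _ _)))

/-! ### Large annihilators -/

/-- The vectors with this property form a `W(∞)`-stable subspace: for large indices `ξ_l ∂_j`
supercommutes with a given monomial vector field. On `1 ⊗ X`, degree zero is the annihilator
condition for `X` and degrees in `D` act by zero. -/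
lemma exists_smul_vfW_eq_zero (hX : ∀ x : X, ∃ n : ℕ, ∀ A ∈ tgl n, ⁅A, x⁆ = 0) (m : Ind D X) :
    ∃ n : ℕ, ∀ (l : List ℕ) (j : ℕ), (∀ i ∈ l, n ≤ i) → n ≤ j →
      ((l.length : ℤ) - 1 = 0 ∨ (l.length : ℤ) - 1 ∈ D) → iU (vfW (xiL l) j) • m = 0 := by
  let S : Submodule ℂ (Ind D X) :=
    { carrier := {m | ∃ n : ℕ, ∀ (l : List ℕ) (j : ℕ), (∀ i ∈ l, n ≤ i) → n ≤ j →
        ((l.length : ℤ) - 1 = 0 ∨ (l.length : ℤ) - 1 ∈ D) → iU (vfW (xiL l) j) • m = 0}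
      zero_mem' := ⟨0, fun _ _ _ _ _ => smul_zero _⟩
      add_mem' := by
        rintro m m' ⟨n, hn⟩ ⟨n', hn'⟩
        refine ⟨max n n', fun l j hl hj h => ?_⟩
        rw [smul_add, hn l j (fun i hi => (le_max_left _ _).trans (hl i hi))
          ((le_max_left _ _).trans hj) h, hn' l j
          (fun i hi => (le_max_right _ _).trans (hl i hi)) ((le_max_right _ _).trans hj) h, add_zero]
      smul_mem' := by
        rintro c m ⟨n, hn⟩
        refine ⟨n, fun l j hl hj h => ?_⟩
        rw [smul_algebra_smul_comm, hn l j hl hj h, smul_zero] }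
  refine mem_of_stable (S := S) (fun x => ?_) (fun y m hm => ?_) m
  · obtain ⟨n, hn⟩ := hX x
    refine ⟨n, fun l j hl hj h => ?_⟩
    rcases h with h | h
    · obtain ⟨i, rfl⟩ := List.length_eq_one_iff.1 (by omega : l.length = 1)
      have : xiL [i] = xi i := by rw [xiL_cons, xiL_nil, mul_one]
      rw [this, ← phiW_glE, ← lie_eq_smul, lie_tmk_one,
        hn _ (glE_mem_tgl (hl i (List.mem_singleton_self i)) hj), ← tmkB_apply, map_zero]
    · rw [smul_tmk, mul_one, ← one_mul (iU _), tmk_mul_eq_zero _ h (vfW_mem (xiL_mem l) j rfl)]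
  · have hy : y ∈ Submodule.span ℂ {y | ∃ (l : List ℕ) (j : ℕ), y = vfW (xiL l) j} := by
      rw [span_vfW]; trivial
    induction hy using Submodule.span_induction with
    | mem y hy =>
      obtain ⟨b, k, rfl⟩ := hy
      obtain ⟨n, hn⟩ := hm
      -- The bound exceeds every index in `ξ_b ∂_k`, so `j` does not occur in `b` and `k` does not
      -- occur in `l`.
      refine ⟨max n (max (b.toFinset.sup id) k + 1), fun l j hl hj h => ?_⟩
      have hjb : j ∉ b := fun hb => by
        have : j ≤ b.toFinset.sup id := Finset.le_sup (f := id) (List.mem_toFinset.2 hb)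
        omega
      have hkl : k ∉ l := fun hk => by
        have := hl k hk
        omega
      rw [← mul_smul, iU_comm_of_disjoint hjb hkl, smul_assoc, mul_smul,
        hn l j (fun i hi => (le_max_left _ _).trans (hl i hi)) ((le_max_left _ _).trans hj) h,
        smul_zero, smul_zero]
    | zero => rw [map_zero, zero_smul]; exact S.zero_mem
    | add x y _ _ hx hy => rw [map_add, add_smul]; exact S.add_mem hx hy
    | smul c x _ hx => rw [map_smul, smul_assoc]; exact S.smul_mem c hx

lemma exists_lie_tgl_eq_zero (hX : ∀ x : X, ∃ n : ℕ, ∀ A ∈ tgl n, ⁅A, x⁆ = 0) (m : Ind D X) :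
    ∃ n : ℕ, ∀ A ∈ tgl n, ⁅A, m⁆ = 0 := by
  obtain ⟨n, hn⟩ := exists_smul_vfW_eq_zero hX m
  refine ⟨n, lie_tgl_eq_zero fun i j hi hj => ?_⟩
  have : xiL [i] = xi i := by rw [xiL_cons, xiL_nil, mul_one]
  rw [lie_eq_smul, phiW_glE, ← this]
  exact hn [i] j (by simpa using hi) hj (Or.inl (by simp))

lemma inT_ind (hDC : ∀ i, i ∈ C ∨ i = 0 ∨ i ∈ D) (hX : InTgl X) {p : ℤ → Prop}
    (hp : ∀ k, p k → k = 0 ∨ k ∈ D) :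
    InT (Ind D X) (⨆ k : {k : ℤ // p k}, Wdeg k.1) (par D X) where
  super := isSuper_par hDC hX.isInternal_weightDegree.submodule_iSup_eq_top
  grading := ⟨_, isZGrading_Tdeg hDC hX.isInternal_weightDegree.submodule_iSup_eq_top⟩
  integrable A m := by
    have h := (locFin_toEnd (D := D) (fun A x => locFin_of_finite (hX.integrable A x)) A m).finite
    have he : ∀ i : ℕ, (LieModule.toEnd ℂ gl (Ind D X) A ^ i) m = (iU (phiW A) ^ i) • m := by
      intro i
      induction i with
      | zero => simp
      | succ i ih => rw [pow_succ', pow_succ', Module.End.mul_apply, ih, mul_smul]; rfl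
    rwa [funext he] at h
  lac m := by
    obtain ⟨n, hn⟩ := exists_smul_vfW_eq_zero hX.lac m
    refine ⟨n, fun y hy => ?_⟩
    have h := mem_span_of_mem_t hy.1 hy.2
    clear hy
    induction h using Submodule.span_induction with
    | mem y hy => obtain ⟨l, j, hl, hj, hlp, rfl⟩ := hy; exact hn l j hl hj (hp _ hlp)
    | zero => rw [map_zero, zero_smul]
    | add x y _ _ hx hy => rw [map_add, add_smul, hx, hy, add_zero]
    | smul c x _ hx => rw [map_smul, smul_assoc, hx, smul_zero]

/-! ### Finite length -/

variable (D X) in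
/-- The span of the `y_1 ⋯ y_s ⊗ x` with `s ≤ r` and `y_i ∈ G`. -/
def wordSpan (G : Submodule ℂ W) : ℕ → Submodule ℂ (Ind D X)
  | 0 => (⊤ : Submodule ℂ X).map (tmkB D X 1)
  | r + 1 => wordSpan G r ⊔ Submodule.map₂ (actB D X) G (wordSpan G r)

lemma tensorial_wordSpan {n : ℕ} {G : Submodule ℂ W}
    (hG : Tensorial (fun i j => adW (glE (n + i) (n + j))) G) (hX : Tensorial (actE X n) ⊤) (r : ℕ) :
    Tensorial (actE (Ind D X) n) (wordSpan D X G r) := by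
  induction r with
  | zero => exact hX.map _ fun i j x => lie_tmk_one _ x
  | succ r ih =>
    exact Tensorial.sup _ _ ih (hG.map₂ ih _ fun i j y m => lie_smul_eq _ y m)

/-- Each letter contributes at least one to `σ * j`, so a monomial has at most `σ * j` letters, each
of degree at most `σ * j` in absolute value. The bound `N` on degrees is kept fixed while the length
`r` varies in the induction. -/
lemma tmk_mem_wordSpan {σ : ℤ} (hσ : σ = 1 ∨ σ = -1) (hC : ∀ k ∈ C, 0 < σ * k) {N : ℕ} {j : ℤ}
    {u : U} (hu : monomials C j u) (x : X) : 0 ≤ σ * j ∧ ∀ r : ℕ, σ * j ≤ r → r ≤ N →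
      tmk u x ∈ wordSpan D X ((Finset.Icc (-N : ℤ) N).sup Wdeg) r := by
  induction hu with
  | one =>
    refine ⟨by simp, fun r _ _ => ?_⟩
    induction r with
    | zero => exact ⟨x, trivial, rfl⟩
    | succ r ih => exact Submodule.mem_sup_left (ih (by simp) (by omega))
  | mul k j y u hk hy hu ih =>
    have hk' := hC k hk
    rw [Int.cast_id, mul_add]
    refine ⟨by linarith [ih.1], fun r hr hrN => ?_⟩
    have hj := ih.1
    obtain _ | r := r
    · exfalso; push_cast at hr; linarith
    · push_cast at hr
      refine Submodule.mem_sup_right ?_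
      rw [← smul_tmk, ← actB_apply]
      refine Submodule.apply_mem_map₂ _ ?_ (ih.2 r (by linarith) (by omega))
      have hkN : k ∈ Finset.Icc (-N : ℤ) N := by
        rw [Finset.mem_Icc]
        rcases hσ with rfl | rfl <;> constructor <;> omega
      exact (Finset.le_sup (f := Wdeg) hkN) hy

lemma isKacGrading_of_sign {σ : ℤ} (hσ : σ = 1 ∨ σ = -1) (hC : ∀ k ∈ C, 0 < σ * k)
    (hDC : ∀ i, i ∈ C ∨ i = 0 ∨ i ∈ D) (hX : InTgl X) : IsKacGrading D X C := by
  have hint := hX.isInternal_weightDegree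
  -- Stated for all submodules of `T^j`, so that `T^j` and the `T^{j,k}` are treated together.
  have hmem : ∀ (j : ℤ) (N : LieSubmodule ℂ gl (Ind D X)), N ≤ Tdeg D X C j → InTgl N := by
    intro j N hN
    refine ⟨?_, fun A m => ?_, fun m => ?_⟩
    · obtain ⟨n, hn⟩ := hX.tensorial
      -- The same number bounds the length of the words and the degrees of the letters; for negative
      -- `σ * j` it is zero, which is still an upper bound.
      have hG := tensorial_wordSpan (D := D) (Tensorial.finset_sup
        (Finset.Icc (-(σ * j).toNat : ℤ) (σ * j).toNat) Wdeg fun k _ => tensorial_Wdeg n k) hn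
        (σ * j).toNat
      exact hG.exists_chain N ((show N.toSubmodule ≤ (Tdeg D X C j).toSubmodule from hN).trans
        (Tdeg_le hDC fun u x hu => (tmk_mem_wordSpan hσ hC hu x).2 _ (Int.self_le_toNat _) le_rfl))
    · exact ((locFin_toEnd (fun A x => locFin_of_finite (hX.integrable A x)) A
        (m : Ind D X)).restrict N).finite
    · obtain ⟨n, hn⟩ := exists_lie_tgl_eq_zero hX.lac (m : Ind D X)
      exact ⟨n, fun A hA => Subtype.ext (hn A hA)⟩
  exact
    { grading := isZGrading_Tdeg hDC hint.submodule_iSup_eq_top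
      inTgl := fun j => hmem j _ le_rfl
      refined_internal := by
        simp only [T_toSubmodule hDC]
        exact (DirectSum.isInternal_submodule_iff_iSupIndep_and_iSup_eq_top _).2
          ⟨iSupIndep_monomialSpan hint, iSup_monomialSpan hDC hint.submodule_iSup_eq_top⟩
      refined_act := by
        intro i y hy j k m hm
        rw [← LieSubmodule.mem_toSubmodule, T_toSubmodule hDC] at hm ⊢
        exact smul_mem_monomialSpan hDC hy hm
      refined_inTgl := fun j k => hmem j _ (le_iSup (fun k => T D X C j k) k)
      refined_weights := by
        intro j k
        rw [T_toSubmodule hDC]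
        exact monomialSpan_le_weightDegree j k }

lemma Tdeg_eq_bot {σ : ℤ} (hσ : σ = 1 ∨ σ = -1) (hC : ∀ k ∈ C, 0 < σ * k)
    (hDC : ∀ i, i ∈ C ∨ i = 0 ∨ i ∈ D) {j : ℤ} (hj : σ * j < 0) : Tdeg D X C j = ⊥ := by
  rw [← LieSubmodule.toSubmodule_eq_bot, eq_bot_iff]
  refine Tdeg_le hDC fun u x hu => ?_
  exact absurd (tmk_mem_wordSpan (D := D) (N := 0) hσ hC hu x).1 (not_le.2 hj)

end InducedCategory
end WInfty

/-! ### The two induced modules, with `σ = -1` for `K^+` and `σ = 1` for `K^-`. -/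

theorem mainTheorem9 (X : Type*) [AddCommGroup X] [Module ℂ X] [LieRingModule WInfty.gl X]
    [LieModule ℂ WInfty.gl X] (hX : WInfty.InTgl X) :
    -- the weight decomposition of `X`
    DirectSum.IsInternal (WInfty.weightDegree X) ∧
    -- `K^+(X)` is in `T_W^≥` and has the grading by the `T_+^j`, `j ≤ 0`
    (WInfty.InTWge (WInfty.Kplus X) (WInfty.par {k | 0 < k} X) ∧
      WInfty.IsKacGrading {k | 0 < k} X {k | k < 0} ∧
      ∀ j : ℤ, 0 < j → WInfty.Tdeg {k | 0 < k} X {k | k < 0} j = ⊥) ∧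
    -- `K^-(X)` is in `T_W^≤` and has the grading by the `T_-^j`, `j ≥ 0`
    (WInfty.InTWle (WInfty.Kminus X) (WInfty.par {k | k < 0} X) ∧
      WInfty.IsKacGrading {k | k < 0} X {k | 0 < k} ∧
      ∀ j : ℤ, j < 0 → WInfty.Tdeg {k | k < 0} X {k | 0 < k} j = ⊥) := by
  have hplus : ∀ i : ℤ, i ∈ {k : ℤ | k < 0} ∨ i = 0 ∨ i ∈ {k : ℤ | 0 < k} := fun i =>
    lt_trichotomy i 0
  have hminus : ∀ i : ℤ, i ∈ {k : ℤ | 0 < k} ∨ i = 0 ∨ i ∈ {k : ℤ | k < 0} := fun i => by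
    rcases lt_trichotomy i 0 with h | h | h
    exacts [Or.inr (Or.inr h), Or.inr (Or.inl h), Or.inl h]
  have hneg : ∀ k ∈ {k : ℤ | k < 0}, 0 < -1 * k := fun k hk => by
    have : k < 0 := hk
    omega
  have hpos : ∀ k ∈ {k : ℤ | 0 < k}, 0 < 1 * k := fun k hk => by
    have : 0 < k := hk
    omega
  refine ⟨hX.isInternal_weightDegree, ⟨?_, ?_, fun j hj => ?_⟩, ⟨?_, ?_, fun j hj => ?_⟩⟩
  · exact WInfty.inT_ind hplus hX fun k (hk : 0 ≤ k) => hk.eq_or_lt.imp_left Eq.symm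
  · exact WInfty.isKacGrading_of_sign (Or.inr rfl) hneg hplus hX
  · exact WInfty.Tdeg_eq_bot (Or.inr rfl) hneg hplus (by omega)
  · exact WInfty.inT_ind hminus hX fun k (hk : k ≤ 0) => hk.eq_or_lt
  · exact WInfty.isKacGrading_of_sign (Or.inl rfl) hpos hminus hX
  · exact WInfty.Tdeg_eq_bot (Or.inl rfl) hpos hminus (by omega)
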